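/- Let $n=n(\lambda)$ be polynomially bounded and let $H:\{0,1\}^{\lambda+1}\to\{0,1\}^{\lambda+1}$ be a uniformly random function to which all parties have (adversaries quantum) oracle access. Consider the bit commitment scheme that commits to bits $b_1,\dots,b_n$ by $\mathsf{com}_i=H(b_i\|r_i)$ with independent uniform $r_i\in\{0,1\}^\lambda$, opens a set $T\subseteq[n]$ by revealing $(b_i,r_i)_{i\in T}$, and in which the receiver outputs $(b_i)_{i\in T}$ if $H(b_i\|r_i)=\mathsf{com}_i$ for all $i\in T$, and $\bot$ otherwise. Put $\mu(\lambda,q)=2q\sqrt{n(\lambda)}/2^{\lambda/2}$. (1) The scheme is $\mu$-equivocal: there is a simulator, which depends neither on the adversary nor on its number of queries, consisting of an interface $\mathsf{RO}$ and algorithms $\mathsf{Com}$, $\mathsf{Open}$ that share a quantum state, such that for every function $q\ge 1$, every family of quantum oracle algorithms $(\mathsf{A}_1,\mathsf{A}_2,\mathsf{D})_\lambda$ making at most $q(\lambda)$ oracle queries in total, and every $\lambda$ with $n(\lambda)^3\le 2^\lambda$ (hence for all sufficiently large $\lambda$), the probabilities that $\mathsf{D}$ outputs $1$ in the following two experiments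 differ by at most $\mu(\lambda,q(\lambda))$. Real: $\mathsf{A}_1^H$ outputs a quantum state $\rho_1$ and bits $(b_i)_{i\in[n]}$; commitments $\mathsf{com}_i$ are computed honestly; $\mathsf{A}_2^H(\rho_1,(\mathsf{com}_i)_i)$ outputs a quantum state $\rho_2$; $\mathsf{D}^H(\rho_2,(\mathsf{com}_i,b_i,r_i)_i)$ outputs a bit. Simulated: every query of $\mathsf{A}_1,\mathsf{A}_2,\mathsf{D}$ is answered by $\mathsf{RO}$, the commitments are produced by $\mathsf{Com}$ without access to the $b_i$, and the $r_i$ are produced by $\mathsf{Open}$, run after $\mathsf{A}_2$ on input $(b_i)_i$. When $q$ queries are made, the total running time of the simulator is at most $C(q^2+p(\lambda))$ for a constant $C$ and a polynomial $p$. Here the simulator is a (non-uniform) family of quantum circuits on $(\lambda+1)$-qubit words, and running time is the number of elementary word operations: XOR of a constant or of another word, bitwise AND, equality test, comparison, and the Hadamard gate on every qubit of a word. (2) Consequently the scheme is $2\mu$-hiding: for every function $q\ge1$, every family of quantum oracle algorithms $\mathsf{A}$ making at most $q(\lambda)$ queries, any two tuples of bits $(b_i)_{i\in[n]}$, $(b'_i)_{i\in[n]}$,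 and every $\lambda$ with $n(\lambda)^3\le 2^\lambda$, the probabilities that $\mathsf{A}^H((\mathsf{com}_i)_i)=1$ for commitments to $(b_i)_i$ and for commitments to $(b'_i)_i$ differ by at most $2\mu(\lambda,q(\lambda))$. -/

import Mathlib

open scoped Matrix

noncomputable section

/-! ### Bit strings -/

/-- Bit strings of length `n`; the bit with index `0` is the first (most significant) one. -/
abbrev Bits (n : ℕ) : Type := Fin n → Bool

/-- Bitwise exclusive or. -/
def Bits.xor {n : ℕ} (a b : Bits n) : Bits n := fun i => Bool.xor (a i) (b i)

/-- Bitwise conjunction. -/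
def Bits.and {n : ℕ} (a b : Bits n) : Bits n := fun i => a i && b i

/-- The string all of whose bits are `1` if `p` holds, and all of whose bits are `0` otherwise. -/
def Bits.mask {n : ℕ} (p : Prop) [Decidable p] : Bits n := fun _ => decide p

/-- The `w`-bit word `0 ⋯ 0 s` in which a shorter string `s` is stored. -/
def Bits.toWord {l : ℕ} (w : ℕ) (s : Bits l) : Bits w := fun j =>
  if h : w ≤ j.1 + l then s ⟨j.1 + l - w, by have := j.2; omega⟩ else false

/-- The string of length `l ≤ w` stored in a `w`-bit word: its last `l` bits. -/
def Bits.ofWord {l w : ℕ} (h : l ≤ w) (a : Bits w) : Bits l := fun j =>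
  a ⟨w - l + j.1, by have := j.2; omega⟩

/-! ### Quantum states and quantum operations

The joint state of a register with (finite) computational basis `R` and of a memory `M` that
belongs to the environment is given by amplitudes `R → M → ℂ`.
A (subnormalised) mixed state `ρ = ∑ |ψ⟩⟨ψ|` is represented by the list of the vectors `ψ`. -/

/-- Vectors of the joint system of a register and a memory. -/
abbrev StateVec (R M : Type) : Type := R → M → ℂ

/-- Mixed states, as finite ensembles of subnormalised vectors. -/
abbrev MixedState (R M : Type) : Type := List (StateVec R M)

/-- The trace `∑ ⟨ψ|ψ⟩` of a mixed state. All states that occur below have finitely many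
nonzero amplitudes. -/
def MixedState.trace {R M : Type} [Fintype R] (e : MixedState R M) : ℝ :=
  (e.map fun ψ => ∑ r, ∑' m, ‖ψ r m‖ ^ 2).sum

/-- A quantum operation (completely positive trace preserving map), in Kraus form, from a
register `R` to a register `R'` which in addition has a classical outcome in `B`. -/
structure QInstrument (R R' B : Type) [Fintype R] [DecidableEq R] [Fintype R'] [Fintype B] where
  rank : ℕ
  kraus : B → Fin rank → Matrix R' R ℂ
  complete : ∑ b, ∑ k, (kraus b k)ᴴ * kraus b k = 1

/-- A quantum operation without classical outcome. -/
abbrev QChannel (R R' : Type) [Fintype R] [DecidableEq R] [Fintype R'] : Type :=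
  QInstrument R R' Unit

/-- `(K ⊗ 1) ψ`. -/
def applyMatrix {R R' M : Type} [Fintype R] (K : Matrix R' R ℂ) (ψ : StateVec R M) :
    StateVec R' M :=
  fun r' m => ∑ r, K r' r * ψ r m

/-- The subnormalised state after the operation, given the classical outcome `b`: its trace is
the probability of `b`. -/
def QInstrument.apply {R R' B M : Type} [Fintype R] [DecidableEq R] [Fintype R'] [Fintype B]
    (A : QInstrument R R' B) (b : B) (e : MixedState R M) : MixedState R' M :=
  e.flatMap fun ψ => List.ofFn fun k => applyMatrix (A.kraus b k) ψ

/-! ### Quantum oracle algorithms -/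

/-- The register of an oracle algorithm: oracle input register, oracle output register and a
workspace of dimension `d`. -/
abbrev QReg (w d : ℕ) : Type := Bits w × Bits w × Fin d

/-- A quantum oracle algorithm for an oracle `{0,1}^w → {0,1}^w`: arbitrary quantum operations
`A₁, …, A_{q+1}` between which `q` oracle queries are made. It takes a quantum state on `R`, and
outputs a quantum state on `R'` together with a classical value in `B`.
(`A_{q+1}` is split into the last step and the map `final` to the output.) -/
structure OracleAlg (w : ℕ) (R R' B : Type) [Fintype R] [DecidableEq R] [Fintype R']
    [Fintype B] where
  dim : ℕ
  prep : QChannel R (QReg w dim)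
  steps : List (QChannel (QReg w dim) (QReg w dim))
  final : QInstrument (QReg w dim) R' B

/-- The number of oracle queries. -/
def OracleAlg.queries {w : ℕ} {R R' B : Type} [Fintype R] [DecidableEq R] [Fintype R']
    [Fintype B] (A : OracleAlg w R R' B) : ℕ :=
  A.steps.length

/-- What answers oracle queries: the effect of the `j`-th query (counted from `0`) on the
algorithm's register and the memory `M` of the oracle. -/
abbrev OracleWorld (w : ℕ) (M : Type) : Type :=
  ℕ → (d : ℕ) → StateVec (QReg w d) M → StateVec (QReg w d) M

/-- Alternately make a query and apply an operation; `j` queries were made before. -/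
def runSteps {w d : ℕ} {M : Type} (Q : OracleWorld w M) :
    ℕ → List (QChannel (QReg w d) (QReg w d)) →
      MixedState (QReg w d) M → MixedState (QReg w d) M
  | _, [], e => e
  | j, A :: As, e => runSteps Q (j + 1) As (A.apply () (e.map (Q j d)))

/-- The subnormalised output state of an oracle algorithm for classical outcome `b`, when it is
started on `e` after `j` queries have been made to the same oracle. -/
def OracleAlg.run {w : ℕ} {R R' B M : Type} [Fintype R] [DecidableEq R] [Fintype R']
    [Fintype B] (A : OracleAlg w R R' B) (Q : OracleWorld w M) (j : ℕ) (b : B)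
    (e : MixedState R M) : MixedState R' M :=
  A.final.apply b (runSteps Q j A.steps (A.prep.apply () e))

/-- Quantum access to a function `H`, i.e. `|x⟩|y⟩ ↦ |x⟩|y ⊕ H x⟩`; there is no memory. -/
def functionOracle {w : ℕ} (H : Bits w → Bits w) : OracleWorld w Unit :=
  fun _ _ ψ r m => ψ (r.1, r.2.1.xor (H r.1), r.2.2) m

/-- The state `|0⟩` of the trivial one-dimensional register, without memory. -/
def trivialState : MixedState (Fin 1) Unit := [fun _ _ => 1]

/-- The average of a function over a finite type. -/
def average {α : Type} [Fintype α] (f : α → ℝ) : ℝ := (∑ a, f a) / (Fintype.card α : ℝ)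

/-! ### Non-interactive commitment schemes with partial opening -/

/-- A non-interactive commitment scheme with partial opening in the quantum random oracle model,
for `n` messages in parallel and an oracle `H : {0,1}^w → {0,1}^w`. Messages, commitments and
openings are strings of at most `w` bits; `commit` is given uniformly random coins. -/
structure CommitmentScheme (w n : ℕ) where
  msgLen : ℕ
  comLen : ℕ
  opnLen : ℕ
  msgLen_le : msgLen ≤ w
  comLen_le : comLen ≤ w
  opnLen_le : opnLen ≤ w
  Coins : Type
  State : Type
  coinsFintype : Fintype Coins
  coinsNonempty : Nonempty Coins
  commit : (Bits w → Bits w) → (Fin n → Bits msgLen) → Coins → (Fin n → Bits comLen) × State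
  opening : (Bits w → Bits w) → State → (T : Finset (Fin n)) → (T → Bits msgLen × Bits opnLen)
  receive : (Bits w → Bits w) → (Fin n → Bits comLen) → (T : Finset (Fin n)) →
    (T → Bits msgLen × Bits opnLen) → Option (T → Bits msgLen)

attribute [instance] CommitmentScheme.coinsFintype

/-- The concatenation `b ‖ r`. -/
def hashInput {l : ℕ} (b : Bits 1) (r : Bits l) : Bits (l + 1) := Fin.cons (b 0) r

open Classical in
/-- The bit commitment scheme in which the commitment to `b` is `H (b ‖ r)`, for a uniformly
random `r ∈ {0,1}^l` and a random oracle `H : {0,1}^(l+1) → {0,1}^(l+1)`. -/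
def hashCommitment (l n : ℕ) : CommitmentScheme (l + 1) n where
  msgLen := 1
  comLen := l + 1
  opnLen := l
  msgLen_le := Nat.le_add_left 1 l
  comLen_le := le_refl _
  opnLen_le := Nat.le_succ l
  Coins := Fin n → Bits l
  State := Fin n → Bits 1 × Bits l
  coinsFintype := inferInstance
  coinsNonempty := inferInstance
  commit := fun H b r => (fun i => H (hashInput (b i) (r i)), fun i => (b i, r i))
  opening := fun _ st _ i => st i.1
  receive := fun H com T z =>
    if ∃ i : T, H (hashInput (z i).1 (z i).2) ≠ com i.1 then none else some fun i => (z i).1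

/-! ### Hiding -/

/-- An adversary against hiding: an oracle algorithm with a one-bit output whose classical input
is the tuple of commitments. -/
abbrev HidingAdversary {w n : ℕ} (S : CommitmentScheme w n) : Type :=
  (Fin n → Bits S.comLen) → OracleAlg w (Fin 1) (Fin 1) Bool

/-- The probability that `Adv^H({com_i}) = 1` for an honest commitment to `m`. -/
def hidingProb {w n : ℕ} (S : CommitmentScheme w n) (Adv : HidingAdversary S)
    (m : Fin n → Bits S.msgLen) : ℝ :=
  average fun H : Bits w → Bits w => average fun coins : S.Coins =>
    ((Adv (S.commit H m coins).1).run (functionOracle H) 0 true trivialState).trace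

/-- `μ`-hiding, at the security parameters in `Λ`, of a family of schemes. -/
def IsHiding {w n : ℕ → ℕ} (S : ∀ l, CommitmentScheme (w l) (n l)) (Λ : Set ℕ)
    (μ : ℕ → ℕ → ℝ) : Prop :=
  ∀ (q : ℕ → ℕ) (Adv : ∀ l, HidingAdversary (S l))
    (m₀ m₁ : ∀ l, Fin (n l) → Bits (S l).msgLen),
    (∀ l, 1 ≤ q l) → (∀ l com, (Adv l com).queries ≤ q l) →
    ∀ l ∈ Λ, |hidingProb (S l) (Adv l) (m₀ l) - hidingProb (S l) (Adv l) (m₁ l)| ≤ μ l (q l)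

/-! ### Quantum circuits over words, with unit cost per word operation -/

/-- Elementary operations of a quantum machine whose memory cells (addressed by `L`) hold
`w`-qubit words. -/
inductive Instr (w : ℕ) (L : Type) : Type
  /-- `|t⟩ ↦ |t ⊕ c⟩` for a constant word `c` -/
  | const (c : Bits w) (t : L) : Instr w L
  /-- `|a⟩|t⟩ ↦ |a⟩|t ⊕ a⟩` -/
  | xor (a t : L) (h : a ≠ t) : Instr w L
  /-- `|a⟩|b⟩|t⟩ ↦ |a⟩|b⟩|t ⊕ (a ∧ b)⟩`, with bitwise conjunction -/
  | and (a b t : L) (ha : a ≠ t) (hb : b ≠ t) : Instr w L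
  /-- `|a⟩|b⟩|t⟩ ↦ |a⟩|b⟩|t ⊕ [a = b]⟩`, where a truth value is written as a mask -/
  | eq (a b t : L) (ha : a ≠ t) (hb : b ≠ t) : Instr w L
  /-- `|a⟩|b⟩|t⟩ ↦ |a⟩|b⟩|t ⊕ [a < b]⟩`, for the order of binary numbers -/
  | lt (a b t : L) (ha : a ≠ t) (hb : b ≠ t) : Instr w L
  /-- the Hadamard gate on every qubit of `t` -/
  | hadamard (t : L) : Instr w L

open Classical in
/-- The unitary of an elementary operation, on amplitudes indexed by memory contents. (All
operations except the Hadamard transform are involutions of the computational basis.) -/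
def Instr.apply {w : ℕ} {L : Type} (g : Instr w L) (φ : (L → Bits w) → ℂ) :
    (L → Bits w) → ℂ := fun m =>
  match g with
  | .const c t => φ (Function.update m t ((m t).xor c))
  | .xor a t _ => φ (Function.update m t ((m t).xor (m a)))
  | .and a b t _ _ => φ (Function.update m t ((m t).xor ((m a).and (m b))))
  | .eq a b t _ _ => φ (Function.update m t ((m t).xor (Bits.mask (m a = m b))))
  | .lt a b t _ _ => φ (Function.update m t ((m t).xor (Bits.mask (toLex (m a) < toLex (m b)))))
  | .hadamard t =>
      ((Real.sqrt 2 : ℂ) ^ w)⁻¹ *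
        ∑ v : Bits w, (∏ i, if m t i && v i then (-1 : ℂ) else 1) * φ (Function.update m t v)

/-- A circuit is a list of elementary operations, carried out from left to right. Its running
time is its length. -/
abbrev Circuit (w : ℕ) (L : Type) : Type := List (Instr w L)

/-- The unitary of a circuit. -/
def Circuit.apply {w : ℕ} {L : Type} (c : Circuit w L) (φ : (L → Bits w) → ℂ) :
    (L → Bits w) → ℂ :=
  c.foldl (fun φ g => g.apply φ) φ

/-! ### Equivocality -/

/-- The memory cells of an equivocation simulator: cells in which it outputs commitments, cells
in which it is given messages, cells in which it outputs openings, and work cells. -/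
inductive SimCell : Type
  | com (i : ℕ)
  | msg (i : ℕ)
  | opn (i : ℕ)
  | work (i : ℕ)

/-- The cells accessible to the random oracle interface of a simulator: the input word and the
output word of the query at hand, and the cells of the simulator. -/
inductive QueryCell : Type
  | input
  | output
  | own (c : SimCell)

/-- The contents of a simulator's memory. -/
abbrev SimMemory (w : ℕ) : Type := SimCell → Bits w

/-- An equivocation simulator: circuits, acting on a common quantum memory, for the
initialisation, for the random oracle interface (`ro j` answers the query made after `j` earlier
ones), for producing commitments, and for producing openings. -/
structure EquivSimulator (w : ℕ) where
  init : Circuit w SimCell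
  ro : ℕ → Circuit w QueryCell
  com : Circuit w SimCell
  opn : Circuit w SimCell

/-- The total running time of a simulator that answers `q` queries. -/
def EquivSimulator.runtime {w : ℕ} (S : EquivSimulator w) (q : ℕ) : ℕ :=
  S.init.length + (∑ j ∈ Finset.range q, (S.ro j).length) + S.com.length + S.opn.length

/-- Answering queries with the random oracle interface of a simulator. -/
def EquivSimulator.world {w : ℕ} (S : EquivSimulator w) : OracleWorld w (SimMemory w) :=
  fun j _ ψ r m =>
    Circuit.apply (S.ro j)
      (fun c => ψ (c .input, c .output, r.2.2) (fun s => c (.own s)))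
      (fun | .input => r.1 | .output => r.2.1 | .own s => m s)

/-- Applying a circuit to the memory only. -/
def onMemory {w : ℕ} {R : Type} (c : Circuit w SimCell) (e : MixedState R (SimMemory w)) :
    MixedState R (SimMemory w) :=
  e.map fun ψ r => Circuit.apply c (ψ r)

open Classical in
/-- Projection of the memory onto the contents that satisfy `p`. -/
def project {R M : Type} (p : M → Prop) (e : MixedState R M) : MixedState R M :=
  e.map fun ψ r m => if p m then ψ r m else 0

/-- Writing (by exclusive or) the messages `m` to the message cells. -/
def loadMessages {w n k : ℕ} {R : Type} (m : Fin n → Bits k)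
    (e : MixedState R (SimMemory w)) : MixedState R (SimMemory w) :=
  e.map fun ψ r μ => ψ r fun
    | .msg i => if h : i < n then (μ (.msg i)).xor ((m ⟨i, h⟩).toWord w) else μ (.msg i)
    | c => μ c

open Classical in
/-- The state before the adversary starts: an empty adversary register, and the simulator's
memory with all cells zero. -/
def blankState (w : ℕ) : MixedState (Fin 1) (SimMemory w) :=
  [fun _ m => if m = fun _ _ => false then 1 else 0]

/-- An adversary against equivocality. `rcommit` outputs a state `ρ₁` and messages, `ropen` gets
`ρ₁` and the commitments and outputs a state `ρ₂`, and `dist` gets `ρ₂` and all commitments,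
messages and openings and outputs a bit. -/
structure EquivAdversary {w n : ℕ} (S : CommitmentScheme w n) where
  dim₁ : ℕ
  dim₂ : ℕ
  rcommit : OracleAlg w (Fin 1) (Fin dim₁) (Fin n → Bits S.msgLen)
  ropen : (Fin n → Bits S.comLen) → OracleAlg w (Fin dim₁) (Fin dim₂) Unit
  dist : (Fin n → Bits S.comLen × Bits S.msgLen × Bits S.opnLen) →
    OracleAlg w (Fin dim₂) (Fin 1) Bool

/-- The adversary makes at most `q` oracle queries in total. -/
def EquivAdversary.QueriesLE {w n : ℕ} {S : CommitmentScheme w n} (Adv : EquivAdversary S)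
    (q : ℕ) : Prop :=
  ∀ com z, Adv.rcommit.queries + (Adv.ropen com).queries + (Adv.dist z).queries ≤ q

/-- The probability that the distinguisher outputs `1` in the real experiment. -/
def realProb {w n : ℕ} (S : CommitmentScheme w n) (Adv : EquivAdversary S) : ℝ :=
  average fun H : Bits w → Bits w => average fun coins : S.Coins =>
    ∑ m : Fin n → Bits S.msgLen,
      let Q := functionOracle H
      let ρ₁ := Adv.rcommit.run Q 0 m trivialState
      let com := (S.commit H m coins).1
      let st := (S.commit H m coins).2
      let ρ₂ := (Adv.ropen com).run Q 0 () ρ₁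
      let z := fun i => (com i, S.opening H st Finset.univ ⟨i, Finset.mem_univ i⟩)
      ((Adv.dist z).run Q 0 true ρ₂).trace

/-- The probability that the distinguisher outputs `1` in the simulated experiment. The sums are
over the messages chosen by the adversary and over the results of measuring the commitment cells
and the opening cells of the simulator. -/
def simProb {w n : ℕ} (S : CommitmentScheme w n) (Sim : EquivSimulator w)
    (Adv : EquivAdversary S) : ℝ :=
  let Q := Sim.world
  ∑ m : Fin n → Bits S.msgLen, ∑ com : Fin n → Bits S.comLen, ∑ u : Fin n → Bits S.opnLen,
    let j₁ := Adv.rcommit.queries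
    let j₂ := j₁ + (Adv.ropen com).queries
    let ρ₁ := Adv.rcommit.run Q 0 m (onMemory Sim.init (blankState w))
    let σ₁ := project (fun μ => ∀ i : Fin n, (μ (.com i)).ofWord S.comLen_le = com i)
      (onMemory Sim.com ρ₁)
    let ρ₂ := (Adv.ropen com).run Q j₁ () σ₁
    let σ₂ := project (fun μ => ∀ i : Fin n, (μ (.opn i)).ofWord S.opnLen_le = u i)
      (onMemory Sim.opn (loadMessages m ρ₂))
    ((Adv.dist fun i => (com i, m i, u i)).run Q j₂ true σ₂).trace

/-- `μ`-equivocality, at the security parameters in `Λ`, of a family of schemes, with a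
simulator whose total running time for `q` queries is at most `s l q`. -/
def IsEquivocal {w n : ℕ → ℕ} (S : ∀ l, CommitmentScheme (w l) (n l)) (Λ : Set ℕ)
    (μ : ℕ → ℕ → ℝ) (s : ℕ → ℕ → ℕ) : Prop :=
  ∃ Sim : ∀ l, EquivSimulator (w l),
    (∀ l q, (Sim l).runtime q ≤ s l q) ∧
    ∀ (q : ℕ → ℕ) (Adv : ∀ l, EquivAdversary (S l)),
      (∀ l, 1 ≤ q l) → (∀ l, (Adv l).QueriesLE (q l)) →
      ∀ l ∈ Λ, |realProb (S l) (Adv l) - simProb (S l) (Sim l) (Adv l)| ≤ μ l (q l)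

end

/-!
The proof keeps the random function `H` in a memory register, as the label of a superposition
`ψ r H` with unit weight on each `H`; a query is then the operation `ctrl`, and a run with the
function `H` is the restriction of this one run to the label `H` (`atLabel_run`).

**Two hybrids.** Let `x_i = b_i ‖ r_i`, and let `H'` be `H` reprogrammed to fresh uniform values
`c_i` at the points `x_i`. The simulated experiment equals the one in which the commitments are
the `c_i`, the first two adversaries use `H`, and the distinguisher uses `H'`. The real experiment
is compared with it in two steps.

* In the real experiment, `(H, H(x_i))` and `(H', c_i)` have the same distribution (`exchange`), so
  that it becomes the experiment in which only the first adversary uses `H` and everyone later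
  uses `H'`, up to the distance of the first adversary's states for `H` and for `H'`. By Parseval,
  this is twice the Fourier weight of the state on the characters `∏ x, (-1) ^ (F x · H x)` with
  some `F x_i ≠ 0` (`sum_norm_sub_resample`). A query changes `F` at one point only, so that
  after `q₁` queries `F` has at most `q₁` nonzero values (`sparse`), and the average over the
  `r_i` of this weight is at most `n q₁ / 2 ^ l` (`sum_touchWeight_le`).
* The second adversary does not know the `r_i`, and one of its queries hits some `x_i` with
  average weight at most `n / 2 ^ l`; the states for `H` and `H'` move apart by at most
  `2 √(n / 2 ^ l)` per query (`OracleAlg.wt_sub_run_le`).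

With the probability of a collision among the `r_i`, which `n ^ 3 ≤ 2 ^ l` bounds by
`√(n / 2 ^ l) / 2` (`collision_le`), the losses add up to `√(2 q₁) + 2 q₂ + 1 / 2`, in units of
`√(n / 2 ^ l)`. This is at most `2 q` for `q₁ ≥ 1`. For `q₁ = 0` the first query of the second
adversary meets a uniformly random value independent of everything else, and costs only `√2`
(`OracleAlg.wt_sub_run_const_le`); this saves what the collisions cost. The result is
`abs_sum_realSum_sub_le`. Hiding needs only the second step, for an adversary with `q₁ = 0`,
and a comparison of both commitments with uniformly random ones (`abs_hidingProb_sub_le`).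

**The simulator** holds the Fourier transform of the state `ψ r` in its memory: the basis vector
`F` is stored as the list of pairs `(x, F x)` with `F x ≠ 0`, in decreasing order of `x`
(`dbMem`). The embedding `push` multiplies norms by a constant and intertwines `ctrl` with the
circuit `answer` (`push_intertwines`): between two Hadamard transforms of the output word, a query
to `H` is the update `F x ↦ F x ⊕ u` of the list. This update is an involution on lists, and the
circuit computes each slot of the new list from its neighbours in the old one, in linearly many
word operations in the number of slots (`exec_updateCircuit`); hence the quadratic running time.
Commitments and openings are measurements of uniform superpositions, and after the opening the
interface replaces `H x_i` by the commitment, with masks that compare `x` with all the `x_i`.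
Thus the simulated probability is exactly the one of the hybrid (`simProb_eq`).
-/

noncomputable section

/-! ### Linear maps of the memory -/

/-- A linear map of the memory, applied to a joint state of a register and the memory. -/
def onMem {R M M' : Type} (Λ : (M → ℂ) →ₗ[ℂ] (M' → ℂ)) (ψ : StateVec R M) : StateVec R M' :=
  fun r => Λ (ψ r)

/-- Restriction of the amplitudes along a map of memory labels. -/
def pull {M M' : Type} (f : M' → M) : (M → ℂ) →ₗ[ℂ] (M' → ℂ) := LinearMap.funLeft ℂ ℂ f

@[simp] lemma pull_apply {M M' : Type} (f : M' → M) (φ : M → ℂ) (m : M') :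
    pull f φ m = φ (f m) := rfl

lemma applyMatrix_eq_sum {R R' M : Type} [Fintype R] (K : Matrix R' R ℂ) (ψ : StateVec R M)
    (r' : R') : applyMatrix K ψ r' = ∑ r, K r' r • ψ r := by
  funext m
  simp [applyMatrix, Finset.sum_apply]

lemma applyMatrix_onMem {R R' M M' : Type} [Fintype R] (Λ : (M → ℂ) →ₗ[ℂ] (M' → ℂ))
    (K : Matrix R' R ℂ) (ψ : StateVec R M) :
    applyMatrix K (onMem Λ ψ) = onMem Λ (applyMatrix K ψ) := by
  funext r'
  simp only [onMem, applyMatrix_eq_sum, map_sum, map_smul]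

lemma QInstrument.apply_map_onMem {R R' B M M' : Type} [Fintype R] [DecidableEq R] [Fintype R']
    [Fintype B] (A : QInstrument R R' B) (b : B) (Λ : (M → ℂ) →ₗ[ℂ] (M' → ℂ))
    (e : MixedState R M) :
    A.apply b (e.map (onMem Λ)) = (A.apply b e).map (onMem Λ) := by
  simp only [QInstrument.apply, List.flatMap_map, List.map_flatMap, List.map_ofFn]
  congr 1
  funext ψ
  congr 1
  funext k
  exact applyMatrix_onMem Λ _ ψ

/-- All memory components of all vectors of an ensemble lie in the subspace `W`. -/
def MemIn {R M : Type} (W : Submodule ℂ (M → ℂ)) (e : MixedState R M) : Prop :=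
  ∀ ψ ∈ e, ∀ r, ψ r ∈ W

lemma memIn_top {R M : Type} (e : MixedState R M) : MemIn ⊤ e := fun _ _ _ => trivial

lemma QInstrument.memIn_apply {R R' B M : Type} [Fintype R] [DecidableEq R] [Fintype R']
    [Fintype B] (A : QInstrument R R' B) (b : B) {W : Submodule ℂ (M → ℂ)}
    {e : MixedState R M} (he : MemIn W e) : MemIn W (A.apply b e) := by
  intro φ hφ r
  simp only [QInstrument.apply, List.mem_flatMap, List.mem_ofFn] at hφ
  obtain ⟨ψ, hψ, k, rfl⟩ := hφ
  rw [applyMatrix_eq_sum]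
  exact W.sum_mem fun r _ => W.smul_mem _ (he ψ hψ r)

/-- `Λ` intertwines the oracles `Q` and `Q'`, as long as before the `j`-th query the memory is in
the subspace `W j`. -/
def Intertwines {w : ℕ} {M M' : Type} (Λ : (M → ℂ) →ₗ[ℂ] (M' → ℂ)) (W : ℕ → Submodule ℂ (M → ℂ))
    (Q : OracleWorld w M) (Q' : OracleWorld w M') : Prop :=
  ∀ j d ψ, (∀ r, ψ r ∈ W j) →
    Q' j d (onMem Λ ψ) = onMem Λ (Q j d ψ) ∧ ∀ r, Q j d ψ r ∈ W (j + 1)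

lemma Intertwines.runSteps {w d : ℕ} {M M' : Type} {Λ : (M → ℂ) →ₗ[ℂ] (M' → ℂ)}
    {W : ℕ → Submodule ℂ (M → ℂ)} {Q : OracleWorld w M} {Q' : OracleWorld w M'}
    (h : Intertwines Λ W Q Q') (As : List (QChannel (QReg w d) (QReg w d))) :
    ∀ (j : ℕ) (e : MixedState (QReg w d) M), MemIn (W j) e →
      runSteps Q' j As (e.map (onMem Λ)) = (runSteps Q j As e).map (onMem Λ) ∧
        MemIn (W (j + As.length)) (runSteps Q j As e) := by
  induction As with
  | nil => intro j e he; exact ⟨rfl, he⟩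
  | cons A As ih =>
    intro j e he
    have h1 : (e.map (onMem Λ)).map (Q' j d) = (e.map (Q j d)).map (onMem Λ) := by
      rw [List.map_map, List.map_map]
      exact List.map_congr_left fun ψ hψ => (h j d ψ (he ψ hψ)).1
    have h2 : MemIn (W (j + 1)) (e.map (Q j d)) := by
      intro φ hφ
      obtain ⟨ψ, hψ, rfl⟩ := List.mem_map.1 hφ
      exact (h j d ψ (he ψ hψ)).2
    have h3 := ih (j + 1) _ (A.memIn_apply () h2)
    simp only [_root_.runSteps]
    rw [h1, QInstrument.apply_map_onMem]
    refine ⟨h3.1, ?_⟩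
    rw [List.length_cons, Nat.add_comm As.length, ← Nat.add_assoc]
    exact h3.2

/-- Oracle algorithms only act on their register: intertwined oracles lead to runs that are
related by the same map of the memory. -/
lemma Intertwines.run {w : ℕ} {R R' B M M' : Type} [Fintype R] [DecidableEq R] [Fintype R']
    [Fintype B] {Λ : (M → ℂ) →ₗ[ℂ] (M' → ℂ)}
    {W : ℕ → Submodule ℂ (M → ℂ)} {Q : OracleWorld w M} {Q' : OracleWorld w M'}
    (h : Intertwines Λ W Q Q') (A : OracleAlg w R R' B) (j : ℕ) (b : B) {e : MixedState R M}
    (he : MemIn (W j) e) :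
    A.run Q' j b (e.map (onMem Λ)) = (A.run Q j b e).map (onMem Λ) ∧
      MemIn (W (j + A.queries)) (A.run Q j b e) := by
  have h1 := h.runSteps A.steps j _ (A.prep.memIn_apply () he)
  simp only [OracleAlg.run, QInstrument.apply_map_onMem, h1.1]
  exact ⟨trivial, A.final.memIn_apply b h1.2⟩

/-! ### Oracles controlled by the memory -/

/-- Quantum access to the function `g m` that is determined by the contents `m` of the memory. -/
def ctrl {w : ℕ} {M : Type} (g : M → Bits w → Bits w) : OracleWorld w M :=
  fun _ _ ψ r m => ψ (r.1, r.2.1.xor (g m r.1), r.2.2) m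

lemma ctrl_intertwines_pull {w : ℕ} {M M' : Type} (g : M → Bits w → Bits w) (f : M' → M) :
    Intertwines (pull f) (fun _ => ⊤) (ctrl g) (ctrl fun m => g (f m)) :=
  fun _ _ _ _ => ⟨rfl, fun _ => trivial⟩

lemma OracleAlg.run_map_pull {w : ℕ} {R R' B M M' : Type} [Fintype R] [DecidableEq R]
    [Fintype R'] [Fintype B] (A : OracleAlg w R R' B) (g : M → Bits w → Bits w) (f : M' → M)
    (j j' : ℕ) (b : B) (e : MixedState R M) :
    A.run (ctrl fun m => g (f m)) j b (e.map (onMem (pull f))) =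
      (A.run (ctrl g) j' b e).map (onMem (pull f)) := by
  have h : ∀ (As : List (QChannel (QReg w A.dim) (QReg w A.dim))) (j j' : ℕ) e,
      _root_.runSteps (ctrl g) j As e = _root_.runSteps (ctrl g) j' As e := by
    intro As
    induction As with
    | nil => intros; rfl
    | cons A As ih => intro j j' e; exact ih _ _ _
  rw [((ctrl_intertwines_pull g f).run A j b (memIn_top e)).1]
  simp only [OracleAlg.run, h A.steps j j']

/-! ### Norms of ensembles -/

/-- The squared norm of a vector, for a finite memory. -/
def sqn {R M : Type} [Fintype R] [Fintype M] (ψ : StateVec R M) : ℝ := ∑ r, ∑ m, ‖ψ r m‖ ^ 2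

/-- The sum of the squared norms of the vectors of an ensemble, after a map of the memory. -/
def wt {R M M' : Type} [Fintype R] [Fintype M'] (Λ : (M → ℂ) →ₗ[ℂ] (M' → ℂ))
    (e : MixedState R M) : ℝ :=
  (e.map fun ψ => sqn (onMem Λ ψ)).sum

lemma sqn_nonneg {R M : Type} [Fintype R] [Fintype M] (ψ : StateVec R M) : 0 ≤ sqn ψ :=
  Finset.sum_nonneg fun _ _ => Finset.sum_nonneg fun _ _ => by positivity

lemma wt_nonneg {R M M' : Type} [Fintype R] [Fintype M'] (Λ : (M → ℂ) →ₗ[ℂ] (M' → ℂ))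
    (e : MixedState R M) : 0 ≤ wt Λ e :=
  List.sum_nonneg fun x hx => by
    obtain ⟨ψ, -, rfl⟩ := List.mem_map.1 hx
    exact sqn_nonneg _

lemma trace_map_onMem {R M M' : Type} [Fintype R] [Fintype M'] (Λ : (M → ℂ) →ₗ[ℂ] (M' → ℂ))
    (e : MixedState R M) : MixedState.trace (e.map (onMem Λ)) = wt Λ e := by
  simp only [MixedState.trace, wt, sqn, List.map_map, Function.comp_def, tsum_fintype]

lemma wt_map_onMem {R M M' M'' : Type} [Fintype R] [Fintype M''] (Λ : (M → ℂ) →ₗ[ℂ] (M' → ℂ))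
    (Λ' : (M' → ℂ) →ₗ[ℂ] (M'' → ℂ)) (e : MixedState R M) :
    wt Λ' (e.map (onMem Λ)) = wt (Λ' ∘ₗ Λ) e := by
  simp only [wt, List.map_map, Function.comp_def]
  rfl

lemma list_sum_map_sum {α ι : Type*} (s : Finset ι) (l : List α) (f : ι → α → ℝ) :
    (l.map fun a => ∑ i ∈ s, f i a).sum = ∑ i ∈ s, (l.map (f i)).sum := by
  induction l with
  | nil => simp
  | cons a l ih => simp [ih, Finset.sum_add_distrib]

/-- A weight is the sum of the weights at the labels of the memory. -/
lemma wt_eq_sum_pull {R M M' : Type} [Fintype R] [Fintype M'] (Λ : (M → ℂ) →ₗ[ℂ] (M' → ℂ))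
    (e : MixedState R M) :
    wt Λ e = ∑ m, wt (pull (fun _ : Unit => m) ∘ₗ Λ) e := by
  simp only [wt, ← list_sum_map_sum]
  congr 2
  funext ψ
  simp only [sqn, onMem, LinearMap.comp_apply, pull_apply, Finset.univ_unique,
    Finset.sum_singleton]
  exact Finset.sum_comm

/-- `∑ ‖K ψ‖² = ‖ψ‖²` over the Kraus operators of a trace preserving operation. -/
lemma QInstrument.sum_sqn {R R' B M : Type} [Fintype R] [DecidableEq R] [Fintype R'] [Fintype B]
    [Fintype M] (A : QInstrument R R' B) (ψ : StateVec R M) :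
    ∑ b, ∑ k, sqn (applyMatrix (A.kraus b k) ψ) = sqn ψ := by
  have key : ∀ (K : Matrix R' R ℂ) (m : M),
      ((∑ r', ‖applyMatrix K ψ r' m‖ ^ 2 : ℝ) : ℂ) =
        star (fun r => ψ r m) ⬝ᵥ ((Kᴴ * K) *ᵥ fun r => ψ r m) := by
    intro K m
    rw [← Matrix.mulVec_mulVec, Matrix.dotProduct_mulVec, ← Matrix.star_mulVec]
    simp only [dotProduct, Pi.star_apply, applyMatrix, Matrix.mulVec]
    push_cast
    refine Finset.sum_congr rfl fun r' _ => ?_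
    rw [← Complex.conj_mul']
    rfl
  have h2 : ∀ m : M, ∑ b, ∑ k, ∑ r', ‖applyMatrix (A.kraus b k) ψ r' m‖ ^ 2 =
      ∑ r, ‖ψ r m‖ ^ 2 := by
    intro m
    have : ((∑ b, ∑ k, ∑ r', ‖applyMatrix (A.kraus b k) ψ r' m‖ ^ 2 : ℝ) : ℂ) =
        ((∑ r, ‖ψ r m‖ ^ 2 : ℝ) : ℂ) := by
      rw [Complex.ofReal_sum]
      simp only [Complex.ofReal_sum _ (fun k => ∑ r', ‖applyMatrix (A.kraus _ k) ψ r' m‖ ^ 2)]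
      simp only [key, ← dotProduct_sum, ← Matrix.sum_mulVec, A.complete, Matrix.one_mulVec]
      simp only [dotProduct, Pi.star_apply]
      push_cast
      refine Finset.sum_congr rfl fun r' _ => ?_
      rw [← Complex.conj_mul']
      rfl
    exact_mod_cast this
  calc ∑ b, ∑ k, sqn (applyMatrix (A.kraus b k) ψ)
      = ∑ m, ∑ b, ∑ k, ∑ r', ‖applyMatrix (A.kraus b k) ψ r' m‖ ^ 2 := by
        symm
        rw [Finset.sum_comm]
        refine Finset.sum_congr rfl fun b _ => ?_
        rw [Finset.sum_comm]
        exact Finset.sum_congr rfl fun k _ => Finset.sum_comm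
    _ = sqn ψ := by simp only [h2, sqn]; exact Finset.sum_comm

/-- Quantum operations preserve all weights, summed over the outcomes. -/
lemma QInstrument.sum_wt {R R' B M M' : Type} [Fintype R] [DecidableEq R] [Fintype R']
    [Fintype B] [Fintype M'] (A : QInstrument R R' B) (Λ : (M → ℂ) →ₗ[ℂ] (M' → ℂ))
    (e : MixedState R M) : ∑ b, wt Λ (A.apply b e) = wt Λ e := by
  induction e with
  | nil => simp [wt, QInstrument.apply]
  | cons ψ e ih =>
    have h : ∀ b, wt Λ (A.apply b (ψ :: e)) =
        ∑ k, sqn (applyMatrix (A.kraus b k) (onMem Λ ψ)) + wt Λ (A.apply b e) := by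
      intro b
      simp [wt, QInstrument.apply, List.sum_ofFn, applyMatrix_onMem]
    simp only [h, Finset.sum_add_distrib, A.sum_sqn, ih]
    simp [wt]

lemma QInstrument.wt_apply {R R' M M' : Type} [Fintype R] [DecidableEq R] [Fintype R']
    [Fintype M'] (A : QChannel R R') (Λ : (M → ℂ) →ₗ[ℂ] (M' → ℂ))
    (e : MixedState R M) : wt Λ (A.apply () e) = wt Λ e := by
  rw [← A.sum_wt Λ e]
  simp

lemma Bits.xor_xor_cancel {w : ℕ} (a b : Bits w) : (a.xor b).xor b = a := by
  funext i; simp [Bits.xor]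

/-- The permutation `y ↦ y ⊕ c`. -/
def Bits.xorEquiv {w : ℕ} (c : Bits w) : Bits w ≃ Bits w where
  toFun y := y.xor c
  invFun y := y.xor c
  left_inv y := y.xor_xor_cancel c
  right_inv y := y.xor_xor_cancel c

lemma sqn_ctrl {w d : ℕ} {M : Type} [Fintype M] (g : M → Bits w → Bits w) (j : ℕ)
    (ψ : StateVec (QReg w d) M) : sqn (ctrl g j d ψ) = sqn ψ := by
  simp only [sqn, ctrl, Fintype.sum_prod_type]
  refine Finset.sum_congr rfl fun x _ => ?_
  have hc : ∀ f : Bits w → Fin d → M → ℝ, ∑ y, ∑ z, ∑ m, f y z m = ∑ m, ∑ y, ∑ z, f y z m :=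
    fun f => by
      rw [Finset.sum_comm (γ := M)]
      exact Finset.sum_congr rfl fun y _ => Finset.sum_comm
  rw [hc, hc]
  refine Finset.sum_congr rfl fun m _ => ?_
  exact (Bits.xorEquiv (g m x)).sum_comp fun y => ∑ z, ‖ψ (x, y, z) m‖ ^ 2

lemma wt_map_ctrl {w d : ℕ} {M M' : Type} [Fintype M'] {Λ : (M → ℂ) →ₗ[ℂ] (M' → ℂ)}
    {g : M → Bits w → Bits w} {g' : M' → Bits w → Bits w}
    (h : Intertwines Λ (fun _ => ⊤) (ctrl g) (ctrl g')) (j : ℕ)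
    (e : MixedState (QReg w d) M) : wt Λ (e.map (ctrl g j d)) = wt Λ e := by
  simp only [wt, List.map_map, Function.comp_def]
  congr 1
  refine List.map_congr_left fun ψ _ => ?_
  rw [← (h j d ψ fun _ => trivial).1, sqn_ctrl]

lemma wt_runSteps {w d : ℕ} {M M' : Type} [Fintype M'] {Λ : (M → ℂ) →ₗ[ℂ] (M' → ℂ)}
    {g : M → Bits w → Bits w} {g' : M' → Bits w → Bits w}
    (h : Intertwines Λ (fun _ => ⊤) (ctrl g) (ctrl g'))
    (As : List (QChannel (QReg w d) (QReg w d))) : ∀ (j : ℕ) (e : MixedState (QReg w d) M),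
    wt Λ (runSteps (ctrl g) j As e) = wt Λ e := by
  induction As with
  | nil => intros; rfl
  | cons A As ih =>
    intro j e
    simp only [_root_.runSteps]
    rw [ih, QInstrument.wt_apply, wt_map_ctrl h]

/-- Runs of an oracle algorithm preserve all weights with which the oracle is compatible. -/
lemma OracleAlg.sum_wt_run {w : ℕ} {R R' B M M' : Type} [Fintype R] [DecidableEq R] [Fintype R']
    [Fintype B] [Fintype M'] {Λ : (M → ℂ) →ₗ[ℂ] (M' → ℂ)}
    {g : M → Bits w → Bits w} {g' : M' → Bits w → Bits w}
    (h : Intertwines Λ (fun _ => ⊤) (ctrl g) (ctrl g')) (A : OracleAlg w R R' B) (j : ℕ)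
    (e : MixedState R M) : ∑ b, wt Λ (A.run (ctrl g) j b e) = wt Λ e := by
  simp only [OracleAlg.run]
  rw [QInstrument.sum_wt, wt_runSteps h, QInstrument.wt_apply]

/-! ### Comparing runs of oracle algorithms -/

lemma ctrl_intertwines_sub {w : ℕ} {M M' : Type} (g : M → Bits w → Bits w) (a b : M' → M)
    (hg : ∀ m, g (a m) = g (b m)) :
    Intertwines (pull a - pull b) (fun _ => ⊤) (ctrl g) (ctrl fun m => g (a m)) := by
  refine fun _ _ ψ _ => ⟨?_, fun _ => trivial⟩
  funext r m
  simp [ctrl, onMem, hg]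

lemma abs_norm_sq_sub_le {t : ℝ} (ht : 0 < t) (u v : ℂ) : |‖u‖ ^ 2 - ‖v‖ ^ 2| ≤
    t / 2 * ‖u - v‖ ^ 2 + (1 / t) * (‖u‖ ^ 2 + ‖v‖ ^ 2) := by
  have h1 : |‖u‖ - ‖v‖| ≤ ‖u - v‖ := abs_norm_sub_norm_le u v
  have h2 : |‖u‖ ^ 2 - ‖v‖ ^ 2| ≤ ‖u - v‖ * (‖u‖ + ‖v‖) := by
    rw [sq_sub_sq, abs_mul, mul_comm, abs_of_nonneg (add_nonneg (norm_nonneg u) (norm_nonneg v))]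
    exact mul_le_mul_of_nonneg_right h1 (by positivity)
  have h3 : 0 ≤ (t * ‖u - v‖ - (‖u‖ + ‖v‖)) ^ 2 / (2 * t) := by positivity
  have h4 : (t * ‖u - v‖ - (‖u‖ + ‖v‖)) ^ 2 / (2 * t) =
      t / 2 * ‖u - v‖ ^ 2 + (1 / t) * ((‖u‖ + ‖v‖) ^ 2 / 2) - ‖u - v‖ * (‖u‖ + ‖v‖) := by
    field_simp; ring
  have h5 : (1 / t) * ((‖u‖ + ‖v‖) ^ 2 / 2) ≤ (1 / t) * (‖u‖ ^ 2 + ‖v‖ ^ 2) := by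
    gcongr
    nlinarith [sq_nonneg (‖u‖ - ‖v‖)]
  linarith

lemma abs_sqn_sub_le {R M M' : Type} [Fintype R] [Fintype M'] {t : ℝ} (ht : 0 < t)
    (a b : M' → M) (ψ : StateVec R M) :
    |sqn (onMem (pull a) ψ) - sqn (onMem (pull b) ψ)| ≤
      t / 2 * sqn (onMem (pull a - pull b) ψ) +
        (1 / t) * (sqn (onMem (pull a) ψ) + sqn (onMem (pull b) ψ)) := by
  simp only [sqn, ← Finset.sum_sub_distrib, ← Finset.sum_add_distrib, Finset.mul_sum]
  refine (Finset.abs_sum_le_sum_abs _ _).trans (Finset.sum_le_sum fun r _ => ?_)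
  refine (Finset.abs_sum_le_sum_abs _ _).trans (Finset.sum_le_sum fun m _ => ?_)
  exact abs_norm_sq_sub_le ht _ _

lemma abs_wt_sub_le {R M M' : Type} [Fintype R] [Fintype M'] {t : ℝ} (ht : 0 < t)
    (a b : M' → M) (e : MixedState R M) :
    |wt (pull a) e - wt (pull b) e| ≤
      t / 2 * wt (pull a - pull b) e + (1 / t) * (wt (pull a) e + wt (pull b) e) := by
  induction e with
  | nil => simp [wt]
  | cons ψ e ih =>
    have h := abs_sqn_sub_le ht a b ψ
    simp only [wt, List.map_cons, List.sum_cons] at ih ⊢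
    rw [abs_le] at *
    constructor <;> linarith [h.1, h.2, ih.1, ih.2]

/-- A measurement with two outcomes on two ensembles: the difference of the probabilities of an
outcome is controlled by the distance of the ensembles. As both outcomes are taken into account,
the bound is the trace distance and not twice it. -/
lemma abs_wt_outcome_sub_le {R M M' : Type} [Fintype R] [Fintype M'] (a b : M' → M)
    (e : Bool → MixedState R M) {t : ℝ} (ht : 0 < t) :
    |2 * (wt (pull a) (e true) - wt (pull b) (e true)) -
        (∑ o, wt (pull a) (e o) - ∑ o, wt (pull b) (e o))| ≤
      t / 2 * ∑ o, wt (pull a - pull b) (e o) +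
        (1 / t) * (∑ o, wt (pull a) (e o) + ∑ o, wt (pull b) (e o)) := by
  have h1 := abs_wt_sub_le ht a b (e true)
  have h2 := abs_wt_sub_le ht a b (e false)
  simp only [Fintype.sum_bool]
  rw [abs_le] at *
  constructor <;> linarith [h1.1, h1.2, h2.1, h2.2]

lemma OracleAlg.abs_wt_run_sub_le {w : ℕ} {R R' M M' : Type} [Fintype R] [DecidableEq R]
    [Fintype R'] [Fintype M'] (D : OracleAlg w R R' Bool) (g : M → Bits w → Bits w)
    (a b : M' → M) (hg : ∀ m, g (a m) = g (b m)) (j : ℕ) (e : MixedState R M) {t : ℝ}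
    (ht : 0 < t) :
    |2 * (wt (pull a) (D.run (ctrl g) j true e) - wt (pull b) (D.run (ctrl g) j true e)) -
        (wt (pull a) e - wt (pull b) e)| ≤
      t / 2 * wt (pull a - pull b) e + (1 / t) * (wt (pull a) e + wt (pull b) e) := by
  have h := abs_wt_outcome_sub_le a b (fun o => D.run (ctrl g) j o e) ht
  rwa [D.sum_wt_run (ctrl_intertwines_sub g a b hg) j e,
    D.sum_wt_run (ctrl_intertwines_pull g a) j e,
    D.sum_wt_run (ctrl_intertwines_pull g b) j e] at h

/-! ### Minkowski's inequality for ensembles -/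

lemma sqn_add_le {R M : Type} [Fintype R] [Fintype M] {s : ℝ} (hs : 0 < s) (ψ φ : StateVec R M) :
    sqn (ψ + φ) ≤ (1 + s) * sqn ψ + (1 + 1 / s) * sqn φ := by
  simp only [sqn, ← Finset.sum_add_distrib, Finset.mul_sum]
  refine Finset.sum_le_sum fun r _ => Finset.sum_le_sum fun m _ => ?_
  have h1 : ‖(ψ + φ) r m‖ ≤ ‖ψ r m‖ + ‖φ r m‖ := norm_add_le _ _
  have h2 : ‖(ψ + φ) r m‖ ^ 2 ≤ (‖ψ r m‖ + ‖φ r m‖) ^ 2 := by gcongr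
  have h3 : 0 ≤ (s * ‖ψ r m‖ - ‖φ r m‖) ^ 2 / s := by positivity
  have h4 : (s * ‖ψ r m‖ - ‖φ r m‖) ^ 2 / s =
      s * ‖ψ r m‖ ^ 2 + 1 / s * ‖φ r m‖ ^ 2 - 2 * ‖ψ r m‖ * ‖φ r m‖ := by
    field_simp; ring
  nlinarith

/-- Minkowski's inequality for the square root of the weight of an ensemble, in squared form. -/
lemma sum_sqn_add_le {α R M : Type} [Fintype R] [Fintype M] (l : List α)
    (u v : α → StateVec R M) {a b : ℝ} (ha : 0 ≤ a) (hb : 0 ≤ b)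
    (hu : (l.map fun x => sqn (u x)).sum ≤ a ^ 2) (hv : (l.map fun x => sqn (v x)).sum ≤ b ^ 2) :
    (l.map fun x => sqn (u x + v x)).sum ≤ (a + b) ^ 2 := by
  have h1 : ∀ s > 0, (l.map fun x => sqn (u x + v x)).sum ≤
      (1 + s) * (l.map fun x => sqn (u x)).sum + (1 + 1 / s) * (l.map fun x => sqn (v x)).sum := by
    intro s hs
    rw [← List.sum_map_mul_left, ← List.sum_map_mul_left, ← List.sum_map_add]
    exact List.sum_le_sum fun x _ => sqn_add_le hs _ _
  have h2 : ∀ ε > 0, (l.map fun x => sqn (u x + v x)).sum ≤ (a + ε + (b + ε)) ^ 2 := by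
    intro ε hε
    have hs : 0 < (b + ε) / (a + ε) := by positivity
    have h3 : (1 + (b + ε) / (a + ε)) * (l.map fun x => sqn (u x)).sum ≤
        (1 + (b + ε) / (a + ε)) * (a + ε) ^ 2 :=
      mul_le_mul_of_nonneg_left (hu.trans (by gcongr; linarith)) (by positivity)
    have h4 : (1 + 1 / ((b + ε) / (a + ε))) * (l.map fun x => sqn (v x)).sum ≤
        (1 + 1 / ((b + ε) / (a + ε))) * (b + ε) ^ 2 :=
      mul_le_mul_of_nonneg_left (hv.trans (by gcongr; linarith)) (by positivity)
    have h5 : (1 + (b + ε) / (a + ε)) * (a + ε) ^ 2 +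
        (1 + 1 / ((b + ε) / (a + ε))) * (b + ε) ^ 2 = (a + ε + (b + ε)) ^ 2 := by
      have : a + ε ≠ 0 := by positivity
      have : b + ε ≠ 0 := by positivity
      field_simp; ring
    linarith [h1 _ hs]
  have hc : Filter.Tendsto (fun ε : ℝ => (a + ε + (b + ε)) ^ 2) (nhdsWithin 0 (Set.Ioi 0))
      (nhds ((a + b) ^ 2)) := by
    have : Continuous fun ε : ℝ => (a + ε + (b + ε)) ^ 2 := by fun_prop
    have h := this.tendsto 0
    simp only [add_zero] at h
    exact h.mono_left nhdsWithin_le_nhds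
  exact ge_of_tendsto hc (Filter.eventually_of_mem self_mem_nhdsWithin h2)

/-! ### Reprogramming a function at few points -/

open Classical in
/-- The function `H`, reprogrammed to take the value `c i` at the point `x i`. (The points are
meant to be distinct.) -/
def reprogram {w n : ℕ} (x c : Fin n → Bits w) (H : Bits w → Bits w) : Bits w → Bits w :=
  fun p => if h : ∃ i, x i = p then c h.choose else H p

lemma reprogram_of_ne {w n : ℕ} {x : Fin n → Bits w} (c : Fin n → Bits w) (H : Bits w → Bits w)
    {p : Bits w} (h : ¬∃ i, x i = p) : reprogram x c H p = H p := dif_neg h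

lemma exists_reprogram_eq {w n : ℕ} {x : Fin n → Bits w} (c : Fin n → Bits w) {p : Bits w}
    (h : ∃ i, x i = p) : ∃ i, ∀ H, reprogram x c H p = c i := ⟨h.choose, fun _ => dif_pos h⟩

lemma reprogram_apply {w n : ℕ} {x : Fin n → Bits w} (hx : Function.Injective x)
    (c : Fin n → Bits w) (H : Bits w → Bits w) (i : Fin n) : reprogram x c H (x i) = c i := by
  have h : ∃ k, x k = x i := ⟨i, rfl⟩
  rw [reprogram, dif_pos h, hx h.choose_spec]

/-- The oracle world in which a random function `H` (memory `(H, none)`) and its reprogrammed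
versions (memory `(H, some r)`) are available at the same time. -/
def bothOracles {w n : ℕ} {ρ : Type} (x : ρ → Fin n → Bits w) (c : Fin n → Bits w) :
    (Bits w → Bits w) × Option ρ → Bits w → Bits w
  | (H, none) => H
  | (H, some r) => reprogram (x r) c H

/-- The label of a function in the world `bothOracles`. -/
def plain {w : ℕ} {ρ : Type} (H : Bits w → Bits w) : (Bits w → Bits w) × Option ρ := (H, none)

/-- The label of the function of a pair. -/
def orig {w : ℕ} {ρ : Type} (p : (Bits w → Bits w) × ρ) : (Bits w → Bits w) × Option ρ :=
  (p.1, none)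

/-- The label of the reprogrammed version of the function of a pair. -/
def modif {w : ℕ} {ρ : Type} (p : (Bits w → Bits w) × ρ) : (Bits w → Bits w) × Option ρ :=
  (p.1, some p.2)

lemma norm_sub_sq_le (u v : ℂ) : ‖u - v‖ ^ 2 ≤ 2 * ‖u‖ ^ 2 + 2 * ‖v‖ ^ 2 := by
  have h := norm_sub_le u v
  have := pow_le_pow_left₀ (norm_nonneg _) h 2
  nlinarith [sq_nonneg (‖u‖ - ‖v‖)]

lemma sum_norm_shift_sub_le {w : ℕ} (f : Bits w → ℂ) (a b : Bits w) :
    ∑ y : Bits w, ‖f (y.xor a) - f (y.xor b)‖ ^ 2 ≤ 4 * ∑ y, ‖f y‖ ^ 2 := by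
  have h1 : ∑ y, ‖f (Bits.xor y a)‖ ^ 2 = ∑ y, ‖f y‖ ^ 2 :=
    (Bits.xorEquiv a).sum_comp fun y => ‖f y‖ ^ 2
  have h2 : ∑ y, ‖f (Bits.xor y b)‖ ^ 2 = ∑ y, ‖f y‖ ^ 2 :=
    (Bits.xorEquiv b).sum_comp fun y => ‖f y‖ ^ 2
  calc _ ≤ ∑ y, (2 * ‖f (Bits.xor y a)‖ ^ 2 + 2 * ‖f (Bits.xor y b)‖ ^ 2) :=
        Finset.sum_le_sum fun y _ => norm_sub_sq_le _ _
    _ = 4 * ∑ y, ‖f y‖ ^ 2 := by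
        rw [Finset.sum_add_distrib, ← Finset.mul_sum, ← Finset.mul_sum, h1, h2]; ring

open Classical in
/-- If the reprogrammed points are spread out, then a query in a state that is independent of
these points hardly notices the reprogramming. -/
lemma sqn_query_error_le {w n d : ℕ} {ρ : Type} [Fintype ρ] (x : ρ → Fin n → Bits w)
    (c : Fin n → Bits w) {κ : ℝ}
    (hκ : ∀ p, ((Finset.univ.filter fun r => ∃ i, x r i = p).card : ℝ) ≤ κ)
    (ψ : StateVec (QReg w d) (Bits w → Bits w)) {C : ℝ} (hC0 : 0 ≤ C)
    (hC : ∀ p z r, (∃ i, x r i = p) →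
      ∑ H, ∑ y : Bits w, ‖ψ (p, y.xor (H p), z) H -
        ψ (p, y.xor (reprogram (x r) c H p), z) H‖ ^ 2 ≤ C * ∑ H, ∑ y, ‖ψ (p, y, z) H‖ ^ 2) :
    sqn (fun (s : QReg w d) (m : (Bits w → Bits w) × ρ) =>
      ψ (s.1, s.2.1.xor (m.1 s.1), s.2.2) m.1 -
        ψ (s.1, s.2.1.xor (reprogram (x m.2) c m.1 s.1), s.2.2) m.1) ≤ C * κ * sqn ψ := by
  have h1 : ∀ f : QReg w d → (Bits w → Bits w) → ρ → ℝ,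
      ∑ s, ∑ m : (Bits w → Bits w) × ρ, f s m.1 m.2 =
        ∑ p, ∑ z, ∑ r, ∑ H, ∑ y, f (p, y, z) H r := by
    intro f
    simp only [Fintype.sum_prod_type]
    refine Finset.sum_congr rfl fun p _ => ?_
    rw [Finset.sum_comm]
    refine Finset.sum_congr rfl fun z _ => ?_
    rw [Finset.sum_comm' (t' := Finset.univ) (s' := fun _ => Finset.univ) (by simp),
      Finset.sum_comm (γ := ρ)]
    refine Finset.sum_congr rfl fun H _ => ?_
    rw [Finset.sum_comm]
  have h2 : sqn ψ = ∑ p, ∑ z, ∑ H, ∑ y, ‖ψ (p, y, z) H‖ ^ 2 := by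
    simp only [sqn, Fintype.sum_prod_type]
    refine Finset.sum_congr rfl fun p _ => ?_
    rw [Finset.sum_comm]
    exact Finset.sum_congr rfl fun z _ => Finset.sum_comm
  rw [sqn, h1 fun s H r => ‖ψ (s.1, s.2.1.xor (H s.1), s.2.2) H -
        ψ (s.1, s.2.1.xor (reprogram (x r) c H s.1), s.2.2) H‖ ^ 2, h2, Finset.mul_sum]
  refine Finset.sum_le_sum fun p _ => ?_
  rw [Finset.mul_sum]
  refine Finset.sum_le_sum fun z _ => ?_
  set A := ∑ H, ∑ y, ‖ψ (p, y, z) H‖ ^ 2 with hA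
  have hA0 : 0 ≤ A := by positivity
  -- only the coins `r` for which the query point `p` is reprogrammed contribute
  calc _ ≤ ∑ r, if ∃ i, x r i = p then C * A else 0 := by
        refine Finset.sum_le_sum fun r _ => ?_
        split_ifs with h
        · exact hC p z r h
        · simp [reprogram_of_ne c _ h]
    _ = (Finset.univ.filter fun r => ∃ i, x r i = p).card * (C * A) := by
        rw [← Finset.sum_filter, Finset.sum_const, nsmul_eq_mul]
    _ ≤ κ * (C * A) := by gcongr; exact hκ p
    _ = C * κ * A := by ring

section Hybrid

variable {w n d : ℕ} {ρ : Type} (x : ρ → Fin n → Bits w) (c : Fin n → Bits w)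

lemma onMem_sub_query (j : ℕ) (ψ : StateVec (QReg w d) ((Bits w → Bits w) × Option ρ)) :
    onMem (pull orig - pull modif) (ctrl (bothOracles x c) j d ψ) =
      ctrl (fun m : (Bits w → Bits w) × ρ => reprogram (x m.2) c m.1) j d
        (onMem (pull orig - pull modif) ψ) +
      (fun s m => onMem (pull plain) ψ (s.1, s.2.1.xor (m.1 s.1), s.2.2) m.1 -
        onMem (pull plain) ψ (s.1, s.2.1.xor (reprogram (x m.2) c m.1 s.1), s.2.2) m.1) := by
  funext s m
  simp [onMem, ctrl, orig, modif, plain, bothOracles]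

open Classical in
lemma wt_sub_query_le [Fintype ρ] {κ : ℝ}
    (hκ : ∀ p, ((Finset.univ.filter fun r => ∃ i, x r i = p).card : ℝ) ≤ κ) (j : ℕ)
    (e : MixedState (QReg w d) ((Bits w → Bits w) × Option ρ)) {a b : ℝ} (ha : 0 ≤ a)
    (hb : 0 ≤ b) (h1 : wt (pull orig - pull modif) e ≤ a ^ 2)
    (h2 : 4 * κ * wt (pull plain) e ≤ b ^ 2) :
    wt (pull orig - pull modif) (e.map (ctrl (bothOracles x c) j d)) ≤ (a + b) ^ 2 := by
  simp only [wt, List.map_map, Function.comp_def, onMem_sub_query]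
  refine sum_sqn_add_le _ _ _ ha hb ?_ (le_trans ?_ h2)
  · simpa only [sqn_ctrl] using (show (e.map fun ψ => sqn (onMem (pull orig - pull modif) ψ)).sum ≤ a ^ 2 from h1)
  · rw [wt, ← List.sum_map_mul_left]
    refine List.sum_le_sum fun ψ _ => sqn_query_error_le x c hκ _ (by norm_num) ?_
    intro p z r _
    rw [Finset.mul_sum]
    exact Finset.sum_le_sum fun _ _ => sum_norm_shift_sub_le
      (fun y => onMem (pull plain) ψ (p, y, z) _) _ _

lemma wt_plain_map_query (j : ℕ) (e : MixedState (QReg w d) ((Bits w → Bits w) × Option ρ)) :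
    wt (pull plain) (e.map (ctrl (bothOracles x c) j d)) = wt (pull plain) e :=
  wt_map_ctrl (ctrl_intertwines_pull _ _) j e

open Classical in
/-- The hybrid argument. -/
lemma wt_sub_runSteps_le [Fintype ρ] {κ : ℝ}
    (hκ : ∀ p, ((Finset.univ.filter fun r => ∃ i, x r i = p).card : ℝ) ≤ κ)
    {b : ℝ} (hb : 0 ≤ b) (As : List (QChannel (QReg w d) (QReg w d))) :
    ∀ (j : ℕ) (e : MixedState (QReg w d) ((Bits w → Bits w) × Option ρ)) (a : ℝ), 0 ≤ a →
      wt (pull orig - pull modif) e ≤ a ^ 2 → 4 * κ * wt (pull plain) e ≤ b ^ 2 →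
      wt (pull orig - pull modif) (runSteps (ctrl (bothOracles x c)) j As e) ≤
        (a + As.length * b) ^ 2 := by
  induction As with
  | nil => intro j e a ha h1 _; simpa [runSteps] using h1
  | cons A As ih =>
    intro j e a ha h1 h2
    have h := ih (j + 1) (A.apply () (e.map (ctrl (bothOracles x c) j d))) (a + b) (by positivity)
      (by rw [QInstrument.wt_apply]; exact wt_sub_query_le x c hκ j e ha hb h1 h2)
      (by rw [QInstrument.wt_apply, wt_plain_map_query]; exact h2)
    refine h.trans (le_of_eq ?_)
    rw [List.length_cons]
    push_cast
    ring

lemma sum_shift_apply (p : Bits w) (f : Bits w → ℂ) :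
    ∃ κ : ℝ, 0 ≤ κ ∧ ∀ y : Bits w, ∑ H : Bits w → Bits w, f (y.xor (H p)) = κ * ∑ v, f v := by
  classical
  refine ⟨Fintype.card ({q : Bits w // q ≠ p} → Bits w), by positivity, fun y => ?_⟩
  rw [← (Equiv.funSplitAt p (Bits w)).symm.sum_comp, Fintype.sum_prod_type]
  simp only [Equiv.funSplitAt_symm_apply, ↓reduceDIte, Finset.sum_const, nsmul_eq_mul,
    Finset.card_univ]
  rw [← Finset.mul_sum]
  congr 1
  refine (Bits.xorEquiv y).sum_comp (fun v => f v) |>.symm.trans ?_ |>.symm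
  refine Finset.sum_congr rfl fun v _ => ?_
  congr 1
  funext i
  simp [Bits.xorEquiv, Bits.xor, Bool.xor_comm]

/-- In a state that is independent of the random function, the answer to a query and a fixed
value differ only by `√2` (and not by `2`), because the answer is random. -/
lemma sum_first_query_le (p v : Bits w) (f : Bits w → ℂ) :
    ∑ H : Bits w → Bits w, ∑ y : Bits w, ‖f (y.xor (H p)) - f (y.xor v)‖ ^ 2 ≤
      2 * ∑ _H : Bits w → Bits w, ∑ y, ‖f y‖ ^ 2 := by
  obtain ⟨κ, hκ, hs⟩ := sum_shift_apply p f
  have h1 : ∀ u w : ℂ, ‖u - w‖ ^ 2 = ‖u‖ ^ 2 + ‖w‖ ^ 2 - 2 * (u * starRingEnd ℂ w).re := by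
    intro u w
    rw [← Complex.normSq_eq_norm_sq, ← Complex.normSq_eq_norm_sq, ← Complex.normSq_eq_norm_sq,
      Complex.normSq_sub]
  have h2 : ∀ a : Bits w, ∑ y : Bits w, ‖f (y.xor a)‖ ^ 2 = ∑ y, ‖f y‖ ^ 2 := fun a =>
    (Bits.xorEquiv a).sum_comp fun y => ‖f y‖ ^ 2
  have h3 : 0 ≤ ∑ H : Bits w → Bits w, ∑ y : Bits w,
      (f (y.xor (H p)) * starRingEnd ℂ (f (y.xor v))).re := by
    have h4 : ∑ H : Bits w → Bits w, ∑ y : Bits w,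
        f (y.xor (H p)) * starRingEnd ℂ (f (y.xor v)) =
          κ * ((∑ u, f u) * starRingEnd ℂ (∑ u, f u)) := by
      rw [Finset.sum_comm]
      simp only [← Finset.sum_mul, hs]
      rw [← Finset.mul_sum, ← map_sum,
        show ∑ y : Bits w, f (y.xor v) = ∑ y, f y from (Bits.xorEquiv v).sum_comp f]
      ring
    have h5 := congrArg Complex.re h4
    rw [Complex.mul_conj, ← Complex.ofReal_mul, Complex.ofReal_re] at h5
    simp only [Complex.re_sum] at h5
    rw [h5]
    exact mul_nonneg hκ (Complex.normSq_nonneg _)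
  simp only [h1, Finset.sum_add_distrib, Finset.sum_sub_distrib, h2, ← Finset.mul_sum]
  linarith

open Classical in
/-- The error of the first query of an algorithm whose state is independent of the random function:
half of the bound for a general query. -/
lemma wt_sub_first_query_le [Fintype ρ] {κ : ℝ}
    (hκ : ∀ p, ((Finset.univ.filter fun r => ∃ i, x r i = p).card : ℝ) ≤ κ) (j : ℕ)
    (e : MixedState (QReg w d) Unit) :
    wt (pull orig - pull modif) ((e.map (onMem (pull fun _ => ()))).map
      (ctrl (bothOracles x c) j d)) ≤
      2 * κ * wt (pull plain) (e.map (onMem (pull fun _ : (Bits w → Bits w) × Option ρ => ()))) := by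
  simp only [wt, List.map_map, Function.comp_def, onMem_sub_query]
  rw [← List.sum_map_mul_left]
  refine List.sum_le_sum fun ψ _ => ?_
  have h0 : onMem (pull orig - pull modif)
      (onMem (pull fun _ : (Bits w → Bits w) × Option ρ => ()) ψ) = 0 := by
    funext s m; simp [onMem]
  have h1 : ctrl (fun m : (Bits w → Bits w) × ρ => reprogram (x m.2) c m.1) j d 0 = 0 := rfl
  rw [h0, h1, zero_add]
  refine sqn_query_error_le x c hκ _ (by norm_num) ?_
  intro p z r hr
  obtain ⟨i, hi⟩ := exists_reprogram_eq c hr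
  simp only [hi]
  exact sum_first_query_le p (c i) fun y => ψ (p, y, z) ()

end Hybrid

section HybridAlg

variable {w n : ℕ} {ρ R R' B : Type} [Fintype R] [Fintype R'] [Fintype B] (x : ρ → Fin n → Bits w) (c : Fin n → Bits w)

lemma wt_sub_pull_fst [Fintype ρ] (e : MixedState R (Bits w → Bits w)) :
    wt (pull orig - pull modif)
      (e.map (onMem (pull fun m : (Bits w → Bits w) × Option ρ => m.1))) = 0 := by
  rw [wt_map_onMem]
  have : (pull orig - pull modif) ∘ₗ (pull fun m : (Bits w → Bits w) × Option ρ => m.1) = 0 := by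
    ext φ m; simp [orig, modif]
  simp [wt, this, sqn, onMem]

lemma wt_plain_pull_fst (e : MixedState R (Bits w → Bits w)) :
    wt (pull plain) (e.map (onMem (pull fun m : (Bits w → Bits w) × Option ρ => m.1))) =
      wt LinearMap.id e := by
  rw [wt_map_onMem]
  rfl

open Classical in
/-- An algorithm hardly notices the reprogramming of a function at random points of which it
has no information. -/
lemma OracleAlg.wt_sub_run_le [Fintype ρ] [DecidableEq R] {κ : ℝ} (hκ0 : 0 ≤ κ)
    (hκ : ∀ p, ((Finset.univ.filter fun r => ∃ i, x r i = p).card : ℝ) ≤ κ)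
    (A : OracleAlg w R R' B) (j : ℕ) (e : MixedState R (Bits w → Bits w)) :
    ∑ b, wt (pull orig - pull modif) (A.run (ctrl (bothOracles x c)) j b
      (e.map (onMem (pull fun m => m.1)))) ≤ 4 * A.queries ^ 2 * κ * wt LinearMap.id e := by
  simp only [OracleAlg.run]
  rw [QInstrument.sum_wt]
  have hw := wt_nonneg LinearMap.id e
  have h := wt_sub_runSteps_le x c hκ (b := √(4 * κ * wt LinearMap.id e)) (Real.sqrt_nonneg _)
    A.steps j (A.prep.apply () (e.map (onMem (pull fun m => m.1)))) 0 le_rfl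
    (by rw [QInstrument.wt_apply, wt_sub_pull_fst]; norm_num)
    (by rw [QInstrument.wt_apply, wt_plain_pull_fst, Real.sq_sqrt (by positivity)])
  refine h.trans (le_of_eq ?_)
  rw [zero_add, mul_pow, Real.sq_sqrt (by positivity), OracleAlg.queries]
  ring

open Classical in
/-- If the initial state does not depend on the random function, the bound is slightly better. -/
lemma OracleAlg.wt_sub_run_const_le [Fintype ρ] [DecidableEq R] {κ : ℝ} (hκ0 : 0 ≤ κ)
    (hκ : ∀ p, ((Finset.univ.filter fun r => ∃ i, x r i = p).card : ℝ) ≤ κ)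
    (A : OracleAlg w R R' B) (hA : 1 ≤ A.queries) (j : ℕ) (e : MixedState R Unit) :
    ∑ b, wt (pull orig - pull modif) (A.run (ctrl (bothOracles x c)) j b
      ((e.map (onMem (pull fun _ : Bits w → Bits w => ()))).map (onMem (pull fun m => m.1)))) ≤
      (2 * A.queries - 1 / 2) ^ 2 * κ *
        wt LinearMap.id (e.map (onMem (pull fun _ : Bits w → Bits w => ()))) := by
  simp only [OracleAlg.run]
  rw [QInstrument.sum_wt]
  rw [OracleAlg.queries] at hA ⊢
  obtain ⟨S, As, hS⟩ := List.exists_cons_of_length_pos hA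
  rw [hS, List.length_cons]
  set τ := wt LinearMap.id (e.map (onMem (pull fun _ : Bits w → Bits w => ()))) with hτ
  have hw : 0 ≤ τ := wt_nonneg _ _
  have h0 : (e.map (onMem (pull fun _ : Bits w → Bits w => ()))).map (onMem (pull fun m => m.1)) =
      e.map (onMem (pull fun _ : (Bits w → Bits w) × Option ρ => ())) := by
    rw [List.map_map]; rfl
  have hpl : wt (pull plain) ((A.prep.apply () e).map
      (onMem (pull fun _ : (Bits w → Bits w) × Option ρ => ()))) = τ := by
    rw [← QInstrument.apply_map_onMem, QInstrument.wt_apply, ← h0, wt_plain_pull_fst]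
  have h1 := wt_sub_first_query_le x c hκ j (A.prep.apply () e)
  rw [hpl] at h1
  have h := wt_sub_runSteps_le x c hκ (b := 2 * √(κ * τ)) (by positivity) As (j + 1)
    (S.apply () (((A.prep.apply () e).map (onMem (pull fun _ => ()))).map
      (ctrl (bothOracles x c) j A.dim))) (3 / 2 * √(κ * τ)) (by positivity)
    (by
      rw [QInstrument.wt_apply, mul_pow, Real.sq_sqrt (by positivity)]
      have : 0 ≤ κ * τ := by positivity
      linarith)
    (by
      rw [QInstrument.wt_apply, wt_plain_map_query, hpl, mul_pow, Real.sq_sqrt (by positivity)]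
      linarith)
  rw [h0, QInstrument.apply_map_onMem]
  refine h.trans (le_of_eq ?_)
  have h2 : 3 / 2 * √(κ * τ) + As.length * (2 * √(κ * τ)) =
      (2 * ((As.length + 1 : ℕ) : ℝ) - 1 / 2) * √(κ * τ) := by push_cast; ring
  rw [h2, mul_pow, Real.sq_sqrt (by positivity)]
  ring

end HybridAlg

/-! ### Fourier analysis of functions of the random function -/

/-- The character `(-1) ^ (u · v)`. -/
def chi {w : ℕ} (u v : Bits w) : ℂ := ∏ i, if u i && v i then (-1 : ℂ) else 1

/-- The word all of whose bits are `0`. -/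
abbrev zeroWord (w : ℕ) : Bits w := fun _ => false

lemma chi_comm {w : ℕ} (u v : Bits w) : chi u v = chi v u := by
  simp only [chi, Bool.and_comm]

lemma chi_xor_right {w : ℕ} (u v v' : Bits w) : chi u (v.xor v') = chi u v * chi u v' := by
  simp only [chi, ← Finset.prod_mul_distrib]
  refine Finset.prod_congr rfl fun i _ => ?_
  have h : ∀ a b c : Bool, (if a && (Bool.xor b c) then (-1 : ℂ) else 1) =
      (if a && b then (-1 : ℂ) else 1) * (if a && c then (-1 : ℂ) else 1) := by
    intro a b c
    cases a <;> cases b <;> cases c <;> simp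
  exact h _ _ _

lemma chi_xor_left {w : ℕ} (u u' v : Bits w) : chi (u.xor u') v = chi u v * chi u' v := by
  rw [chi_comm, chi_xor_right, chi_comm v, chi_comm v]

lemma chi_and {w : ℕ} (u a v : Bits w) : chi u (a.and v) = chi (u.and a) v := by
  refine Finset.prod_congr rfl fun i _ => ?_
  have h : ∀ a b c : Bool, (if a && (b && c) then (-1 : ℂ) else 1) =
      if (a && b) && c then (-1 : ℂ) else 1 := by
    intro a b c
    cases a <;> cases b <;> cases c <;> simp
  exact h _ _ _

@[simp] lemma chi_zero_left {w : ℕ} (v : Bits w) : chi (zeroWord w) v = 1 := by simp [chi]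

lemma conj_chi {w : ℕ} (u v : Bits w) : starRingEnd ℂ (chi u v) = chi u v := by
  simp only [chi, map_prod]
  refine Finset.prod_congr rfl fun i _ => ?_
  split_ifs <;> simp

lemma Bits.xor_eq_zero {w : ℕ} {a b : Bits w} : a.xor b = zeroWord w ↔ a = b := by
  simp only [funext_iff, Bits.xor]
  refine forall_congr' fun i => ?_
  cases a i <;> cases b i <;> simp

lemma sum_chi {w : ℕ} (u : Bits w) :
    ∑ v, chi u v = if u = zeroWord w then (2 : ℂ) ^ w else 0 := by
  have h : ∑ v, chi u v = ∏ i, ∑ b : Bool, if u i && b then (-1 : ℂ) else 1 := by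
    rw [Finset.prod_univ_sum, Fintype.piFinset_univ]
    rfl
  rw [h]
  split_ifs with hu
  · simp [hu]
  · obtain ⟨i, hi⟩ : ∃ i, u i = true := by
      by_contra! hc
      exact hu (funext fun i => by simpa using hc i)
    exact Finset.prod_eq_zero (Finset.mem_univ i) (by simp [hi])

lemma sum_chi_mul_chi {w : ℕ} (v v' : Bits w) :
    ∑ u, chi u v * chi u v' = if v = v' then (2 : ℂ) ^ w else 0 := by
  simp only [← chi_xor_right, chi_comm _ (Bits.xor v v'), sum_chi, Bits.xor_eq_zero]

/-- The character `(-1) ^ ∑ F x · H x` of the group of functions. -/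
def fchi {w : ℕ} (F H : Bits w → Bits w) : ℂ := ∏ x, chi (F x) (H x)

lemma conj_fchi {w : ℕ} (F H : Bits w → Bits w) : starRingEnd ℂ (fchi F H) = fchi F H := by
  simp only [fchi, map_prod, conj_chi]

lemma card_fun {w : ℕ} : (Fintype.card (Bits w → Bits w) : ℂ) = ∏ _x : Bits w, (2 : ℂ) ^ w := by
  simp

lemma sum_fchi_mul_fchi {w : ℕ} (H H' : Bits w → Bits w) :
    ∑ F, fchi F H * fchi F H' =
      if H = H' then (Fintype.card (Bits w → Bits w) : ℂ) else 0 := by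
  have h : ∑ F, fchi F H * fchi F H' = ∏ x, ∑ u, chi u (H x) * chi u (H' x) := by
    rw [Finset.prod_univ_sum, Fintype.piFinset_univ]
    simp only [fchi, Finset.prod_mul_distrib]
  simp only [h, sum_chi_mul_chi]
  split_ifs with hu
  · rw [card_fun]
    simp [hu]
  · obtain ⟨x, hx⟩ : ∃ x, H x ≠ H' x := by
      by_contra! hc
      exact hu (funext hc)
    exact Finset.prod_eq_zero (Finset.mem_univ x) (by simp [hx])

/-- Fourier coefficients with respect to the normalised counting measure, as a linear map. -/
def hat {w : ℕ} : ((Bits w → Bits w) → ℂ) →ₗ[ℂ] ((Bits w → Bits w) → ℂ) where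
  toFun f F := (∑ H, fchi F H * f H) / Fintype.card (Bits w → Bits w)
  map_add' f g := by
    funext F
    simp only [Pi.add_apply, mul_add, Finset.sum_add_distrib, add_div]
  map_smul' a f := by
    funext F
    simp only [Pi.smul_apply, smul_eq_mul, RingHom.id_apply, mul_left_comm _ a,
      ← Finset.mul_sum, mul_div_assoc]

lemma hat_apply {w : ℕ} (f : (Bits w → Bits w) → ℂ) (F : Bits w → Bits w) :
    hat f F = (∑ H, fchi F H * f H) / Fintype.card (Bits w → Bits w) := rfl

lemma card_fun_ne_zero {w : ℕ} : (Fintype.card (Bits w → Bits w) : ℂ) ≠ 0 := by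
  simp

/-- Parseval's identity. -/
lemma sum_hat_mul_conj_hat {w : ℕ} (f g : (Bits w → Bits w) → ℂ) :
    ∑ F, hat f F * starRingEnd ℂ (hat g F) =
      (∑ H, f H * starRingEnd ℂ (g H)) / Fintype.card (Bits w → Bits w) := by
  set T : ℂ := ((Fintype.card (Bits w → Bits w) : ℕ) : ℂ) with hT
  have hT0 : T ≠ 0 := card_fun_ne_zero
  have hTc : starRingEnd ℂ T = T := Complex.conj_natCast _
  have h1 : ∀ F, hat f F * starRingEnd ℂ (hat g F) =
      (∑ H, ∑ H', f H * starRingEnd ℂ (g H') * (fchi F H * fchi F H')) / T ^ 2 := by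
    intro F
    simp only [hat_apply, map_div₀, map_sum, map_mul, conj_fchi, hTc, ← hT]
    rw [div_mul_div_comm, Finset.sum_mul_sum, ← pow_two]
    congr 1
    refine Finset.sum_congr rfl fun H _ => Finset.sum_congr rfl fun H' _ => ?_
    ring
  simp only [h1]
  rw [← Finset.sum_div, Finset.sum_comm]
  have h2 : ∀ H, ∑ F, ∑ H', f H * starRingEnd ℂ (g H') * (fchi F H * fchi F H') =
      f H * starRingEnd ℂ (g H) * T := by
    intro H
    rw [Finset.sum_comm]
    simp only [← Finset.mul_sum, sum_fchi_mul_fchi, mul_ite, mul_zero, Finset.sum_ite_eq,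
      Finset.mem_univ, if_true, ← hT]
  simp only [h2, ← Finset.sum_mul]
  field_simp

/-- Parseval's identity. -/
lemma sum_norm_hat_sq {w : ℕ} (f : (Bits w → Bits w) → ℂ) :
    ∑ F, ‖hat f F‖ ^ 2 = (∑ H, ‖f H‖ ^ 2) / Fintype.card (Bits w → Bits w) := by
  have h := sum_hat_mul_conj_hat f f
  simp only [Complex.mul_conj, Complex.normSq_eq_norm_sq] at h
  exact_mod_cast h

/-! ### Sparse Fourier expansions -/

/-- The support of a function to words. -/
def fsupp {w : ℕ} (F : Bits w → Bits w) : Finset (Bits w) :=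
  Finset.univ.filter fun x => F x ≠ zeroWord w

lemma mem_fsupp {w : ℕ} {F : Bits w → Bits w} {x : Bits w} : x ∈ fsupp F ↔ F x ≠ zeroWord w := by
  simp [fsupp]

/-- Functions of the random function all of whose Fourier coefficients have support of size at
most `k`. -/
def sparse (w k : ℕ) : Submodule ℂ ((Bits w → Bits w) → ℂ) where
  carrier := {f | ∀ F, k < (fsupp F).card → hat f F = 0}
  add_mem' hf hg F hF := by simp [hf F hF, hg F hF]
  zero_mem' F _ := by simp
  smul_mem' a f hf F hF := by simp [hf F hF]

lemma fsupp_card_le {w : ℕ} (F : Bits w → Bits w) (x u : Bits w) :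
    (fsupp F).card ≤ (fsupp (Function.update F x u)).card + 1 := by
  have h : fsupp F ⊆ insert x (fsupp (Function.update F x u)) := by
    intro p hp
    rw [Finset.mem_insert]
    by_cases hpx : p = x
    · exact Or.inl hpx
    · rw [mem_fsupp] at hp ⊢
      right
      rwa [Function.update_of_ne hpx]
  exact (Finset.card_le_card h).trans (Finset.card_insert_le _ _)

lemma fchi_mul_chi {w : ℕ} (F H : Bits w → Bits w) (x u : Bits w) :
    fchi F H * chi u (H x) = fchi (Function.update F x ((F x).xor u)) H := by
  have h : ∀ G : Bits w → Bits w, fchi G H =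
      chi (G x) (H x) * ∏ p ∈ Finset.univ.erase x, chi (G p) (H p) := fun G =>
    (Finset.mul_prod_erase Finset.univ (fun p => chi (G p) (H p)) (Finset.mem_univ x)).symm
  rw [h, h, Function.update_self, chi_xor_left]
  have h2 : ∏ p ∈ Finset.univ.erase x, chi (Function.update F x ((F x).xor u) p) (H p) =
      ∏ p ∈ Finset.univ.erase x, chi (F p) (H p) :=
    Finset.prod_congr rfl fun p hp => by
      rw [Function.update_of_ne (Finset.ne_of_mem_erase hp)]
  rw [h2]
  ring

/-- The effect of a query on Fourier coefficients: in the Fourier basis of the answer register, a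
query just adds the contents of this register to the database. -/
lemma hat_query {w : ℕ} (f : Bits w → (Bits w → Bits w) → ℂ) (a N y x : Bits w)
    (F : Bits w → Bits w) :
    hat (fun H => f (y.xor (a.xor (N.and (H x)))) H) F =
      ∑ u, ∑ v, ((2 : ℂ) ^ w)⁻¹ * (chi u (v.xor (y.xor a))) *
        hat (f v) (Function.update F x ((F x).xor (u.and N))) := by
  have h1 : ∀ H : Bits w → Bits w, f (y.xor (a.xor (N.and (H x)))) H =
      ∑ u, ∑ v, ((2 : ℂ) ^ w)⁻¹ * (chi u (v.xor (y.xor a))) * (chi (u.and N) (H x) * f v H) := by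
    intro H
    rw [Finset.sum_comm]
    have h2 : ∀ v, ∑ u, ((2 : ℂ) ^ w)⁻¹ * (chi u (v.xor (y.xor a))) *
        (chi (u.and N) (H x) * f v H) =
          if v = y.xor (a.xor (N.and (H x))) then f v H else 0 := by
      intro v
      have h3 : ∀ u, ((2 : ℂ) ^ w)⁻¹ * (chi u (v.xor (y.xor a))) *
          (chi (u.and N) (H x) * f v H) =
            (chi u v * chi u (y.xor (a.xor (N.and (H x))))) * (((2 : ℂ) ^ w)⁻¹ * f v H) := by
        intro u
        simp only [chi_xor_right, chi_and]
        ring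
      simp only [h3, ← Finset.sum_mul, sum_chi_mul_chi]
      split_ifs
      · field_simp
      · simp
    simp only [h2, Finset.sum_ite_eq', Finset.mem_univ, if_true]
  simp only [hat_apply]
  have h4 : ∀ H : Bits w → Bits w, fchi F H * f (y.xor (a.xor (N.and (H x)))) H =
      ∑ u, ∑ v, ((2 : ℂ) ^ w)⁻¹ * (chi u (v.xor (y.xor a))) *
        (fchi (Function.update F x ((F x).xor (u.and N))) H * f v H) := by
    intro H
    rw [h1, Finset.mul_sum]
    refine Finset.sum_congr rfl fun u _ => ?_
    rw [Finset.mul_sum]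
    refine Finset.sum_congr rfl fun v _ => ?_
    rw [← fchi_mul_chi]
    ring
  simp only [h4]
  rw [Finset.sum_comm, Finset.sum_div]
  refine Finset.sum_congr rfl fun u _ => ?_
  rw [Finset.sum_comm, Finset.sum_div]
  refine Finset.sum_congr rfl fun v _ => ?_
  rw [← Finset.mul_sum, mul_div_assoc]

/-- A query increases the sparsity bound by at most one. -/
lemma ctrl_mem_sparse {w d k j : ℕ} (a N : Bits w → Bits w)
    (ψ : StateVec (QReg w d) (Bits w → Bits w)) (hψ : ∀ r, ψ r ∈ sparse w k) (r : QReg w d) :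
    ctrl (fun H x => (a x).xor ((N x).and (H x))) j d ψ r ∈ sparse w (k + 1) := by
  intro F hF
  obtain ⟨x, y, z⟩ := r
  refine (hat_query (fun v => ψ (x, v, z)) (a x) (N x) y x F).trans ?_
  refine Finset.sum_eq_zero fun u _ => Finset.sum_eq_zero fun v _ => ?_
  rw [hψ (x, v, z), mul_zero]
  have := fsupp_card_le F x ((F x).xor (u.and (N x)))
  omega

lemma const_mem_sparse (w k : ℕ) (a : ℂ) : (fun _ => a) ∈ sparse w k := by
  intro F hF
  have hne : F ≠ fun _ => zeroWord w := by
    rintro rfl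
    simp [fsupp] at hF
  obtain ⟨x, hx⟩ : ∃ x, F x ≠ zeroWord w := by
    by_contra! hc
    exact hne (funext hc)
  rw [hat_apply, ← Finset.sum_mul]
  have h : ∑ H, fchi F H = ∏ x, ∑ v, chi (F x) v := by
    rw [Finset.prod_univ_sum, Fintype.piFinset_univ]
    rfl
  rw [h, Finset.prod_eq_zero (Finset.mem_univ x) (by rw [sum_chi, if_neg hx])]
  simp

/-! ### Resampling the random function at few points -/

section Resample

variable {w n : ℕ} {x : Fin n → Bits w}

lemma reprogram_comp (hx : Function.Injective x) (c : Fin n → Bits w) (H : Bits w → Bits w) :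
    (fun i => reprogram x c H (x i)) = c := funext fun i => reprogram_apply hx c H i

lemma reprogram_reprogram (hx : Function.Injective x) (c : Fin n → Bits w)
    (H : Bits w → Bits w) : reprogram x (fun i => H (x i)) (reprogram x c H) = H := by
  funext p
  by_cases h : ∃ i, x i = p
  · obtain ⟨i, rfl⟩ := h
    rw [reprogram_apply hx]
  · rw [reprogram_of_ne _ _ h, reprogram_of_ne _ _ h]

/-- Exchanging the values of `H` at the points `x` with the tuple `c`. -/
def exchange (hx : Function.Injective x) :
    (Bits w → Bits w) × (Fin n → Bits w) ≃ (Bits w → Bits w) × (Fin n → Bits w) where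
  toFun p := (reprogram x p.2 p.1, fun i => p.1 (x i))
  invFun p := (reprogram x p.2 p.1, fun i => p.1 (x i))
  left_inv p := by
    simp only [reprogram_reprogram hx, reprogram_comp hx]
  right_inv p := by
    simp only [reprogram_reprogram hx, reprogram_comp hx]

/-- Averaging over the reprogrammed values annihilates the characters that depend on the values at
these points, and keeps all others. -/
lemma sum_fchi_reprogram (hx : Function.Injective x) (F H : Bits w → Bits w) :
    ∑ c, fchi F (reprogram x c H) =
      if ∀ i, F (x i) = zeroWord w then (Fintype.card (Fin n → Bits w) : ℂ) * fchi F H else 0 := by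
  classical
  set s : Finset (Bits w) := Finset.univ.image x with hs
  have hmem : ∀ p, p ∈ s ↔ ∃ i, x i = p := by simp [hs]
  have h1 : ∀ G : Bits w → Bits w, fchi F G =
      (∏ i, chi (F (x i)) (G (x i))) * ∏ p ∈ sᶜ, chi (F p) (G p) := by
    intro G
    rw [fchi, ← Finset.prod_mul_prod_compl s, hs, Finset.prod_image hx.injOn]
  have h2 : ∀ c, fchi F (reprogram x c H) =
      (∏ i, chi (F (x i)) (c i)) * ∏ p ∈ sᶜ, chi (F p) (H p) := by
    intro c
    rw [h1]
    congr 1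
    · simp only [reprogram_apply hx]
    · refine Finset.prod_congr rfl fun p hp => ?_
      rw [reprogram_of_ne]
      rw [Finset.mem_compl, hmem] at hp
      exact hp
  simp only [h2, ← Finset.sum_mul]
  have h3 : ∑ c : Fin n → Bits w, ∏ i, chi (F (x i)) (c i) = ∏ i, ∑ v, chi (F (x i)) v := by
    rw [Finset.prod_univ_sum, Fintype.piFinset_univ]
  rw [h3]
  split_ifs with h
  · rw [h1 H]
    simp [h]
  · push Not at h
    obtain ⟨i, hi⟩ := h
    rw [Finset.prod_eq_zero (Finset.mem_univ i) (by rw [sum_chi, if_neg hi]), zero_mul]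

/-- Resampling the values of the random function at the points `x` annihilates the Fourier
coefficients that involve these points, and leaves the other ones unchanged. -/
lemma hat_resample (hx : Function.Injective x) (f : (Bits w → Bits w) → ℂ)
    (F : Bits w → Bits w) :
    hat (fun H => ∑ c, f (reprogram x c H)) F =
      if ∀ i, F (x i) = zeroWord w then (Fintype.card (Fin n → Bits w) : ℂ) * hat f F else 0 := by
  have h : ∑ H, fchi F H * ∑ c, f (reprogram x c H) =
      ∑ H, (∑ c, fchi F (reprogram x c H)) * f H := by
    simp only [Finset.mul_sum, Finset.sum_mul]
    rw [← Fintype.sum_prod_type' fun H c => fchi F H * f (reprogram x c H),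
      ← Fintype.sum_prod_type' fun H c => fchi F (reprogram x c H) * f H,
      ← (exchange hx).sum_comp]
    refine Finset.sum_congr rfl fun p _ => ?_
    simp only [exchange, Equiv.coe_fn_mk, reprogram_reprogram hx]
  rw [hat_apply, h]
  simp only [sum_fchi_reprogram hx]
  split_ifs
  · rw [hat_apply, ← mul_div_assoc, Finset.mul_sum]
    simp only [mul_assoc]
  · simp

open Classical in
/-- Resampling the values at some points moves a function by its Fourier weight on the characters
that depend on these values. -/
lemma sum_norm_sub_resample (hx : Function.Injective x) (f : (Bits w → Bits w) → ℂ) :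
    ∑ H, ∑ c, ‖f H - f (reprogram x c H)‖ ^ 2 =
      2 * (Fintype.card (Bits w → Bits w) * Fintype.card (Fin n → Bits w)) *
        ∑ F, if ∃ i, F (x i) ≠ zeroWord w then ‖hat f F‖ ^ 2 else 0 := by
  set T : ℝ := ((Fintype.card (Bits w → Bits w) : ℕ) : ℝ) with hT
  set K : ℝ := ((Fintype.card (Fin n → Bits w) : ℕ) : ℝ) with hK
  have hT0 : T ≠ 0 := by rw [hT]; positivity
  have hsub : ∀ u w : ℂ, ‖u - w‖ ^ 2 = ‖u‖ ^ 2 + ‖w‖ ^ 2 - 2 * (u * starRingEnd ℂ w).re := by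
    intro u w
    rw [← Complex.normSq_eq_norm_sq, ← Complex.normSq_eq_norm_sq, ← Complex.normSq_eq_norm_sq,
      Complex.normSq_sub]
  have h1 : ∑ H, ∑ c, ‖f (reprogram x c H)‖ ^ 2 = K * ∑ H, ‖f H‖ ^ 2 := by
    rw [← Fintype.sum_prod_type' fun H c => ‖f (reprogram x c H)‖ ^ 2, ← (exchange hx).sum_comp]
    simp only [exchange, Equiv.coe_fn_mk, reprogram_reprogram hx]
    rw [Fintype.sum_prod_type]
    simp only [Finset.sum_const, Finset.card_univ, nsmul_eq_mul, ← Finset.mul_sum, hK]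
  have h2 : ∑ H, ∑ _c : Fin n → Bits w, ‖f H‖ ^ 2 = K * ∑ H, ‖f H‖ ^ 2 := by
    simp only [Finset.sum_const, Finset.card_univ, nsmul_eq_mul, ← Finset.mul_sum, hK]
  -- the mixed term is the Fourier weight on the other characters
  have h3 : ∑ H, ∑ c, (f H * starRingEnd ℂ (f (reprogram x c H))).re =
      T * K * ∑ F, if ∃ i, F (x i) ≠ zeroWord w then 0 else ‖hat f F‖ ^ 2 := by
    have h := sum_hat_mul_conj_hat f (fun H => ∑ c, f (reprogram x c H))
    rw [eq_div_iff card_fun_ne_zero] at h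
    simp only [hat_resample hx, map_sum, Finset.mul_sum] at h
    have h' := congrArg Complex.re h
    simp only [Complex.re_sum] at h'
    rw [← h', mul_comm, ← Complex.ofReal_natCast, Complex.re_ofReal_mul, ← hT, mul_assoc,
      Complex.re_sum, Finset.mul_sum (a := K)]
    refine congrArg _ (Finset.sum_congr rfl fun F _ => ?_)
    by_cases hF : ∃ i, F (x i) ≠ zeroWord w
    · rw [if_pos hF, if_neg (by push Not; exact hF)]
      simp
    · rw [if_neg hF, if_pos (by push Not at hF; exact hF), map_mul, Complex.conj_natCast,
        mul_left_comm, Complex.mul_conj, Complex.normSq_eq_norm_sq]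
      rw [← Complex.ofReal_natCast, ← Complex.ofReal_mul, Complex.ofReal_re]
  have h4 : ∑ H, ‖f H‖ ^ 2 = T * ∑ F, ‖hat f F‖ ^ 2 := by
    rw [sum_norm_hat_sq, mul_div_cancel₀ _ hT0]
  have h5 : ∑ F, ‖hat f F‖ ^ 2 = (∑ F, if ∃ i, F (x i) ≠ zeroWord w then ‖hat f F‖ ^ 2 else 0) +
      ∑ F, if ∃ i, F (x i) ≠ zeroWord w then 0 else ‖hat f F‖ ^ 2 := by
    rw [← Finset.sum_add_distrib]
    exact Finset.sum_congr rfl fun F _ => by split_ifs <;> simp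
  simp only [hsub, Finset.sum_add_distrib, Finset.sum_sub_distrib, h1, h2, ← Finset.mul_sum, h3]
  rw [h4, h5]
  ring

end Resample

/-! ### Counting coins -/

/-- The points of the random oracle whose values are the commitments. -/
abbrev points {l n : ℕ} (b : Fin n → Bits 1) (r : Fin n → Bits l) : Fin n → Bits (l + 1) :=
  fun i => hashInput (b i) (r i)

lemma hashInput_tail {l : ℕ} (b : Bits 1) (r : Bits l) : Fin.tail (hashInput b r) = r :=
  Fin.tail_cons (α := fun _ => Bool) _ _

lemma points_injective {l n : ℕ} (b : Fin n → Bits 1) {r : Fin n → Bits l}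
    (hr : Function.Injective r) : Function.Injective (points b r) := by
  intro i j hij
  apply hr
  rw [← hashInput_tail (b i) (r i), ← hashInput_tail (b j) (r j)]
  exact congrArg _ hij

lemma card_filter_apply_eq {l n : ℕ} (i : Fin n) (v : Bits l) :
    ((Finset.univ.filter fun r : Fin n → Bits l => r i = v).card : ℝ) =
      Fintype.card (Fin n → Bits l) / 2 ^ l := by
  classical
  have h : (Finset.univ.filter fun r : Fin n → Bits l => r i = v) =
      Fintype.piFinset fun k => if k = i then {v} else Finset.univ := by
    ext r
    simp only [Finset.mem_filter, Finset.mem_univ, true_and, Fintype.mem_piFinset]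
    constructor
    · rintro h k
      split_ifs with hk
      · subst hk; simpa using h
      · simp
    · intro h
      simpa using h i
  have h2 : ∀ k, (if k = i then ({v} : Finset (Bits l)) else Finset.univ).card =
      if k = i then 1 else 2 ^ l := by
    intro k; split_ifs <;> simp
  rw [h, Fintype.card_piFinset]
  simp only [h2, Fintype.card_pi, Fintype.card_bool, Finset.prod_const, Finset.card_univ,
    Fintype.card_fin]
  rw [eq_div_iff (by positivity), ← Finset.mul_prod_erase _ _ (Finset.mem_univ i), if_pos rfl,
    Finset.prod_congr rfl fun k hk => if_neg (Finset.ne_of_mem_erase hk)]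
  have hn : n ≠ 0 := by rintro rfl; exact i.elim0
  obtain ⟨m, rfl⟩ := Nat.exists_eq_succ_of_ne_zero hn
  simp [pow_succ]

lemma card_filter_points_mem_le {l n : ℕ} (b : Fin n → Bits 1) (s : Finset (Bits (l + 1))) :
    ((Finset.univ.filter fun r : Fin n → Bits l => ∃ i, points b r i ∈ s).card : ℝ) ≤
      n * s.card / 2 ^ l * Fintype.card (Fin n → Bits l) := by
  classical
  have h : (Finset.univ.filter fun r : Fin n → Bits l => ∃ i, points b r i ∈ s) ⊆
      (Finset.univ : Finset (Fin n)).biUnion fun i => s.biUnion fun p =>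
        Finset.univ.filter fun r : Fin n → Bits l => r i = Fin.tail p := by
    intro r hr
    obtain ⟨i, hi⟩ := (Finset.mem_filter.1 hr).2
    simp only [Finset.mem_biUnion, Finset.mem_filter, Finset.mem_univ, true_and]
    exact ⟨i, _, hi, (hashInput_tail _ _).symm⟩
  have h2 : ((Finset.univ.filter fun r : Fin n → Bits l => ∃ i, points b r i ∈ s).card : ℝ) ≤
      ∑ i : Fin n, ∑ p ∈ s,
        ((Finset.univ.filter fun r : Fin n → Bits l => r i = Fin.tail p).card : ℝ) := by
    have := (Finset.card_le_card h).trans (Finset.card_biUnion_le.trans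
      (Finset.sum_le_sum fun i _ => Finset.card_biUnion_le))
    exact_mod_cast this
  refine h2.trans (le_of_eq ?_)
  simp only [card_filter_apply_eq, Finset.sum_const, Finset.card_univ, Fintype.card_fin,
    nsmul_eq_mul]
  ring

open Classical in
lemma card_filter_points_eq_le {l n : ℕ} (b : Fin n → Bits 1) (p : Bits (l + 1)) :
    ((Finset.univ.filter fun r : Fin n → Bits l => ∃ i, points b r i = p).card : ℝ) ≤
      n / 2 ^ l * Fintype.card (Fin n → Bits l) := by
  have h := card_filter_points_mem_le b {p}
  simpa using h

open Classical in
/-- The probability of a collision among the coins. -/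
lemma card_filter_not_injective_le (l n : ℕ) :
    ((Finset.univ.filter fun r : Fin n → Bits l => ¬Function.Injective r).card : ℝ) ≤
      n ^ 2 / (2 * 2 ^ l) * Fintype.card (Fin n → Bits l) := by
  -- adding `r j` to `r i` turns the event `r i = r j` into `r i = 0`
  have hpair : ∀ i j : Fin n, i ≠ j →
      ((Finset.univ.filter fun r : Fin n → Bits l => r i = r j).card : ℝ) =
        Fintype.card (Fin n → Bits l) / 2 ^ l := by
    intro i j hij
    rw [← card_filter_apply_eq i (zeroWord l)]
    congr 1
    refine Finset.card_bij' (fun r _ => Function.update r i ((r i).xor (r j)))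
      (fun r _ => Function.update r i ((r i).xor (r j))) ?_ ?_ ?_ ?_
    · intro r hr
      simp only [Finset.mem_filter, Finset.mem_univ, true_and, Function.update_self] at hr ⊢
      exact Bits.xor_eq_zero.2 hr
    · intro r hr
      simp only [Finset.mem_filter, Finset.mem_univ, true_and, Function.update_self,
        Function.update_of_ne hij.symm] at hr ⊢
      rw [hr]
      funext k; simp [Bits.xor]
    · intro r _
      simp only [Function.update_self, Function.update_of_ne hij.symm, Function.update_idem,
        Bits.xor_xor_cancel, Function.update_eq_self]
    · intro r _
      simp only [Function.update_self, Function.update_of_ne hij.symm, Function.update_idem,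
        Bits.xor_xor_cancel, Function.update_eq_self]
  have hsub : (Finset.univ.filter fun r : Fin n → Bits l => ¬Function.Injective r) ⊆
      (Finset.univ : Finset (Fin n)).biUnion fun j => (Finset.univ.filter fun i => i < j).biUnion
        fun i => Finset.univ.filter fun r : Fin n → Bits l => r i = r j := by
    intro r hr
    have hr' := (Finset.mem_filter.1 hr).2
    simp only [Function.Injective] at hr'
    push Not at hr'
    obtain ⟨i, j, hij, hne⟩ := hr'
    simp only [Finset.mem_biUnion, Finset.mem_filter, Finset.mem_univ, true_and]
    rcases lt_or_gt_of_ne hne with h | h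
    · exact ⟨j, i, h, hij⟩
    · exact ⟨i, j, h, hij.symm⟩
  have h1 : ((Finset.univ.filter fun r : Fin n → Bits l => ¬Function.Injective r).card : ℝ) ≤
      ∑ j : Fin n, ∑ i ∈ Finset.univ.filter fun i => i < j,
        ((Finset.univ.filter fun r : Fin n → Bits l => r i = r j).card : ℝ) := by
    have := (Finset.card_le_card hsub).trans (Finset.card_biUnion_le.trans
      (Finset.sum_le_sum fun j _ => Finset.card_biUnion_le))
    exact_mod_cast this
  have h2 : ∀ j : Fin n, ∑ i ∈ Finset.univ.filter fun i => i < j,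
        ((Finset.univ.filter fun r : Fin n → Bits l => r i = r j).card : ℝ) =
      j * (Fintype.card (Fin n → Bits l) / 2 ^ l) := by
    intro j
    rw [Finset.sum_congr rfl fun i hi => hpair i j (Finset.mem_filter.1 hi).2.ne,
      Finset.sum_const, nsmul_eq_mul]
    congr 2
    rw [show (Finset.univ.filter fun i => i < j) = Finset.Iio j by ext; simp, Fin.card_Iio]
  refine h1.trans ?_
  simp only [h2, ← Finset.sum_mul]
  have h3 : ∑ j : Fin n, (j : ℝ) ≤ n ^ 2 / 2 := by
    rw [Fin.sum_univ_eq_sum_range fun j => (j : ℝ)]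
    have h := Finset.sum_range_id_mul_two n
    have h' : ((∑ j ∈ Finset.range n, j : ℕ) : ℝ) * 2 ≤ n ^ 2 := by
      have : (∑ j ∈ Finset.range n, j) * 2 ≤ n ^ 2 := by
        rw [h, pow_two]; exact Nat.mul_le_mul_left _ (Nat.sub_le _ _)
      exact_mod_cast this
    push_cast at h'
    linarith
  calc _ ≤ (n ^ 2 / 2 : ℝ) * (Fintype.card (Fin n → Bits l) / 2 ^ l) := by gcongr
    _ = _ := by field_simp

/-! ### Weights at labels -/

/-- Evaluation of the memory amplitudes at a label. -/
abbrev pt {M : Type} (m : M) : (M → ℂ) →ₗ[ℂ] (Unit → ℂ) := pull fun _ => m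

lemma wt_pull_sub {R M M' : Type} [Fintype R] [Fintype M'] (a b : M' → M)
    (e : MixedState R M) : wt (pull a - pull b) e = ∑ m, wt (pt (a m) - pt (b m)) e :=
  wt_eq_sum_pull _ _

lemma wt_id {R M : Type} [Fintype R] [Fintype M] (e : MixedState R M) :
    wt LinearMap.id e = ∑ m, wt (pt m) e := wt_eq_sum_pull _ _

lemma le_of_forall_weight {X ε : ℝ} (hε : 0 ≤ ε) (h : ∀ t > 0, X ≤ t / 4 * ε ^ 2 + 1 / t) :
    X ≤ ε := by
  rcases hε.eq_or_lt with rfl | hε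
  · refine le_of_forall_pos_le_add fun δ hδ => ?_
    have := h (1 / δ) (by positivity)
    simpa using this
  · have := h (2 / ε) (by positivity)
    have h2 : 2 / ε / 4 * ε ^ 2 + 1 / (2 / ε) = ε := by field_simp; norm_num
    linarith

/-! ### The experiments for a fixed security parameter -/

/-- The type of the random function. -/
abbrev Fn (w : ℕ) : Type := Bits w → Bits w

/-- The restriction of an ensemble to a label of the memory. -/
abbrev atLabel {R M : Type} (m : M) (e : MixedState R M) : MixedState R Unit :=
  e.map (onMem (pt m))

section Experiments

variable {l n d₁ d₂ : ℕ} (A₁ : OracleAlg (l + 1) (Fin 1) (Fin d₁) (Fin n → Bits 1))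
  (A₂ : (Fin n → Bits (l + 1)) → OracleAlg (l + 1) (Fin d₁) (Fin d₂) Unit)
  (D : (Fin n → Bits (l + 1)) → (Fin n → Bits 1) → (Fin n → Bits l) →
    OracleAlg (l + 1) (Fin d₂) (Fin 1) Bool)

/-- The state of the first adversary after the choice of the messages `b`, as a function of the
random function. -/
def firstState (b : Fin n → Bits 1) : MixedState (Fin d₁) (Fn (l + 1)) :=
  A₁.run (ctrl fun H => H) 0 b [fun _ _ => 1]

/-- The probability that the distinguisher outputs `1`, if the second adversary is started on `e`
with the oracle `H`, and the distinguisher has the oracle `H'`. -/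
def endProb (H H' : Fn (l + 1)) (c : Fin n → Bits (l + 1)) (b : Fin n → Bits 1)
    (r : Fin n → Bits l) (e : MixedState (Fin d₁) Unit) : ℝ :=
  MixedState.trace ((D c b r).run (functionOracle H') 0 true
    ((A₂ c).run (functionOracle H) 0 () e))

lemma atLabel_run {w : ℕ} {R R' B M : Type} [Fintype R] [DecidableEq R]
    [Fintype R'] [Fintype B] (A : OracleAlg w R R' B) (g : M → Fn w) (m : M) (b : B)
    (e : MixedState R M) :
    A.run (functionOracle (g m)) 0 b (atLabel m e) = atLabel m (A.run (ctrl g) 0 b e) :=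
  A.run_map_pull g (fun _ => m) 0 0 b e

lemma trace_atLabel {R M : Type} [Fintype R] (m : M) (e : MixedState R M) :
    MixedState.trace (atLabel m e) = wt (pt m) e := trace_map_onMem _ _

lemma firstState_atLabel (b : Fin n → Bits 1) (H : Fn (l + 1)) :
    atLabel H (firstState A₁ b) = A₁.run (functionOracle H) 0 b trivialState := by
  rw [firstState, ← atLabel_run]
  rfl

lemma sum_wt_pt_firstState (H : Fn (l + 1)) :
    ∑ b, wt (pt H) (firstState A₁ b) = 1 := by
  simp only [firstState]
  rw [A₁.sum_wt_run (ctrl_intertwines_pull _ _)]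
  simp [wt, sqn, onMem]

lemma sum_wt_id_firstState :
    ∑ b, wt LinearMap.id (firstState A₁ b) = Fintype.card (Fn (l + 1)) := by
  simp only [wt_id]
  rw [Finset.sum_comm]
  simp [sum_wt_pt_firstState]

lemma memIn_firstState (b : Fin n → Bits 1) :
    MemIn (sparse (l + 1) A₁.queries) (firstState A₁ b) := by
  have h : Intertwines LinearMap.id (sparse (l + 1)) (ctrl fun H : Fn (l + 1) => H)
      (ctrl fun H => H) := by
    intro j d ψ hψ
    refine ⟨rfl, fun r => ?_⟩
    have h := ctrl_mem_sparse (j := j) (fun _ => zeroWord _) (fun _ _ => true) ψ hψ r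
    have h2 : (fun (H : Fn (l + 1)) x => (zeroWord (l + 1)).xor
        (Bits.and (fun _ => true) (H x))) = fun H => H := by
      funext H x i
      simp [Bits.xor, Bits.and]
    rwa [h2] at h
  have h2 := (h.run A₁ 0 b (e := [fun _ _ => 1]) (by
    intro ψ hψ r
    rw [List.mem_singleton] at hψ
    subst hψ
    exact const_mem_sparse _ _ _)).2
  rwa [Nat.zero_add] at h2

lemma firstState_eq_const (h0 : A₁.queries = 0) (b : Fin n → Bits 1) :
    ∃ e : MixedState (Fin d₁) Unit, firstState A₁ b = e.map (onMem (pull fun _ => ())) := by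
  have hs : A₁.steps = [] := List.length_eq_zero_iff.1 h0
  refine ⟨A₁.final.apply b (A₁.prep.apply () trivialState), ?_⟩
  rw [← QInstrument.apply_map_onMem, ← QInstrument.apply_map_onMem]
  simp only [firstState, OracleAlg.run, hs, runSteps]
  rfl

lemma endProb_nonneg (H H' : Fn (l + 1)) (c : Fin n → Bits (l + 1)) (b : Fin n → Bits 1)
    (r : Fin n → Bits l) (e : MixedState (Fin d₁) Unit) : 0 ≤ endProb A₂ D H H' c b r e :=
  List.sum_nonneg fun x hx => by
    obtain ⟨ψ, -, rfl⟩ := List.mem_map.1 hx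
    exact Finset.sum_nonneg fun _ _ => tsum_nonneg fun _ => by positivity

lemma trace_eq_wt_id {R : Type} [Fintype R] (e : MixedState R Unit) :
    MixedState.trace e = wt LinearMap.id e := by
  rw [← trace_map_onMem]
  congr 1
  exact (List.map_id _).symm

lemma functionOracle_intertwines_id {w : ℕ} (H : Fn w) :
    Intertwines LinearMap.id (fun _ => ⊤) (functionOracle H) (functionOracle H) :=
  fun _ _ _ _ => ⟨rfl, fun _ => trivial⟩

lemma sum_wt_run_functionOracle {w : ℕ} {R R' B : Type} [Fintype R] [DecidableEq R]
    [Fintype R'] [Fintype B] (A : OracleAlg w R R' B) (H : Fn w) (j : ℕ)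
    (e : MixedState R Unit) :
    ∑ b, wt LinearMap.id (A.run (functionOracle H) j b e) = wt LinearMap.id e :=
  A.sum_wt_run (functionOracle_intertwines_id H) j e

lemma endProb_le (H H' : Fn (l + 1)) (c : Fin n → Bits (l + 1)) (b : Fin n → Bits 1)
    (r : Fin n → Bits l) (e : MixedState (Fin d₁) Unit) :
    endProb A₂ D H H' c b r e ≤ wt LinearMap.id e := by
  rw [← sum_wt_run_functionOracle (A₂ c) H 0 e, endProb, trace_eq_wt_id]
  simp only [Finset.univ_unique, Finset.sum_singleton]
  rw [← sum_wt_run_functionOracle (D c b r) H' 0, Fintype.sum_bool]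
  exact le_add_of_nonneg_right (wt_nonneg _ _)

lemma sum_endProb_le (H : Fn (l + 1)) (H₁ H₂ : (Fin n → Bits 1) → Fn (l + 1))
    (c : (Fin n → Bits 1) → Fin n → Bits (l + 1)) (r : Fin n → Bits l) :
    ∑ b, endProb A₂ D (H₁ b) (H₂ b) (c b) b r (atLabel H (firstState A₁ b)) ≤ 1 := by
  rw [← sum_wt_pt_firstState A₁ H]
  refine Finset.sum_le_sum fun b _ => (endProb_le _ _ _ _ _ _ _ _).trans (le_of_eq ?_)
  rw [← trace_eq_wt_id, trace_atLabel]

/-- Replacing the state after the first stage by the one at another label changes the outcome at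
most by the distance of the two states; `t` is free, so that the choice can be made after
summing. -/
lemma abs_endProb_sub_le {M : Type} (H H' : Fn (l + 1)) (c : Fin n → Bits (l + 1))
    (b : Fin n → Bits 1) (r : Fin n → Bits l) (e : MixedState (Fin d₁) M) (m₀ m₁ : M) {t : ℝ}
    (ht : 0 < t) :
    |2 * (endProb A₂ D H H' c b r (atLabel m₀ e) - endProb A₂ D H H' c b r (atLabel m₁ e)) -
        (wt (pt m₀) e - wt (pt m₁) e)| ≤
      t / 2 * wt (pt m₀ - pt m₁) e + (1 / t) * (wt (pt m₀) e + wt (pt m₁) e) := by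
  have h1 : ∀ m : M, endProb A₂ D H H' c b r (atLabel m e) =
      wt (pt m) ((D c b r).run (ctrl fun _ => H') 0 true
        ((A₂ c).run (ctrl fun _ => H) 0 () e)) := by
    intro m
    rw [endProb, atLabel_run (A₂ c) (fun _ => H) m, atLabel_run (D c b r) (fun _ => H') m,
      trace_atLabel]
  have h2 := (D c b r).abs_wt_run_sub_le (fun _ => H') (fun _ : Unit => m₀) (fun _ => m₁)
    (fun _ => rfl) 0 ((A₂ c).run (ctrl fun _ => H) 0 () e) ht
  have h3 := (A₂ c).sum_wt_run (ctrl_intertwines_sub (fun _ => H) (fun _ : Unit => m₀)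
    (fun _ => m₁) fun _ => rfl) 0 e
  have h4 := (A₂ c).sum_wt_run (ctrl_intertwines_pull (fun _ => H) (fun _ : Unit => m₀)) 0 e
  have h5 := (A₂ c).sum_wt_run (ctrl_intertwines_pull (fun _ => H) (fun _ : Unit => m₁)) 0 e
  simp only [Finset.univ_unique, Finset.sum_singleton] at h3 h4 h5
  have hu : (default : Unit) = () := rfl
  rw [hu] at h3 h4 h5
  rw [h1, h1]
  rw [h3, h4, h5] at h2
  exact h2

/-- The real experiment with coins `r`, up to normalisation. The additional tuple of commitments
is not used. -/
def realSum (r : Fin n → Bits l) : ℝ :=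
  ∑ b, ∑ p : Fn (l + 1) × (Fin n → Bits (l + 1)),
    endProb A₂ D p.1 p.1 (fun i => p.1 (points b r i)) b r (atLabel p.1 (firstState A₁ b))

/-- The experiment in which the commitments are random, and the random function is reprogrammed
when the commitments are made. -/
def commitSum (r : Fin n → Bits l) : ℝ :=
  ∑ b, ∑ p : Fn (l + 1) × (Fin n → Bits (l + 1)),
    endProb A₂ D (reprogram (points b r) p.2 p.1) (reprogram (points b r) p.2 p.1) p.2 b r
      (atLabel p.1 (firstState A₁ b))

/-- The experiment in which the commitments are random, and the random function is reprogrammed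
when the commitments are opened. -/
def openSum (r : Fin n → Bits l) : ℝ :=
  ∑ b, ∑ p : Fn (l + 1) × (Fin n → Bits (l + 1)),
    endProb A₂ D p.1 (reprogram (points b r) p.2 p.1) p.2 b r (atLabel p.1 (firstState A₁ b))

open Classical in
/-- The weight of the database entries at the points of the commitments. -/
def touchWeight (b : Fin n → Bits 1) (r : Fin n → Bits l) : ℝ :=
  ((firstState A₁ b).map fun ψ => ∑ s, ∑ F : Fn (l + 1),
    if ∃ i, F (points b r i) ≠ zeroWord (l + 1) then ‖hat (ψ s) F‖ ^ 2 else 0).sum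

lemma sum_wt_sub_resample {r : Fin n → Bits l} (hr : Function.Injective r) (b : Fin n → Bits 1) :
    ∑ p : Fn (l + 1) × (Fin n → Bits (l + 1)),
      wt (pt p.1 - pt (reprogram (points b r) p.2 p.1)) (firstState A₁ b) =
    2 * (Fintype.card (Fn (l + 1)) * Fintype.card (Fin n → Bits (l + 1))) *
      touchWeight A₁ b r := by
  simp only [wt, touchWeight, ← list_sum_map_sum]
  rw [← List.sum_map_mul_left]
  congr 1
  refine List.map_congr_left fun ψ _ => ?_
  simp only [sqn, onMem, Finset.univ_unique, Finset.sum_singleton]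
  rw [Finset.sum_comm, Finset.mul_sum]
  refine Finset.sum_congr rfl fun s _ => ?_
  rw [Fintype.sum_prod_type]
  exact sum_norm_sub_resample (points_injective b hr) (ψ s)

lemma sum_wt_exchange {r : Fin n → Bits l} (hr : Function.Injective r) (b : Fin n → Bits 1) :
    ∑ p : Fn (l + 1) × (Fin n → Bits (l + 1)),
      wt (pt (reprogram (points b r) p.2 p.1)) (firstState A₁ b) =
    ∑ p : Fn (l + 1) × (Fin n → Bits (l + 1)), wt (pt p.1) (firstState A₁ b) :=
  (exchange (points_injective b hr)).sum_comp fun p => wt (pt p.1) (firstState A₁ b)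

lemma sum_wt_pt_pairs :
    ∑ b, ∑ p : Fn (l + 1) × (Fin n → Bits (l + 1)), wt (pt p.1) (firstState A₁ b) =
      Fintype.card (Fn (l + 1)) * Fintype.card (Fin n → Bits (l + 1)) := by
  rw [Finset.sum_comm, Fintype.sum_prod_type]
  simp only [sum_wt_pt_firstState]
  simp

/-- Reprogramming at the time of the commitment: exchanging the values of the random function at
the points of the commitments with the fresh commitments yields the real experiment, but with
a first adversary who sees independent values at these points. -/
lemma abs_realSum_sub_commitSum_le {r : Fin n → Bits l} (hr : Function.Injective r) {t : ℝ}
    (ht : 0 < t) :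
    |realSum A₁ A₂ D r - commitSum A₁ A₂ D r| ≤
      Fintype.card (Fn (l + 1)) * Fintype.card (Fin n → Bits (l + 1)) *
        (t / 2 * ∑ b, touchWeight A₁ b r + 1 / t) := by
  have h1 : commitSum A₁ A₂ D r = ∑ b, ∑ p : Fn (l + 1) × (Fin n → Bits (l + 1)),
      endProb A₂ D p.1 p.1 (fun i => p.1 (points b r i)) b r
        (atLabel (reprogram (points b r) p.2 p.1) (firstState A₁ b)) := by
    refine Finset.sum_congr rfl fun b _ => ?_
    rw [← (exchange (points_injective b hr)).sum_comp]
    refine Finset.sum_congr rfl fun p _ => ?_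
    simp only [exchange, Equiv.coe_fn_mk, reprogram_reprogram (points_injective b hr)]
  have h2 : |2 * (realSum A₁ A₂ D r - commitSum A₁ A₂ D r) -
      ∑ b, ∑ p : Fn (l + 1) × (Fin n → Bits (l + 1)), (wt (pt p.1) (firstState A₁ b) -
        wt (pt (reprogram (points b r) p.2 p.1)) (firstState A₁ b))| ≤
      ∑ b, ∑ p : Fn (l + 1) × (Fin n → Bits (l + 1)),
        (t / 2 * wt (pt p.1 - pt (reprogram (points b r) p.2 p.1)) (firstState A₁ b) +
          (1 / t) * (wt (pt p.1) (firstState A₁ b) +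
            wt (pt (reprogram (points b r) p.2 p.1)) (firstState A₁ b))) := by
    rw [h1, realSum]
    simp only [← Finset.sum_sub_distrib, Finset.mul_sum]
    refine (Finset.abs_sum_le_sum_abs _ _).trans (Finset.sum_le_sum fun b _ => ?_)
    refine (Finset.abs_sum_le_sum_abs _ _).trans (Finset.sum_le_sum fun p _ => ?_)
    exact abs_endProb_sub_le A₂ D _ _ _ _ _ _ _ _ ht
  simp only [Finset.sum_sub_distrib, Finset.sum_add_distrib, ← Finset.mul_sum,
    sum_wt_exchange A₁ hr, sum_wt_sub_resample A₁ hr, sum_wt_pt_pairs, sub_self,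
    Finset.sum_const_zero, sub_zero] at h2
  rw [abs_mul, abs_two] at h2
  have h3 : (0 : ℝ) < 2 := two_pos
  have h4 : (1 : ℝ) / t * (Fintype.card (Fn (l + 1)) * Fintype.card (Fin n → Bits (l + 1)) +
      Fintype.card (Fn (l + 1)) * Fintype.card (Fin n → Bits (l + 1))) =
      2 * (Fintype.card (Fn (l + 1)) * Fintype.card (Fin n → Bits (l + 1)) * (1 / t)) := by ring
  rw [h4] at h2
  nlinarith [h2]

open Classical in
/-- A first adversary with `q` queries has a database with at most `q` entries, and random points
are unlikely to be among them. -/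
lemma sum_touchWeight_le :
    ∑ r : Fin n → Bits l, ∑ b, touchWeight A₁ b r ≤
      n * A₁.queries / 2 ^ l * Fintype.card (Fin n → Bits l) := by
  have key : ∀ b, ∑ r : Fin n → Bits l, touchWeight A₁ b r ≤
      n * A₁.queries / 2 ^ l * Fintype.card (Fin n → Bits l) *
        ((Fintype.card (Fn (l + 1)) : ℝ)⁻¹ * wt LinearMap.id (firstState A₁ b)) := by
    intro b
    simp only [touchWeight, wt, ← list_sum_map_sum]
    rw [← List.sum_map_mul_left, ← List.sum_map_mul_left]
    refine List.sum_le_sum fun ψ hψ => ?_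
    have hp : (Fintype.card (Fn (l + 1)) : ℝ)⁻¹ * sqn (onMem LinearMap.id ψ) =
        ∑ s, ∑ F, ‖hat (ψ s) F‖ ^ 2 := by
      rw [mul_comm, ← div_eq_mul_inv]
      simp only [sum_norm_hat_sq, sqn, Finset.sum_div]
      rfl
    rw [hp, Finset.sum_comm, Finset.mul_sum]
    refine Finset.sum_le_sum fun s _ => ?_
    rw [Finset.sum_comm, Finset.mul_sum]
    refine Finset.sum_le_sum fun F _ => ?_
    rw [← Finset.sum_filter, Finset.sum_const, nsmul_eq_mul]
    by_cases hF : A₁.queries < (fsupp F).card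
    · rw [memIn_firstState A₁ b ψ hψ s F hF]
      simp
    · refine mul_le_mul_of_nonneg_right ?_ (by positivity)
      have h := card_filter_points_mem_le (n := n) b (fsupp F)
      simp only [mem_fsupp] at h
      refine h.trans ?_
      have : ((fsupp F).card : ℝ) ≤ A₁.queries := by exact_mod_cast not_lt.1 hF
      gcongr
  rw [Finset.sum_comm]
  refine (Finset.sum_le_sum fun b _ => key b).trans (le_of_eq ?_)
  rw [← Finset.mul_sum, ← Finset.mul_sum, sum_wt_id_firstState, inv_mul_cancel₀ (by positivity),
    mul_one]

/-- The joint state of the runs of the second adversary with the original and with the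
reprogrammed random functions. -/
def secondState (b : Fin n → Bits 1) (c : Fin n → Bits (l + 1)) :
    MixedState (Fin d₂) (Fn (l + 1) × Option (Fin n → Bits l)) :=
  (A₂ c).run (ctrl (bothOracles (points b) c)) 0 ()
    ((firstState A₁ b).map (onMem (pull fun m => m.1)))

lemma wt_secondState (b : Fin n → Bits 1) (c : Fin n → Bits (l + 1))
    (m : Fn (l + 1) × Option (Fin n → Bits l)) :
    wt (pt m) (secondState A₁ A₂ b c) = wt (pt m.1) (firstState A₁ b) := by
  have h := (A₂ c).sum_wt_run (ctrl_intertwines_pull (bothOracles (points b) c)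
    (fun _ : Unit => m)) 0 ((firstState A₁ b).map (onMem (pull fun m => m.1)))
  simp only [Finset.univ_unique, Finset.sum_singleton] at h
  exact h.trans (wt_map_onMem _ _ _)

lemma endProb_eq_secondState (b : Fin n → Bits 1) (c : Fin n → Bits (l + 1)) (r : Fin n → Bits l)
    (H' : Fn (l + 1)) (m : Fn (l + 1) × Option (Fin n → Bits l)) :
    endProb A₂ D (bothOracles (points b) c m) H' c b r (atLabel m.1 (firstState A₁ b)) =
      wt (pt m) ((D c b r).run (ctrl fun _ => H') 0 true (secondState A₁ A₂ b c)) := by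
  have h : atLabel m.1 (firstState A₁ b) = atLabel m ((firstState A₁ b).map
      (onMem (pull fun m : Fn (l + 1) × Option (Fin n → Bits l) => m.1))) := by
    rw [atLabel, atLabel, List.map_map]; rfl
  rw [endProb, h, atLabel_run, atLabel_run (D c b r) (fun _ => H') m, trace_atLabel]
  rfl

/-- Reprogramming when the commitments are opened instead of when they are made. -/
lemma sum_abs_commitSum_sub_openSum_le {C : ℝ}
    (hC : ∀ b c, wt (pull orig - pull modif) (secondState A₁ A₂ b c) ≤
      C * Fintype.card (Fin n → Bits l) * wt LinearMap.id (firstState A₁ b)) {t : ℝ}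
    (ht : 0 < t) :
    ∑ r, |commitSum A₁ A₂ D r - openSum A₁ A₂ D r| ≤
      Fintype.card (Fn (l + 1)) * Fintype.card (Fin n → Bits (l + 1)) *
        Fintype.card (Fin n → Bits l) * (t / 4 * C + 1 / t) := by
  have h1 : ∀ (b : Fin n → Bits 1) (c : Fin n → Bits (l + 1)) (p : Fn (l + 1) × (Fin n → Bits l)),
      |endProb A₂ D (reprogram (points b p.2) c p.1) (reprogram (points b p.2) c p.1) c b p.2
          (atLabel p.1 (firstState A₁ b)) -
        endProb A₂ D p.1 (reprogram (points b p.2) c p.1) c b p.2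
          (atLabel p.1 (firstState A₁ b))| ≤
        t / 4 * wt (pt (orig p) - pt (modif p)) (secondState A₁ A₂ b c) +
          1 / t * wt (pt p.1) (firstState A₁ b) := by
    intro b c p
    have h2 := (D c b p.2).abs_wt_run_sub_le (fun _ => reprogram (points b p.2) c p.1)
      (fun _ : Unit => orig p) (fun _ => modif p) (fun _ => rfl) 0 (secondState A₁ A₂ b c) ht
    rw [wt_secondState, wt_secondState] at h2
    simp only [orig, modif, sub_self, sub_zero] at h2
    rw [← endProb_eq_secondState A₁ A₂ D b c p.2 _ (p.1, none),
      ← endProb_eq_secondState A₁ A₂ D b c p.2 _ (p.1, some p.2), abs_mul, abs_two,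
      abs_sub_comm] at h2
    simp only [bothOracles] at h2
    have h3 : 1 / t * (wt (pt p.1) (firstState A₁ b) + wt (pt p.1) (firstState A₁ b)) =
      2 * (1 / t * wt (pt p.1) (firstState A₁ b)) := by ring
    simp only [orig, modif]
    rw [h3] at h2
    linarith
  calc ∑ r, |commitSum A₁ A₂ D r - openSum A₁ A₂ D r|
      ≤ ∑ r : Fin n → Bits l, ∑ b, ∑ p : Fn (l + 1) × (Fin n → Bits (l + 1)),
        (t / 4 * wt (pt (orig (p.1, r)) - pt (modif (p.1, r))) (secondState A₁ A₂ b p.2) +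
          1 / t * wt (pt p.1) (firstState A₁ b)) := by
        refine Finset.sum_le_sum fun r _ => ?_
        simp only [commitSum, openSum, ← Finset.sum_sub_distrib]
        refine (Finset.abs_sum_le_sum_abs _ _).trans (Finset.sum_le_sum fun b _ => ?_)
        refine (Finset.abs_sum_le_sum_abs _ _).trans (Finset.sum_le_sum fun p _ => ?_)
        exact h1 b p.2 (p.1, r)
    _ = ∑ b, ∑ c : Fin n → Bits (l + 1),
        (t / 4 * wt (pull orig - pull modif) (secondState A₁ A₂ b c) +
          1 / t * (Fintype.card (Fin n → Bits l) * wt LinearMap.id (firstState A₁ b))) := by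
        rw [Finset.sum_comm]
        refine Finset.sum_congr rfl fun b _ => ?_
        have hc : ∀ f : (Fin n → Bits l) → Fn (l + 1) → (Fin n → Bits (l + 1)) → ℝ,
            ∑ r, ∑ H, ∑ c, f r H c = ∑ c, ∑ H, ∑ r, f r H c := fun f =>
          (Finset.sum_congr rfl fun _ _ => Finset.sum_comm).trans
            (Finset.sum_comm.trans (Finset.sum_congr rfl fun _ _ => Finset.sum_comm))
        simp only [Fintype.sum_prod_type]
        rw [hc]
        refine Finset.sum_congr rfl fun c _ => ?_
        rw [wt_pull_sub, wt_id, Fintype.sum_prod_type]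
        simp only [Finset.sum_add_distrib, Finset.mul_sum, Finset.sum_const, Finset.card_univ,
          nsmul_eq_mul]
        congr 1
        refine Finset.sum_congr rfl fun H _ => ?_
        ring
    _ ≤ ∑ b, ∑ c : Fin n → Bits (l + 1),
        (t / 4 * (C * Fintype.card (Fin n → Bits l) * wt LinearMap.id (firstState A₁ b)) +
          1 / t * (Fintype.card (Fin n → Bits l) * wt LinearMap.id (firstState A₁ b))) := by
        gcongr with b _ c _
        exact hC b c
    _ = ∑ b, Fintype.card (Fin n → Bits (l + 1)) * Fintype.card (Fin n → Bits l) *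
        (t / 4 * C + 1 / t) * wt LinearMap.id (firstState A₁ b) := by
        refine Finset.sum_congr rfl fun b _ => ?_
        rw [Finset.sum_const, nsmul_eq_mul, Finset.card_univ]
        ring
    _ = _ := by
        rw [← Finset.mul_sum, sum_wt_id_firstState]
        ring

end Experiments

/-! ### The distance of the experiments -/

lemma two_rpow_half (l : ℕ) : (2 : ℝ) ^ ((l : ℝ) / 2) = √((2 : ℝ) ^ l) := by
  rw [Real.sqrt_eq_rpow, ← Real.rpow_natCast, ← Real.rpow_mul (by norm_num)]
  congr 1
  ring

lemma sq_sqrt_div (n l : ℕ) : (√n / √((2 : ℝ) ^ l)) ^ 2 = n / 2 ^ l := by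
  rw [div_pow, Real.sq_sqrt (by positivity), Real.sq_sqrt (by positivity)]

/-- If `n ^ 3 ≤ 2 ^ l`, then collisions among the coins are negligible compared to the other
errors. -/
lemma collision_le {n l : ℕ} (h : n ^ 3 ≤ 2 ^ l) :
    (n : ℝ) ^ 2 / (2 * 2 ^ l) ≤ 1 / 2 * (√n / √((2 : ℝ) ^ l)) := by
  set a := √(n : ℝ) with ha
  set B := √((2 : ℝ) ^ l) with hB
  have ha0 : 0 ≤ a := Real.sqrt_nonneg _
  have hB0 : 0 < B := Real.sqrt_pos.2 (by positivity)
  have ha2 : a ^ 2 = n := Real.sq_sqrt (by positivity)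
  have hB2 : B ^ 2 = 2 ^ l := Real.sq_sqrt (by positivity)
  have h' : (a ^ 3) ^ 2 ≤ B ^ 2 := by
    rw [← pow_mul, mul_comm, pow_mul, ha2, hB2]
    exact_mod_cast h
  have h3 : a ^ 3 ≤ B := (sq_le_sq₀ (by positivity) hB0.le).1 h'
  rw [← ha2, ← hB2]
  have h4 : 1 / 2 * (a / B) - (a ^ 2) ^ 2 / (2 * B ^ 2) = a * (B - a ^ 3) / (2 * B ^ 2) := by
    field_simp
  have h5 : 0 ≤ a * (B - a ^ 3) / (2 * B ^ 2) :=
    div_nonneg (mul_nonneg ha0 (sub_nonneg.2 h3)) (by positivity)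
  linarith

open Classical in
/-- Collisions aside, two experiments that are close for injective coins are close. -/
lemma abs_sum_sub_le_of_injective {l n : ℕ} (f g : (Fin n → Bits l) → ℝ) {X : ℝ} (hX : 0 ≤ X)
    (hf : ∀ r, 0 ≤ f r ∧ f r ≤ X) (hg : ∀ r, 0 ≤ g r ∧ g r ≤ X) :
    |∑ r, f r - ∑ r, g r| ≤
      ∑ r ∈ Finset.univ.filter (fun r : Fin n → Bits l => Function.Injective r), |f r - g r| +
        n ^ 2 / (2 * 2 ^ l) * Fintype.card (Fin n → Bits l) * X := by
  rw [← Finset.sum_sub_distrib]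
  refine (Finset.abs_sum_le_sum_abs _ _).trans ?_
  rw [← Finset.sum_filter_add_sum_filter_not _ fun r : Fin n → Bits l => Function.Injective r]
  refine add_le_add le_rfl ?_
  calc _ ≤ ∑ r ∈ Finset.univ.filter (fun r : Fin n → Bits l => ¬Function.Injective r), X := by
        refine Finset.sum_le_sum fun r _ => ?_
        rw [abs_le]
        constructor <;> linarith [hf r, hg r]
    _ = (Finset.univ.filter fun r : Fin n → Bits l => ¬Function.Injective r).card * X := by
        rw [Finset.sum_const, nsmul_eq_mul]
    _ ≤ _ := by
        gcongr
        exact card_filter_not_injective_le l n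

section Experiments

variable {l n d₁ d₂ : ℕ} (A₁ : OracleAlg (l + 1) (Fin 1) (Fin d₁) (Fin n → Bits 1))
  (A₂ : (Fin n → Bits (l + 1)) → OracleAlg (l + 1) (Fin d₁) (Fin d₂) Unit)
  (D : (Fin n → Bits (l + 1)) → (Fin n → Bits 1) → (Fin n → Bits l) →
    OracleAlg (l + 1) (Fin d₂) (Fin 1) Bool)

lemma sum_endProb_nonneg_le (H₁ H₂ : (Fin n → Bits 1) → Fn (l + 1) × (Fin n → Bits (l + 1)) →
      Fn (l + 1))
    (c : (Fin n → Bits 1) → Fn (l + 1) × (Fin n → Bits (l + 1)) → Fin n → Bits (l + 1))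
    (r : Fin n → Bits l) :
    0 ≤ ∑ b, ∑ p : Fn (l + 1) × (Fin n → Bits (l + 1)),
        endProb A₂ D (H₁ b p) (H₂ b p) (c b p) b r (atLabel p.1 (firstState A₁ b)) ∧
      ∑ b, ∑ p : Fn (l + 1) × (Fin n → Bits (l + 1)),
        endProb A₂ D (H₁ b p) (H₂ b p) (c b p) b r (atLabel p.1 (firstState A₁ b)) ≤
      Fintype.card (Fn (l + 1)) * Fintype.card (Fin n → Bits (l + 1)) := by
  refine ⟨Finset.sum_nonneg fun b _ => Finset.sum_nonneg fun p _ => endProb_nonneg _ _ _ _ _ _ _ _,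
    ?_⟩
  rw [Finset.sum_comm]
  refine (Finset.sum_le_sum fun p _ => sum_endProb_le A₁ A₂ D p.1 (fun b => H₁ b p)
    (fun b => H₂ b p) (fun b => c b p) r).trans ?_
  simp

/-- The error of late reprogramming, as a multiple of `√(n / 2 ^ l)`. The first query of all
contributes at most `3 / 2` and not `2`, as the random function is then still independent of the
state of the adversary. -/
def hybridLoss (q₁ q : ℕ) : ℝ := if q₁ = 0 then 2 * q - 1 / 2 else 2 * (q - q₁)

/-- The distance, after the second stage, of the states for the random function and for its
reprogrammed version. -/
lemma wt_secondState_sub_le {q : ℕ} (hA : ∀ c, A₁.queries + (A₂ c).queries ≤ q)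
    (b : Fin n → Bits 1) (c : Fin n → Bits (l + 1)) :
    wt (pull orig - pull modif) (secondState A₁ A₂ b c) ≤
      (hybridLoss A₁.queries q * (√n / √((2 : ℝ) ^ l))) ^ 2 * Fintype.card (Fin n → Bits l) *
        wt LinearMap.id (firstState A₁ b) := by
  classical
  have hw := wt_nonneg LinearMap.id (firstState A₁ b)
  have hκ := card_filter_points_eq_le (l := l) (n := n) b
  have hκ0 : (0 : ℝ) ≤ n / 2 ^ l * Fintype.card (Fin n → Bits l) := by positivity
  rw [mul_pow, sq_sqrt_div]
  have h1 := (A₂ c).wt_sub_run_le (points b) c hκ0 hκ 0 (firstState A₁ b)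
  simp only [Finset.univ_unique, Finset.sum_singleton] at h1
  by_cases h0 : A₁.queries = 0
  · rw [hybridLoss, if_pos h0]
    have hAc := hA c
    rw [h0, zero_add] at hAc
    have hAc' : ((A₂ c).queries : ℝ) ≤ q := by exact_mod_cast hAc
    rcases Nat.eq_zero_or_pos (A₂ c).queries with hz | hpos
    · refine h1.trans ?_
      rw [hz]
      have : 0 ≤ (2 * (q : ℝ) - 1 / 2) ^ 2 * (n / 2 ^ l) * Fintype.card (Fin n → Bits l) *
        wt LinearMap.id (firstState A₁ b) := by positivity
      simpa using this
    · obtain ⟨e, he⟩ := firstState_eq_const A₁ h0 b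
      have h2 := (A₂ c).wt_sub_run_const_le (points b) c hκ0 hκ hpos 0 e
      simp only [Finset.univ_unique, Finset.sum_singleton] at h2
      rw [← he] at h2
      refine h2.trans ?_
      have hpos' : (1 : ℝ) ≤ (A₂ c).queries := by exact_mod_cast hpos
      rw [← mul_assoc]
      gcongr
      linarith
  · rw [hybridLoss, if_neg h0]
    refine h1.trans ?_
    have hAc' : (A₁.queries : ℝ) + (A₂ c).queries ≤ q := by exact_mod_cast hA c
    have h3 : ((A₂ c).queries : ℝ) ≤ q - A₁.queries := by linarith
    rw [mul_pow, ← mul_assoc]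
    have h4 : ((2 : ℝ) ^ 2) = 4 := by norm_num
    rw [h4]
    gcongr

lemma hybridLoss_nonneg {q₁ q : ℕ} (hq : 1 ≤ q) (h : q₁ ≤ q) : 0 ≤ hybridLoss q₁ q := by
  have hq' : (1 : ℝ) ≤ q := by exact_mod_cast hq
  have h' : (q₁ : ℝ) ≤ q := by exact_mod_cast h
  unfold hybridLoss
  split_ifs <;> linarith

/-- The three losses: reprogramming at the time of the commitments, late reprogramming, and
collisions of the coins. -/
lemma total_loss_le {q₁ q : ℕ} : √(2 * q₁) + hybridLoss q₁ q + 1 / 2 ≤ 2 * q := by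
  unfold hybridLoss
  split_ifs with h
  · simp [h]
  · have h1 : (1 : ℝ) ≤ q₁ := by exact_mod_cast Nat.one_le_iff_ne_zero.2 h
    have h2 : √(2 * (q₁ : ℝ)) ≤ 2 * q₁ - 1 / 2 := by
      rw [Real.sqrt_le_left (by linarith)]
      nlinarith
    linarith

/-- The real experiment is close to any experiment that, for injective coins, reprograms the
random function when the commitments are opened. -/
theorem abs_sum_realSum_sub_le (hn : n ^ 3 ≤ 2 ^ l) {q : ℕ} (hq : 1 ≤ q)
    (hA : ∀ c, A₁.queries + (A₂ c).queries ≤ q) (g : (Fin n → Bits l) → ℝ)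
    (hg : ∀ r, 0 ≤ g r ∧
      g r ≤ Fintype.card (Fn (l + 1)) * Fintype.card (Fin n → Bits (l + 1)))
    (hgo : ∀ r, Function.Injective r → g r = openSum A₁ A₂ D r) :
    |∑ r, realSum A₁ A₂ D r - ∑ r, g r| ≤
      2 * q * (√n / √((2 : ℝ) ^ l)) * (Fintype.card (Fn (l + 1)) *
        Fintype.card (Fin n → Bits (l + 1)) * Fintype.card (Fin n → Bits l)) := by
  classical
  set s : ℝ := √n / √((2 : ℝ) ^ l) with hs
  have hs0 : 0 ≤ s := by positivity
  have hs2 : s ^ 2 = n / 2 ^ l := sq_sqrt_div n l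
  set X : ℝ := (Fintype.card (Fn (l + 1)) : ℝ) * (Fintype.card (Fin n → Bits (l + 1)) : ℝ) with hX
  set N : ℝ := (Fintype.card (Fin n → Bits l) : ℝ) with hN
  have hX0 : 0 < X := by positivity
  have hN0 : 0 < N := by positivity
  set I := Finset.univ.filter (fun r : Fin n → Bits l => Function.Injective r) with hI
  have hinj : ∀ r ∈ I, Function.Injective r := fun r hr => (Finset.mem_filter.1 hr).2
  have h0 := abs_sum_sub_le_of_injective (realSum A₁ A₂ D) g hX0.le
    (fun r => sum_endProb_nonneg_le A₁ A₂ D (fun _ p => p.1) (fun _ p => p.1)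
      (fun b p i => p.1 (points b r i)) r) hg
  have h1 : ∑ r ∈ I, |realSum A₁ A₂ D r - g r| ≤
      ∑ r ∈ I, |realSum A₁ A₂ D r - commitSum A₁ A₂ D r| +
        ∑ r ∈ I, |commitSum A₁ A₂ D r - openSum A₁ A₂ D r| := by
    rw [← Finset.sum_add_distrib]
    refine Finset.sum_le_sum fun r hr => ?_
    rw [hgo r (hinj r hr)]
    exact abs_sub_le _ _ _
  -- reprogramming at the time of the commitments
  have h2 : (∑ r ∈ I, |realSum A₁ A₂ D r - commitSum A₁ A₂ D r|) / (X * N) ≤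
      √(2 * A₁.queries) * s := by
    refine le_of_forall_weight (by positivity) fun t ht => ?_
    rw [div_le_iff₀ (by positivity), mul_pow, Real.sq_sqrt (by positivity), hs2]
    calc _ ≤ ∑ r ∈ I, X * (t / 2 * ∑ b, touchWeight A₁ b r + 1 / t) :=
          Finset.sum_le_sum fun r hr =>
            abs_realSum_sub_commitSum_le A₁ A₂ D (hinj r hr) ht
      _ ≤ ∑ r, X * (t / 2 * ∑ b, touchWeight A₁ b r + 1 / t) := by
          refine Finset.sum_le_sum_of_subset_of_nonneg (Finset.subset_univ _) fun r _ _ => ?_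
          have : 0 ≤ ∑ b, touchWeight A₁ b r := Finset.sum_nonneg fun b _ =>
            List.sum_nonneg fun x hx => by
              obtain ⟨ψ, -, rfl⟩ := List.mem_map.1 hx
              exact Finset.sum_nonneg fun _ _ => Finset.sum_nonneg fun _ _ => by
                split_ifs <;> positivity
          positivity
      _ = X * (t / 2 * ∑ r, ∑ b, touchWeight A₁ b r + N * (1 / t)) := by
          rw [← Finset.mul_sum, Finset.sum_add_distrib, ← Finset.mul_sum, Finset.sum_const,
            nsmul_eq_mul, Finset.card_univ]
      _ ≤ X * (t / 2 * (n * A₁.queries / 2 ^ l * N) + N * (1 / t)) := by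
          gcongr
          exact sum_touchWeight_le A₁
      _ = _ := by field_simp; ring
  -- reprogramming at the time of the openings
  have h3 : (∑ r ∈ I, |commitSum A₁ A₂ D r - openSum A₁ A₂ D r|) / (X * N) ≤
      hybridLoss A₁.queries q * s := by
    have hq1 : A₁.queries ≤ q :=
      (Nat.le_add_right _ _).trans (hA fun _ => zeroWord _)
    refine le_of_forall_weight (mul_nonneg (hybridLoss_nonneg hq hq1) hs0) fun t ht => ?_
    rw [div_le_iff₀ (by positivity)]
    refine (Finset.sum_le_sum_of_subset_of_nonneg (Finset.subset_univ _)
      fun _ _ _ => abs_nonneg _).trans ?_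
    refine (sum_abs_commitSum_sub_openSum_le A₁ A₂ D (wt_secondState_sub_le A₁ A₂ hA)
      ht).trans (le_of_eq ?_)
    ring
  rw [div_le_iff₀ (by positivity)] at h2 h3
  have h4 := mul_le_mul_of_nonneg_right (collision_le hn) (mul_pos hX0 hN0).le
  have h5 := mul_le_mul_of_nonneg_right (total_loss_le (q₁ := A₁.queries) (q := q))
    (mul_nonneg hs0 (mul_pos hX0 hN0).le)
  rw [← hs] at h4
  linarith

end Experiments

/-! ### Hiding -/

section Hiding

variable {l n : ℕ} (A : (Fin n → Bits (l + 1)) → OracleAlg (l + 1) (Fin 1) (Fin 1) Bool)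

/-- The probability that the adversary outputs `1`, given commitments `c`. -/
def hidProb (H : Fn (l + 1)) (c : Fin n → Bits (l + 1)) : ℝ :=
  MixedState.trace ((A c).run (functionOracle H) 0 true trivialState)

lemma hidProb_eq_wt (g : Fn (l + 1)) (c : Fin n → Bits (l + 1)) :
    hidProb A g c = wt LinearMap.id ((A c).run (functionOracle g) 0 true trivialState) :=
  trace_eq_wt_id _

lemma hidProb_nonneg (H : Fn (l + 1)) (c : Fin n → Bits (l + 1)) : 0 ≤ hidProb A H c := by
  rw [hidProb_eq_wt]
  exact wt_nonneg _ _

lemma hidProb_le_one (H : Fn (l + 1)) (c : Fin n → Bits (l + 1)) : hidProb A H c ≤ 1 := by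
  have h := sum_wt_run_functionOracle (A c) H 0 trivialState
  rw [Fintype.sum_bool, ← hidProb_eq_wt] at h
  have h1 : wt LinearMap.id trivialState = 1 := by simp [wt, trivialState, sqn, onMem]
  have h2 := wt_nonneg LinearMap.id ((A c).run (functionOracle H) 0 false trivialState)
  linarith

/-- The blank initial state, as a function of the random function. -/
def constState (M : Type) : MixedState (Fin 1) M := trivialState.map (onMem (pull fun _ => ()))

lemma constState_map_pull {M M' : Type} (f : M' → M) :
    (constState M).map (onMem (pull f)) = constState M' := by
  rw [constState, List.map_map]; rfl

lemma wt_pt_constState {M : Type} (m : M) : wt (pt m) (constState M) = 1 := by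
  simp [wt, constState, trivialState, sqn, onMem]

lemma hidProb_eq_wt_pt {M : Type} (g : M → Fn (l + 1)) (c : Fin n → Bits (l + 1)) (m : M) :
    hidProb A (g m) c = wt (pt m) ((A c).run (ctrl g) 0 true (constState M)) := by
  rw [← trace_atLabel, ← atLabel_run, atLabel, constState_map_pull]
  rfl

/-- The experiment with random commitments and late reprogramming, which in the absence of
openings does not depend on the messages, is close to the real experiment. -/
theorem abs_sum_hidProb_sub_le (hn : n ^ 3 ≤ 2 ^ l) {q : ℕ} (hq : 1 ≤ q)
    (hA : ∀ c, (A c).queries ≤ q) (b : Fin n → Bits 1) :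
    |∑ r, ∑ p : Fn (l + 1) × (Fin n → Bits (l + 1)),
        hidProb A p.1 (fun i => p.1 (points b r i)) -
      ∑ _r : Fin n → Bits l, ∑ p : Fn (l + 1) × (Fin n → Bits (l + 1)), hidProb A p.1 p.2| ≤
      2 * q * (√n / √((2 : ℝ) ^ l)) * (Fintype.card (Fn (l + 1)) *
        Fintype.card (Fin n → Bits (l + 1)) * Fintype.card (Fin n → Bits l)) := by
  classical
  set s : ℝ := √n / √((2 : ℝ) ^ l) with hs
  have hs0 : 0 ≤ s := by positivity
  have hs2 : s ^ 2 = n / 2 ^ l := sq_sqrt_div n l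
  set X : ℝ := (Fintype.card (Fn (l + 1)) : ℝ) * (Fintype.card (Fin n → Bits (l + 1)) : ℝ) with hX
  set N : ℝ := (Fintype.card (Fin n → Bits l) : ℝ) with hN
  have hX0 : 0 < X := by positivity
  have hN0 : 0 < N := by positivity
  set I := Finset.univ.filter (fun r : Fin n → Bits l => Function.Injective r) with hI
  have hinj : ∀ r ∈ I, Function.Injective r := fun r hr => (Finset.mem_filter.1 hr).2
  have hq' : (1 : ℝ) ≤ q := by exact_mod_cast hq
  have hbd : ∀ c : Fn (l + 1) × (Fin n → Bits (l + 1)) → Fin n → Bits (l + 1),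
      0 ≤ ∑ p : Fn (l + 1) × (Fin n → Bits (l + 1)), hidProb A p.1 (c p) ∧
        ∑ p : Fn (l + 1) × (Fin n → Bits (l + 1)), hidProb A p.1 (c p) ≤ X := fun c =>
    ⟨Finset.sum_nonneg fun p _ => hidProb_nonneg A _ _,
      (Finset.sum_le_sum fun p _ => hidProb_le_one A _ _).trans (by simp [hX])⟩
  have h0 := abs_sum_sub_le_of_injective
    (fun r => ∑ p : Fn (l + 1) × (Fin n → Bits (l + 1)),
      hidProb A p.1 (fun i => p.1 (points b r i)))
    (fun _ => ∑ p : Fn (l + 1) × (Fin n → Bits (l + 1)), hidProb A p.1 p.2) hX0.le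
    (fun r => hbd _) (fun _ => hbd _)
  -- the distance of the runs with the random function and with its reprogrammed version
  have hdiff : ∀ c, ∑ o, wt (pull orig - pull modif) ((A c).run (ctrl (bothOracles (points b) c))
      0 o (constState (Fn (l + 1) × Option (Fin n → Bits l)))) ≤
        ((2 * q - 1 / 2) * s) ^ 2 * N * Fintype.card (Fn (l + 1)) := by
    intro c
    have hκ := card_filter_points_eq_le (l := l) (n := n) b
    have hκ0 : (0 : ℝ) ≤ n / 2 ^ l * Fintype.card (Fin n → Bits l) := by positivity
    have hwt : wt LinearMap.id (constState (Fn (l + 1))) = Fintype.card (Fn (l + 1)) := by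
      simp [wt_id, wt_pt_constState]
    have hAc : ((A c).queries : ℝ) ≤ q := by exact_mod_cast hA c
    rw [mul_pow, hs2]
    rcases Nat.eq_zero_or_pos (A c).queries with hz | hpos
    · have h1 := (A c).wt_sub_run_le (points b) c hκ0 hκ 0 (constState _)
      rw [constState_map_pull, hz, hwt] at h1
      refine h1.trans ?_
      have : 0 ≤ (2 * (q : ℝ) - 1 / 2) ^ 2 * (n / 2 ^ l) * N * Fintype.card (Fn (l + 1)) := by
        positivity
      simpa using this
    · have h2 := (A c).wt_sub_run_const_le (points b) c hκ0 hκ hpos 0 trivialState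
      have he : trivialState.map (onMem (pull fun _ : Fn (l + 1) => ())) = constState _ := rfl
      rw [he, constState_map_pull, hwt] at h2
      refine h2.trans ?_
      have hpos' : (1 : ℝ) ≤ (A c).queries := by exact_mod_cast hpos
      rw [← mul_assoc]
      gcongr
      linarith
  have h1 : ∀ t > 0, ∑ r ∈ I, |∑ p : Fn (l + 1) × (Fin n → Bits (l + 1)),
      hidProb A p.1 (fun i => p.1 (points b r i)) -
        ∑ p : Fn (l + 1) × (Fin n → Bits (l + 1)), hidProb A p.1 p.2| ≤
      ∑ c, ∑ p : Fn (l + 1) × (Fin n → Bits l), (t / 4 * ∑ o, wt (pt (orig p) - pt (modif p))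
        ((A c).run (ctrl (bothOracles (points b) c)) 0 o (constState _)) + 1 / t) := by
    intro t ht
    calc _ ≤ ∑ r ∈ I, ∑ p : Fn (l + 1) × (Fin n → Bits (l + 1)),
          |hidProb A (reprogram (points b r) p.2 p.1) p.2 - hidProb A p.1 p.2| := by
          refine Finset.sum_le_sum fun r hr => ?_
          have hx := points_injective b (hinj r hr)
          -- the honest commitments are the values of a reprogrammed function
          rw [← (exchange hx).sum_comp fun p => hidProb A p.1 (fun i => p.1 (points b r i)),
            ← Finset.sum_sub_distrib]
          simp only [exchange, Equiv.coe_fn_mk, reprogram_comp hx]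
          exact Finset.abs_sum_le_sum_abs _ _
      _ ≤ ∑ r, ∑ p : Fn (l + 1) × (Fin n → Bits (l + 1)),
          |hidProb A (reprogram (points b r) p.2 p.1) p.2 - hidProb A p.1 p.2| :=
          Finset.sum_le_sum_of_subset_of_nonneg (Finset.subset_univ _)
            fun _ _ _ => Finset.sum_nonneg fun _ _ => abs_nonneg _
      _ = ∑ c, ∑ p : Fn (l + 1) × (Fin n → Bits l),
          |hidProb A (reprogram (points b p.2) c p.1) c - hidProb A p.1 c| := by
          simp only [Fintype.sum_prod_type]
          exact (Finset.sum_congr rfl fun _ _ => Finset.sum_comm).trans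
            (Finset.sum_comm.trans (Finset.sum_congr rfl fun _ _ => Finset.sum_comm))
      _ ≤ _ := by
          refine Finset.sum_le_sum fun c _ => Finset.sum_le_sum fun p _ => ?_
          have h := abs_wt_outcome_sub_le (fun _ : Unit => orig p) (fun _ => modif p)
            (fun o => (A c).run (ctrl (bothOracles (points b) c)) 0 o (constState _)) ht
          have hm : ∀ m : Fn (l + 1) × Option (Fin n → Bits l), ∑ o, wt (pt m)
              ((A c).run (ctrl (bothOracles (points b) c)) 0 o (constState _)) = 1 := fun m => by
            rw [(A c).sum_wt_run (ctrl_intertwines_pull _ _), wt_pt_constState]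
          rw [hm, hm, sub_self, sub_zero, ← hidProb_eq_wt_pt, ← hidProb_eq_wt_pt, abs_mul,
            abs_two, abs_sub_comm] at h
          simp only [orig, modif, bothOracles] at h ⊢
          have h3 : 1 / t * (1 + 1) = 2 * (1 / t) := by ring
          rw [h3] at h
          linarith
  have h2 : (∑ r ∈ I, |∑ p : Fn (l + 1) × (Fin n → Bits (l + 1)),
      hidProb A p.1 (fun i => p.1 (points b r i)) -
        ∑ p : Fn (l + 1) × (Fin n → Bits (l + 1)), hidProb A p.1 p.2|) / (X * N) ≤
      (2 * q - 1 / 2) * s := by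
    refine le_of_forall_weight (mul_nonneg (by linarith) hs0) fun t ht => ?_
    rw [div_le_iff₀ (by positivity)]
    refine (h1 t ht).trans ?_
    calc _ = ∑ c : Fin n → Bits (l + 1), (t / 4 * ∑ o, wt (pull orig - pull modif)
          ((A c).run (ctrl (bothOracles (points b) c)) 0 o (constState _)) +
            (Fintype.card (Fn (l + 1)) * N) * (1 / t)) := by
          refine Finset.sum_congr rfl fun c _ => ?_
          rw [Finset.sum_add_distrib, ← Finset.mul_sum, Finset.sum_comm, Finset.sum_const,
            nsmul_eq_mul, Finset.card_univ, Fintype.card_prod, Nat.cast_mul]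
          congr 2
          exact Finset.sum_congr rfl fun o _ => (wt_pull_sub _ _ _).symm
      _ ≤ ∑ c : Fin n → Bits (l + 1),
          (t / 4 * (((2 * q - 1 / 2) * s) ^ 2 * N * Fintype.card (Fn (l + 1))) +
            (Fintype.card (Fn (l + 1)) * N) * (1 / t)) := by
          gcongr with c _
          exact hdiff c
      _ = _ := by
          rw [Finset.sum_const, nsmul_eq_mul, Finset.card_univ]
          ring
  rw [div_le_iff₀ (by positivity)] at h2
  have h4 := mul_le_mul_of_nonneg_right (collision_le hn) (mul_pos hX0 hN0).le
  rw [← hs] at h4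
  linarith [mul_nonneg hs0 (mul_pos hX0 hN0).le]

/-- Hiding: the experiments for two tuples of messages are close to the same experiment. -/
theorem abs_hidingProb_sub_le (hn : n ^ 3 ≤ 2 ^ l) {q : ℕ} (hq : 1 ≤ q)
    (Adv : HidingAdversary (hashCommitment l n)) (hA : ∀ c, (Adv c).queries ≤ q)
    (b b' : Fin n → Bits 1) :
    |hidingProb (hashCommitment l n) Adv b - hidingProb (hashCommitment l n) Adv b'| ≤
      2 * (2 * q * √n / (2 : ℝ) ^ ((l : ℝ) / 2)) := by
  have h1 : ∀ b : Fin n → Bits 1, hidingProb (hashCommitment l n) Adv b *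
      (Fintype.card (Fn (l + 1)) * Fintype.card (Fin n → Bits (l + 1)) *
        Fintype.card (Fin n → Bits l)) =
      ∑ r, ∑ p : Fn (l + 1) × (Fin n → Bits (l + 1)),
        hidProb Adv p.1 (fun i => p.1 (points b r i)) := by
    intro b
    have h : hidingProb (hashCommitment l n) Adv b =
        (∑ H : Fn (l + 1), (∑ r : Fin n → Bits l, hidProb Adv H (fun i => H (points b r i))) /
          Fintype.card (Fin n → Bits l)) / Fintype.card (Fn (l + 1)) := rfl
    have hT : (Fintype.card (Fn (l + 1)) : ℝ) ≠ 0 := by positivity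
    have hN : (Fintype.card (Fin n → Bits l) : ℝ) ≠ 0 := by positivity
    rw [h, ← Finset.sum_div, Finset.sum_comm]
    simp only [Fintype.sum_prod_type, Finset.sum_const, nsmul_eq_mul, ← Finset.mul_sum,
      Finset.card_univ]
    field_simp
  have h2 := abs_sum_hidProb_sub_le Adv hn hq hA b
  have h3 := abs_sum_hidProb_sub_le Adv hn hq hA b'
  rw [← h1] at h2 h3
  set Y : ℝ := (Fintype.card (Fn (l + 1)) : ℝ) * (Fintype.card (Fin n → Bits (l + 1)) : ℝ) *
        (Fintype.card (Fin n → Bits l) : ℝ) with hY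
  have hY0 : 0 < Y := by positivity
  rw [two_rpow_half, ← mul_div_assoc]
  have h4 := abs_sub_le (hidingProb (hashCommitment l n) Adv b * Y)
    (∑ _r : Fin n → Bits l, ∑ p : Fn (l + 1) × (Fin n → Bits (l + 1)), hidProb Adv p.1 p.2)
    (hidingProb (hashCommitment l n) Adv b' * Y)
  rw [← sub_mul, abs_mul, abs_of_pos hY0] at h4
  rw [abs_sub_comm] at h3
  refine le_of_mul_le_mul_right (h4.trans ((add_le_add h2 h3).trans (le_of_eq ?_))) hY0
  ring

end Hiding

/-! ### Classical circuits -/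

section Circuits

variable {w : ℕ} {L : Type}

/-- The cell that is changed by an operation. -/
def Instr.target : Instr w L → L
  | .const _ t | .xor _ t _ | .and _ _ t _ _ | .eq _ _ t _ _ | .lt _ _ t _ _ | .hadamard t => t

/-- The cells that an operation reads, apart from its target. -/
def Instr.reads : Instr w L → List L
  | .const _ _ | .hadamard _ => []
  | .xor a _ _ => [a]
  | .and a b _ _ _ | .eq a b _ _ _ | .lt a b _ _ _ => [a, b]

open Classical in
/-- The word that a classical operation adds to its target. -/
def Instr.value (g : Instr w L) (m : L → Bits w) : Bits w :=
  match g with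
  | .const c _ => c
  | .xor a _ _ => m a
  | .and a b _ _ _ => (m a).and (m b)
  | .eq a b _ _ _ => Bits.mask (m a = m b)
  | .lt a b _ _ _ => Bits.mask (toLex (m a) < toLex (m b))
  | .hadamard _ => zeroWord w

/-- Operations that permute the computational basis. -/
def Instr.IsClassical : Instr w L → Prop
  | .hadamard _ => False
  | _ => True

open Classical in
/-- The effect of a classical operation on a basis state. -/
def Instr.run (g : Instr w L) (m : L → Bits w) : L → Bits w :=
  Function.update m g.target ((m g.target).xor (g.value m))

/-- The effect of a classical circuit on a basis state. -/
def Circuit.exec (c : Circuit w L) (m : L → Bits w) : L → Bits w :=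
  c.foldl (fun m g => g.run m) m

/-- Circuits without Hadamard gates. -/
def Circuit.IsClassical (c : Circuit w L) : Prop := ∀ g ∈ c, g.IsClassical

lemma Instr.value_congr (g : Instr w L) {m m' : L → Bits w} (h : ∀ c ∈ g.reads, m c = m' c) :
    g.value m = g.value m' := by
  cases g
  case eq a b t ha hb =>
    simp only [Instr.value]
    rw [h a (by simp [Instr.reads]), h b (by simp [Instr.reads])]
  case lt a b t ha hb =>
    simp only [Instr.value]
    rw [h a (by simp [Instr.reads]), h b (by simp [Instr.reads])]
  all_goals simp_all [Instr.value, Instr.reads]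

lemma Instr.target_notMem_reads (g : Instr w L) : g.target ∉ g.reads := by
  cases g <;> simp [Instr.target, Instr.reads] <;> grind

lemma Instr.run_target (g : Instr w L) (m : L → Bits w) :
    g.run m g.target = (m g.target).xor (g.value m) := by
  classical exact Function.update_self _ _ _

lemma Instr.run_of_ne (g : Instr w L) (m : L → Bits w) {c : L} (h : c ≠ g.target) :
    g.run m c = m c := by
  classical exact Function.update_of_ne h _ _

lemma Instr.run_run (g : Instr w L) (m : L → Bits w) : g.run (g.run m) = m := by
  have h : g.value (g.run m) = g.value m := g.value_congr fun c hc =>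
    g.run_of_ne m fun h => g.target_notMem_reads (h ▸ hc)
  funext c
  by_cases hc : c = g.target
  · subst hc
    rw [run_target, run_target, h, Bits.xor_xor_cancel]
  · rw [run_of_ne _ _ hc, run_of_ne _ _ hc]

lemma Instr.apply_eq (g : Instr w L) (hg : g.IsClassical) (φ : (L → Bits w) → ℂ)
    (m : L → Bits w) : g.apply φ m = φ (g.run m) := by
  cases g
  case hadamard => exact hg.elim
  all_goals rfl

@[simp] lemma Circuit.exec_nil (m : L → Bits w) : Circuit.exec ([] : Circuit w L) m = m := rfl

lemma Circuit.exec_cons (g : Instr w L) (c : Circuit w L) (m : L → Bits w) :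
    Circuit.exec (g :: c) m = Circuit.exec c (g.run m) := rfl

lemma Circuit.exec_append (c c' : Circuit w L) (m : L → Bits w) :
    Circuit.exec (c ++ c') m = Circuit.exec c' (Circuit.exec c m) := by
  simp [Circuit.exec]

lemma Circuit.apply_append (c c' : Circuit w L) (φ : (L → Bits w) → ℂ) :
    Circuit.apply (c ++ c') φ = Circuit.apply c' (Circuit.apply c φ) := by
  simp [Circuit.apply]

lemma Circuit.exec_reverse_exec (c : Circuit w L) (m : L → Bits w) :
    Circuit.exec c.reverse (Circuit.exec c m) = m := by
  induction c generalizing m with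
  | nil => rfl
  | cons g c ih =>
    rw [List.reverse_cons, exec_append, exec_cons g c, ih]
    exact g.run_run m

/-! ### Superpositions of basis states -/

open Classical in
/-- The superposition of the basis states `v i` with amplitudes `a i`. -/
def ket {ι : Type} [Fintype ι] (a : ι → ℂ) (v : ι → L → Bits w) : (L → Bits w) → ℂ :=
  fun m => ∑ i, if m = v i then a i else 0

lemma ket_congr {ι : Type} [Fintype ι] {a : ι → ℂ} {v v' : ι → L → Bits w}
    (h : ∀ i, a i ≠ 0 → v i = v' i) : ket a v = ket a v' := by
  funext m
  refine Finset.sum_congr rfl fun i _ => ?_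
  by_cases hi : a i = 0
  · simp [hi]
  · rw [h i hi]

lemma Circuit.apply_ket {ι : Type} [Fintype ι] (a : ι → ℂ) (c : Circuit w L)
    (hc : Circuit.IsClassical c) (v : ι → L → Bits w) :
    Circuit.apply c (ket a v) = ket a fun i => Circuit.exec c (v i) := by
  induction c generalizing v with
  | nil => rfl
  | cons g c ih =>
    have h : g.apply (ket a v) = ket a fun i => g.run (v i) := by
      funext m
      rw [g.apply_eq (hc g List.mem_cons_self)]
      refine Finset.sum_congr rfl fun i _ => ?_
      have : g.run m = v i ↔ m = g.run (v i) :=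
        ⟨fun h => by rw [← h, g.run_run], fun h => by rw [h, g.run_run]⟩
      classical exact if_congr this rfl rfl
    have h2 : Circuit.apply (g :: c) (ket a v) = Circuit.apply c (g.apply (ket a v)) := rfl
    rw [h2, h, ih fun g' hg' => hc g' (List.mem_cons_of_mem _ hg')]
    rfl

open Classical in
/-- A Hadamard operation on a superposition of basis states: the superposition index is extended
by the new contents of the cell. -/
lemma Instr.hadamard_ket {ι : Type} [Fintype ι] (a : ι → ℂ) (t : L) (v : ι → L → Bits w) :
    (Instr.hadamard t).apply (ket a v) =
      ket (fun p : ι × Bits w => ((Real.sqrt 2 : ℂ) ^ w)⁻¹ * chi p.2 (v p.1 t) * a p.1)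
        fun p => Function.update (v p.1) t p.2 := by
  funext m
  have h1 : (Instr.hadamard t).apply (ket a v) m = ((Real.sqrt 2 : ℂ) ^ w)⁻¹ *
      ∑ u, chi (m t) u * ket a v (Function.update m t u) := rfl
  rw [h1]
  simp only [ket, Finset.mul_sum]
  rw [Finset.sum_comm, Fintype.sum_prod_type]
  refine Finset.sum_congr rfl fun i _ => ?_
  by_cases h : ∀ c, c ≠ t → m c = v i c
  · have e1 : ∀ u, Function.update m t u = v i ↔ u = v i t := by
      intro u
      constructor
      · intro hu; rw [← hu, Function.update_self]
      · rintro rfl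
        funext c
        by_cases hc : c = t
        · subst hc; rw [Function.update_self]
        · rw [Function.update_of_ne hc, h c hc]
    have e2 : ∀ u, m = Function.update (v i) t u ↔ u = m t := by
      intro u
      constructor
      · intro hu; rw [hu, Function.update_self]
      · rintro rfl
        funext c
        by_cases hc : c = t
        · subst hc; rw [Function.update_self]
        · rw [Function.update_of_ne hc, h c hc]
    simp only [e1, e2, mul_ite, mul_zero, Finset.sum_ite_eq', Finset.mem_univ, if_true]
    ring
  · push Not at h
    obtain ⟨c, hc, hne⟩ := h
    have e1 : ∀ u, Function.update m t u ≠ v i := fun u hu => hne (by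
      rw [← hu, Function.update_of_ne hc])
    have e2 : ∀ u, m ≠ Function.update (v i) t u := fun u hu => hne (by
      rw [hu, Function.update_of_ne hc])
    simp only [e1, e2, if_false, mul_zero, Finset.sum_const_zero]

/-! ### Straight-line programs -/

/-- An assignment: a cell and the operations that compute its new contents, all of which have
this cell as their target. -/
abbrev Assign (w : ℕ) (L : Type) : Type := L × List (Instr w L)

/-- The circuit of a list of assignments. -/
def assignCircuit (p : List (Assign w L)) : Circuit w L := p.flatMap fun b => b.2

/-- The sum of a list of words. -/
def xorSum (l : List (Bits w)) : Bits w := l.foldr Bits.xor (zeroWord w)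

@[simp] lemma xorSum_nil : xorSum ([] : List (Bits w)) = zeroWord w := rfl

@[simp] lemma xorSum_cons (a : Bits w) (l : List (Bits w)) :
    xorSum (a :: l) = a.xor (xorSum l) := rfl

/-- The assignments are made to distinct cells, by classical operations, and no cell is read
before it is assigned to. -/
structure WellFormed (p : List (Assign w L)) : Prop where
  target : ∀ b ∈ p, ∀ g ∈ b.2, g.target = b.1 ∧ g.IsClassical
  order : p.Pairwise fun b b' => b'.1 ≠ b.1 ∧ ∀ g ∈ b.2, b'.1 ∉ g.reads

lemma WellFormed.isClassical {p : List (Assign w L)} (hp : WellFormed p) :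
    Circuit.IsClassical (assignCircuit p) := by
  intro g hg
  obtain ⟨b, hb, hgb⟩ := List.mem_flatMap.1 hg
  exact (hp.target b hb g hgb).2

lemma Bits.xor_zero (a : Bits w) : a.xor (zeroWord w) = a := by
  funext i; simp [Bits.xor]

lemma Bits.xor_assoc (a b c : Bits w) : (a.xor b).xor c = a.xor (b.xor c) := by
  funext i; simp [Bits.xor]

lemma exec_assign (t : L) (gs : List (Instr w L)) (h : ∀ g ∈ gs, g.target = t)
    (m : L → Bits w) :
    Circuit.exec gs m t = (m t).xor (xorSum (gs.map fun g => g.value m)) ∧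
      ∀ c, c ≠ t → Circuit.exec gs m c = m c := by
  induction gs generalizing m with
  | nil => simp [Bits.xor_zero]
  | cons g gs ih =>
    have hg := h g List.mem_cons_self
    have hgs := fun g' hg' => h g' (List.mem_cons_of_mem _ hg')
    obtain ⟨h1, h2⟩ := ih hgs (g.run m)
    have hne : ∀ c, c ≠ t → g.run m c = m c := fun c hc => g.run_of_ne m (by rwa [hg])
    have hval : ∀ g' ∈ gs, g'.value (g.run m) = g'.value m := fun g' hg' =>
      g'.value_congr fun c hc => hne c fun hct =>
        g'.target_notMem_reads (by rw [hgs g' hg', ← hct]; exact hc)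
    refine ⟨?_, fun c hc => by rw [Circuit.exec_cons, h2 c hc, hne c hc]⟩
    rw [Circuit.exec_cons, h1, List.map_cons, xorSum_cons, ← Bits.xor_assoc]
    congr 1
    · rw [← hg]; exact g.run_target m
    · exact congrArg xorSum (List.map_congr_left hval)

lemma exec_of_notMem (p : List (Assign w L)) (hp : ∀ b ∈ p, ∀ g ∈ b.2, g.target = b.1)
    (m : L → Bits w) (c : L) (hc : ∀ b ∈ p, c ≠ b.1) :
    Circuit.exec (assignCircuit p) m c = m c := by
  induction p generalizing m with
  | nil => rfl
  | cons b p ih =>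
    have h : assignCircuit (b :: p) = b.2 ++ assignCircuit p := rfl
    rw [h, Circuit.exec_append, ih (fun b' hb' => hp b' (List.mem_cons_of_mem _ hb')) _
      fun b' hb' => hc b' (List.mem_cons_of_mem _ hb')]
    exact (exec_assign b.1 b.2 (hp b List.mem_cons_self) m).2 c (hc b List.mem_cons_self)

/-- The result of a straight-line program satisfies the equations given by its assignments. -/
lemma WellFormed.exec_eq {p : List (Assign w L)} (hp : WellFormed p) (m : L → Bits w) :
    ∀ b ∈ p, Circuit.exec (assignCircuit p) m b.1 =
      (m b.1).xor (xorSum (b.2.map fun g => g.value (Circuit.exec (assignCircuit p) m))) := by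
  obtain ⟨ht, ho⟩ := hp
  induction p generalizing m with
  | nil => simp
  | cons b p ih =>
    rw [List.pairwise_cons] at ho
    have htp := fun b' hb' => ht b' (List.mem_cons_of_mem b hb')
    have hb := exec_assign b.1 b.2 (fun g hg => (ht b List.mem_cons_self g hg).1) m
    have h : assignCircuit (b :: p) = b.2 ++ assignCircuit p := rfl
    have hkeep : ∀ c, (∀ b' ∈ p, c ≠ b'.1) → Circuit.exec (assignCircuit (b :: p)) m c =
        Circuit.exec b.2 m c := fun c hc => by
      rw [h, Circuit.exec_append]
      exact exec_of_notMem p (fun b' hb' g hg => (htp b' hb' g hg).1) _ c hc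
    intro b' hb'
    rw [List.mem_cons] at hb'
    rcases hb' with rfl | hb'
    · rw [hkeep b'.1 fun b₂ hb₂ => (ho.1 b₂ hb₂).1.symm, hb.1]
      congr 2
      refine List.map_congr_left fun g hg => g.value_congr fun c hc => ?_
      rw [hkeep c fun b₂ hb₂ hcb => (ho.1 b₂ hb₂).2 g hg (hcb ▸ hc), hb.2]
      rintro rfl
      exact g.target_notMem_reads (by rw [(ht b' List.mem_cons_self g hg).1]; exact hc)
    · have h2 := ih (Circuit.exec b.2 m) htp ho.2 b' hb'
      rw [← Circuit.exec_append, ← h] at h2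
      rw [h2, hb.2 _ (ho.1 b' hb').1]

/-- Circuits do not touch the cells in `T`. -/
def Avoids (c : Circuit w L) (T : L → Prop) : Prop :=
  ∀ g ∈ c, ¬T g.target ∧ ∀ a ∈ g.reads, ¬T a

open Classical in
lemma Avoids.exec_eq {c : Circuit w L} {T : L → Prop} (hc : Avoids c T) (m m' : L → Bits w)
    (h : ∀ a, ¬T a → m a = m' a) (a : L) :
    Circuit.exec c m a = if T a then m a else Circuit.exec c m' a := by
  induction c generalizing m m' with
  | nil => simp only [Circuit.exec_nil]; split_ifs with ha; exacts [rfl, h a ha]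
  | cons g c ih =>
    have hg := hc g List.mem_cons_self
    have hv : g.value m = g.value m' := g.value_congr fun a ha => h a (hg.2 a ha)
    have h2 : ∀ a, ¬T a → g.run m a = g.run m' a := by
      intro a ha
      by_cases hat : a = g.target
      · subst hat; rw [g.run_target, g.run_target, hv, h _ ha]
      · rw [g.run_of_ne _ hat, g.run_of_ne _ hat, h a ha]
    rw [Circuit.exec_cons, Circuit.exec_cons,
      ih (fun g' hg' => hc g' (List.mem_cons_of_mem _ hg')) _ _ h2]
    split_ifs with ha
    · exact g.run_of_ne m fun h => hg.1 (h ▸ ha)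
    · rfl

open Classical in
/-- Computing, copying and uncomputing. -/
lemma exec_conj {P Q : Circuit w L} {T : L → Prop} (hP : Avoids P T) (m : L → Bits w)
    (hQ : ∀ a, ¬T a → Circuit.exec Q (Circuit.exec P m) a = Circuit.exec P m a) (a : L) :
    Circuit.exec (P ++ Q ++ P.reverse) m a =
      if T a then Circuit.exec Q (Circuit.exec P m) a else m a := by
  have hP' : Avoids P.reverse T := fun g hg => hP g (List.mem_reverse.1 hg)
  rw [Circuit.exec_append, Circuit.exec_append, hP'.exec_eq _ _ hQ,
    Circuit.exec_reverse_exec]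

end Circuits

/-! ### Databases as sorted lists -/

section Database

variable {w : ℕ}

/-- All words, in descending order. -/
def allWords (w : ℕ) : List (Bits w) :=
  ((Finset.univ : Finset (Lex (Bits w))).sort (· ≥ ·)).map ofLex

lemma mem_allWords (x : Bits w) : x ∈ allWords w :=
  List.mem_map.2 ⟨toLex x, (Finset.mem_sort _).2 (Finset.mem_univ _), rfl⟩

lemma allWords_pairwise : (allWords w).Pairwise fun x y => toLex y < toLex x := by
  rw [allWords, List.pairwise_map]
  exact (Finset.sortedGT_sort _).pairwise

lemma not_lt_zeroWord (x : Bits w) : ¬toLex x < toLex (zeroWord w) := by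
  rintro ⟨i, -, hi⟩
  exact absurd hi (by simp)

/-- The nonzero entries of a database, in descending order. -/
def entries (F : Bits w → Bits w) : List (Bits w × Bits w) :=
  ((allWords w).filter fun x => decide (F x ≠ zeroWord w)).map fun x => (x, F x)

lemma entries_length (F : Bits w → Bits w) : (entries F).length = (fsupp F).card := by
  have hnd : (allWords w).Nodup := allWords_pairwise.imp fun h => by
    rintro rfl
    exact lt_irrefl _ h
  rw [entries, List.length_map, fsupp, ← List.toFinset_card_of_nodup (hnd.filter _)]
  congr 1
  ext x
  simp [mem_allWords]

lemma mem_entries {F : Bits w → Bits w} {p : Bits w × Bits w} :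
    p ∈ entries F ↔ F p.1 ≠ zeroWord w ∧ p.2 = F p.1 := by
  simp only [entries, List.mem_map, List.mem_filter, mem_allWords, true_and, decide_eq_true_eq]
  constructor
  · rintro ⟨x, hx, rfl⟩; exact ⟨hx, rfl⟩
  · rintro ⟨h1, h2⟩; exact ⟨p.1, h1, by rw [← h2]⟩

/-- The first components of the entries, in consecutive slots; empty slots hold `0`. -/
def slotX (F : Bits w → Bits w) (k : ℕ) : Bits w := ((entries F).map Prod.fst).getD k (zeroWord w)

/-- The second components of the entries, in consecutive slots; empty slots hold `0`. -/
def slotY (F : Bits w → Bits w) (k : ℕ) : Bits w := ((entries F).map Prod.snd).getD k (zeroWord w)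

lemma slotX_of_le {F : Bits w → Bits w} {k : ℕ} (h : (fsupp F).card ≤ k) :
    slotX F k = zeroWord w :=
  List.getD_eq_default _ _ (by rwa [List.length_map, entries_length])

lemma slotY_of_le {F : Bits w → Bits w} {k : ℕ} (h : (fsupp F).card ≤ k) :
    slotY F k = zeroWord w :=
  List.getD_eq_default _ _ (by rwa [List.length_map, entries_length])

/-- A database is determined by its slots. -/
lemma slots_injective {F G : Bits w → Bits w} (hX : slotX F = slotX G) (hY : slotY F = slotY G) :
    F = G := by
  have hsub : ∀ F G : Bits w → Bits w, slotX F = slotX G → slotY F = slotY G →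
      ∀ x, F x ≠ zeroWord w → F x = G x := by
    intro F G hX hY x hx
    have hmem : (x, F x) ∈ entries F := mem_entries.2 ⟨hx, rfl⟩
    obtain ⟨k, hk, hkx⟩ := List.getElem_of_mem hmem
    have h1 : slotX F k = x := by
      rw [slotX, List.getD_eq_getElem _ _ (by simpa using hk), List.getElem_map, hkx]
    have h2 : slotY F k = F x := by
      rw [slotY, List.getD_eq_getElem _ _ (by simpa using hk), List.getElem_map, hkx]
    rw [hX] at h1
    rw [hY] at h2
    have hk' : k < (entries G).length := by
      by_contra hlt
      rw [slotY, List.getD_eq_default _ _ (by rw [List.length_map]; omega)] at h2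
      exact hx h2.symm
    rw [slotX, List.getD_eq_getElem _ _ (by simpa using hk'), List.getElem_map] at h1
    rw [slotY, List.getD_eq_getElem _ _ (by simpa using hk'), List.getElem_map] at h2
    have h3 := (mem_entries.1 (List.getElem_mem hk')).2
    rw [h1, h2] at h3
    exact h3
  funext x
  by_cases hF : F x = zeroWord w
  · by_cases hG : G x = zeroWord w
    · rw [hF, hG]
    · exact (hsub G F hX.symm hY.symm x hG).symm
  · exact hsub F G hX hY x hF

/-- The list consisting of `o` if `p` holds, and empty otherwise. -/
def optList {α : Type*} (p : Prop) [Decidable p] (o : α) : List α := if p then [o] else []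

/-- The entries of a database and of its update at `x`: they only differ at the place of `x`. -/
lemma exists_entries_update (F : Bits w → Bits w) (x : Bits w) :
    ∃ A C : List (Bits w × Bits w), (∀ p ∈ A, toLex x < toLex p.1) ∧
      (∀ p ∈ C, toLex p.1 < toLex x) ∧
      ∀ v, entries (Function.update F x v) = A ++ optList (v ≠ zeroWord w) (x, v) ++ C := by
  obtain ⟨s, t, hst⟩ := List.append_of_mem (mem_allWords x)
  have hp := allWords_pairwise (w := w)
  rw [hst, List.pairwise_append, List.pairwise_cons] at hp
  obtain ⟨-, ⟨hxt, -⟩, hsx⟩ := hp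
  have hs : ∀ y ∈ s, toLex x < toLex y := fun y hy => hsx y hy x List.mem_cons_self
  refine ⟨(s.filter fun y => decide (F y ≠ zeroWord w)).map fun y => (y, F y),
    (t.filter fun y => decide (F y ≠ zeroWord w)).map fun y => (y, F y), ?_, ?_, ?_⟩
  · simp only [List.mem_map, List.mem_filter]
    rintro p ⟨y, ⟨hy, -⟩, rfl⟩
    exact hs y hy
  · simp only [List.mem_map, List.mem_filter]
    rintro p ⟨y, ⟨hy, -⟩, rfl⟩
    exact hxt y hy
  · intro v
    have hne : ∀ y, y ∈ s ∨ y ∈ t → Function.update F x v y = F y := by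
      rintro y hy
      refine Function.update_of_ne ?_ _ _
      rintro rfl
      rcases hy with hy | hy
      · exact lt_irrefl _ (hs y hy)
      · exact lt_irrefl _ (hxt y hy)
    have hseg : ∀ u : List (Bits w), (∀ y ∈ u, y ∈ s ∨ y ∈ t) →
        (u.filter fun y => decide (Function.update F x v y ≠ zeroWord w)).map
          (fun y => (y, Function.update F x v y)) =
        (u.filter fun y => decide (F y ≠ zeroWord w)).map fun y => (y, F y) := by
      intro u hu
      rw [List.filter_congr fun y hy => by rw [hne y (hu y hy)]]
      exact List.map_congr_left fun y hy => by rw [hne y (hu y (List.mem_of_mem_filter hy))]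
    rw [entries, hst, List.filter_append, List.filter_cons, List.map_append,
      hseg s fun _ => Or.inl, List.append_assoc]
    congr 1
    simp only [Function.update_self, optList]
    by_cases hv : v = zeroWord w
    · rw [if_neg (by simp [hv]), if_neg (by simp [hv]), List.nil_append]
      exact hseg t fun _ => Or.inr
    · rw [if_pos (by simp [hv]), if_pos hv, List.map_cons, Function.update_self,
        List.singleton_append]
      congr 1
      exact hseg t fun _ => Or.inr

/-! ### The shift of the slots in an update -/

/-- Removing the entry number `k₀ = |A|` if it is present. -/
lemma getD_remove {α : Type*} (A C : List α) (o d : α) (p : Prop) [Decidable p] (k : ℕ) :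
    (A ++ C).getD k d = if ¬k < A.length ∧ p then (A ++ optList p o ++ C).getD (k + 1) d
      else (A ++ optList p o ++ C).getD k d := by
  unfold optList
  by_cases hk : k < A.length
  · rw [if_neg (by simp [hk]), List.append_assoc, List.getD_append _ _ _ _ hk,
      List.getD_append _ _ _ _ hk]
  · by_cases hp : p
    · rw [if_pos ⟨hk, hp⟩, if_pos hp, List.getD_append_right _ _ _ _ (not_lt.1 hk),
        List.getD_append_right _ _ _ _ (by simp; omega)]
      congr 1
      simp
    · rw [if_neg (by simp [hp]), if_neg hp, List.append_nil]

/-- Inserting an entry as number `k₀ = |A|`. -/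
lemma getD_insert {α : Type*} (A C : List α) (o d : α) (p : Prop) [Decidable p] (k : ℕ) :
    (A ++ optList p o ++ C).getD k d =
      if ¬k < A.length ∧ p then (if k = A.length then o else (A ++ C).getD (k - 1) d)
      else (A ++ C).getD k d := by
  unfold optList
  by_cases hk : k < A.length
  · have hc : ¬(¬k < A.length ∧ p) := fun h => h.1 hk
    rw [if_neg hc, List.append_assoc, List.getD_append _ _ _ _ hk,
      List.getD_append _ _ _ _ hk]
  · by_cases hp : p
    · have hc : ¬k < A.length ∧ p := ⟨hk, hp⟩
      rw [if_pos hp, if_pos hc, List.append_assoc,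
        List.getD_append_right _ _ _ _ (not_lt.1 hk)]
      split_ifs with hk2
      · simp [hk2]
      · obtain ⟨i, hi⟩ : ∃ i, k = A.length + i + 1 := ⟨k - A.length - 1, by omega⟩
        have h1 : k - A.length = i + 1 := by omega
        have h2 : k - 1 = A.length + i := by omega
        rw [h1, h2, List.getD_append_right _ _ _ _ (Nat.le_add_right _ _)]
        simp
    · rw [if_neg hp, if_neg fun h => hp h.2, List.append_nil]

end Database

/-! ### The word formulas of a database update -/

section Update

variable {w : ℕ}

lemma Bits.mask_and (p : Prop) [Decidable p] (b : Bits w) :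
    (Bits.mask p).and b = if p then b else zeroWord w := by
  funext i
  by_cases hp : p <;> simp [Bits.mask, Bits.and, hp]

lemma Bits.and_mask (p : Prop) [Decidable p] (b : Bits w) :
    b.and (Bits.mask p) = if p then b else zeroWord w := by
  funext i
  by_cases hp : p <;> simp [Bits.mask, Bits.and, hp]

/-- The word all of whose bits are `1`. -/
abbrev onesWord (w : ℕ) : Bits w := fun _ => true

lemma Bits.ones_xor_mask (p : Prop) [Decidable p] :
    (onesWord w).xor (Bits.mask p) = Bits.mask (¬p) := by
  funext i
  by_cases hp : p <;> simp [Bits.mask, Bits.xor, hp]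

lemma Bits.mask_and_mask (p q : Prop) [Decidable p] [Decidable q] :
    (Bits.mask p : Bits w).and (Bits.mask q) = Bits.mask (p ∧ q) := by
  funext i
  simp [Bits.mask, Bits.and]

lemma Bits.zero_xor (a : Bits w) : (zeroWord w).xor a = a := by
  funext i; simp [Bits.xor]

lemma Bits.xor_self (a : Bits w) : a.xor a = zeroWord w := by
  funext i; simp [Bits.xor]

/-- The place of a word `x` among the entries of a database: the number of larger entries. -/
lemma exists_slots (F : Bits w → Bits w) (x : Bits w) :
    ∃ a : ℕ, ∃ D : ℕ → Bits w × Bits w,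
      (∀ k, toLex x < toLex (slotX F k) ↔ k < a) ∧
      (∀ k, (if x = slotX F k then slotY F k else zeroWord w) =
        if k = a then F x else zeroWord w) ∧
      (F x ≠ zeroWord w → a < (fsupp F).card) ∧
      (∀ k, (D k).1 = if ¬k < a ∧ F x ≠ zeroWord w then slotX F (k + 1) else slotX F k) ∧
      (∀ k, (D k).2 = if ¬k < a ∧ F x ≠ zeroWord w then slotY F (k + 1) else slotY F k) ∧
      ∀ v k, (slotX (Function.update F x v) k = if ¬k < a ∧ v ≠ zeroWord w then
          (if k = a then x else (D (k - 1)).1) else (D k).1) ∧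
        (slotY (Function.update F x v) k = if ¬k < a ∧ v ≠ zeroWord w then
          (if k = a then v else (D (k - 1)).2) else (D k).2) := by
  obtain ⟨A, C, hA, hC, hE⟩ := exists_entries_update F x
  have hF := hE (F x)
  rw [Function.update_eq_self] at hF
  set z : Bits w × Bits w := (zeroWord w, zeroWord w) with hz
  have hX : ∀ G k, slotX G k = ((entries G).getD k z).1 := fun G k =>
    List.getD_map (f := Prod.fst) (n := k) (d := z) (l := entries G)
  have hY : ∀ G k, slotY G k = ((entries G).getD k z).2 := fun G k =>
    List.getD_map (f := Prod.snd) (n := k) (d := z) (l := entries G)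
  have hlow : ∀ k, (C.getD k z ∈ C) ∨ C.getD k z = z := by
    intro k
    by_cases hk : k < C.length
    · left; rw [List.getD_eq_getElem _ _ hk]; exact List.getElem_mem hk
    · right; exact List.getD_eq_default _ _ (not_lt.1 hk)
  -- the slots before, at, and after the place of `x`
  have hlt : ∀ k, k < A.length → toLex x < toLex (slotX F k) := by
    intro k hk
    rw [hX, hF, List.append_assoc, List.getD_append _ _ _ _ hk, List.getD_eq_getElem _ _ hk]
    exact hA _ (List.getElem_mem hk)
  have hge : ∀ k, ¬k < A.length → (k = A.length ∧ slotX F k = x ∧ slotY F k = F x) ∨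
      ((k = A.length → F x = zeroWord w) ∧ (toLex (slotX F k) < toLex x ∨
        slotX F k = zeroWord w ∧ slotY F k = zeroWord w)) := by
    intro k hk
    rw [hX, hY, hF, List.append_assoc, List.getD_append_right _ _ _ _ (not_lt.1 hk)]
    by_cases hx : F x = zeroWord w
    · have h0 : optList (F x ≠ zeroWord w) (x, F x) = [] := if_neg (by simp [hx])
      rw [h0, List.nil_append]
      refine Or.inr ⟨fun _ => hx, ?_⟩
      rcases hlow (k - A.length) with h | h
      · exact Or.inl (hC _ h)
      · rw [h]; exact Or.inr ⟨rfl, rfl⟩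
    · have h0 : optList (F x ≠ zeroWord w) (x, F x) = [(x, F x)] := if_pos hx
      rw [h0]
      by_cases hk2 : k = A.length
      · left
        refine ⟨hk2, ?_⟩
        rw [hk2, Nat.sub_self]
        exact ⟨rfl, rfl⟩
      · right
        obtain ⟨i, hi⟩ : ∃ i, k - A.length = i + 1 := ⟨k - A.length - 1, by omega⟩
        rw [hi, List.singleton_append, List.getD_cons_succ]
        refine ⟨fun h => absurd h hk2, ?_⟩
        rcases hlow i with h | h
        · exact Or.inl (hC _ h)
        · rw [h]; exact Or.inr ⟨rfl, rfl⟩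
  refine ⟨A.length, fun k => (A ++ C).getD k z, ?_, ?_, ?_, ?_, ?_, ?_⟩
  · intro k
    refine ⟨fun h => ?_, hlt k⟩
    by_contra hk
    rcases hge k hk with ⟨-, h1, -⟩ | ⟨-, h1 | ⟨h1, -⟩⟩
    · rw [h1] at h; exact lt_irrefl _ h
    · exact lt_asymm h h1
    · rw [h1] at h; exact not_lt_zeroWord x h
  · intro k
    by_cases hk : k < A.length
    · have h := hlt k hk
      have hne : x ≠ slotX F k := fun he => by rw [← he] at h; exact lt_irrefl _ h
      rw [if_neg hne, if_neg (by omega)]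
    · rcases hge k hk with ⟨h0, h1, h2⟩ | ⟨h0, h1 | ⟨-, h1⟩⟩
      · rw [if_pos h1.symm, if_pos h0, h2]
      · have hne : x ≠ slotX F k := fun he => by rw [← he] at h1; exact lt_irrefl _ h1
        rw [if_neg hne]
        split_ifs with h3
        exacts [(h0 h3).symm, rfl]
      · rw [h1, ite_self]
        split_ifs with h3
        exacts [(h0 h3).symm, rfl]
  · intro hx
    rw [← entries_length, hF, optList, if_pos hx]
    simp only [List.length_append, List.length_singleton]
    omega
  · intro k
    show ((A ++ C).getD k z).1 = _
    rw [hX, hX, hF, getD_remove A C (x, F x) z (F x ≠ zeroWord w)]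
    split_ifs <;> rfl
  · intro k
    show ((A ++ C).getD k z).2 = _
    rw [hY, hY, hF, getD_remove A C (x, F x) z (F x ≠ zeroWord w)]
    split_ifs <;> rfl
  · intro v k
    rw [hX, hY, hE v, getD_insert]
    split_ifs <;> exact ⟨rfl, rfl⟩

/-- The selection formula for the new contents of a slot: `g` and `g'` tell whether this and the
previous slot come after the inserted entry. -/
lemma select_slot (a k : ℕ) (p : Prop) [Decidable p] (d d' o : Bits w) (g' : Bits w)
    (hg : g' = Bits.mask (a < k ∧ p)) :
    d.xor (((Bits.mask (¬k < a ∧ p)).and d).xor (((Bits.mask (¬k < a ∧ p)).and o).xor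
      ((g'.and o).xor ((g'.and d').xor (zeroWord w))))) =
      if ¬k < a ∧ p then (if k = a then o else d') else d := by
  rw [hg]
  simp only [Bits.mask_and]
  by_cases hp : p
  · rcases lt_trichotomy k a with h | h | h
    · have h1 : ¬a < k := by omega
      simp [h, h1, hp, Bits.xor_zero]
    · subst h
      simp [hp, Bits.xor_zero, ← Bits.xor_assoc, Bits.xor_self, Bits.zero_xor]
    · have h1 : ¬k < a := by omega
      have h2 : k ≠ a := by omega
      simp [h, h1, h2, hp, Bits.xor_zero, ← Bits.xor_assoc, Bits.xor_self, Bits.zero_xor]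
  · simp [hp, Bits.xor_zero]

/-! ### The circuit of a database update -/

/-- The work cell number `k` of the family `f`, as a cell of the query interface. -/
abbrev qc (f k : ℕ) : QueryCell := .own (.work (Nat.pair f k))

/-- The computation of auxiliary words for the update of a database with `K` slots.
The database is held by families 0 (arguments) and 1 (values). Computed are: the comparisons
with the query input (families 4 and 5), the old value (family 6, by partial sums), the new
value (family 7), whether these are nonzero (8 and 9), the slots after removal of the entry
(10, 11 and 12, shifted by one) and which of them come after the query input (13). Family 14
stays zero, and `nm` holds the mask by which the query is restricted. -/
def updatePrep (w K : ℕ) (nm : ℕ) : List (Assign w QueryCell) :=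
  (List.range K).map (fun k => (qc 4 k,
    [.const (onesWord w) (qc 4 k), .lt .input (qc 0 k) (qc 4 k) (by simp) (by simp)])) ++
  ((List.range K).map (fun k => (qc 5 k,
    [.eq .input (qc 0 k) (qc 5 k) (by simp) (by simp)])) ++
  ((List.range K).map (fun k => (qc 6 (k + 1),
    [.xor (qc 6 k) (qc 6 (k + 1)) (by simp),
      .and (qc 1 k) (qc 5 k) (qc 6 (k + 1)) (by simp) (by simp)])) ++
  ((qc 7 0, [.xor (qc 6 K) (qc 7 0) (by simp),
      .and .output (qc 17 nm) (qc 7 0) (by simp) (by simp)]) ::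
  (qc 8 0, [.const (onesWord w) (qc 8 0), .eq (qc 6 K) (qc 14 0) (qc 8 0) (by simp) (by simp)]) ::
  (qc 9 0, [.const (onesWord w) (qc 9 0), .eq (qc 7 0) (qc 14 0) (qc 9 0) (by simp) (by simp)]) ::
  ((List.range K).map (fun k => (qc 10 k,
    [.and (qc 4 k) (qc 8 0) (qc 10 k) (by simp) (by simp)])) ++
  ((List.range K).map (fun k => (qc 11 (k + 1),
    [.xor (qc 0 k) (qc 11 (k + 1)) (by simp),
      .and (qc 10 k) (qc 0 k) (qc 11 (k + 1)) (by simp) (by simp),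
      .and (qc 10 k) (qc 0 (k + 1)) (qc 11 (k + 1)) (by simp) (by simp)])) ++
  ((List.range K).map (fun k => (qc 12 (k + 1),
    [.xor (qc 1 k) (qc 12 (k + 1)) (by simp),
      .and (qc 10 k) (qc 1 k) (qc 12 (k + 1)) (by simp) (by simp),
      .and (qc 10 k) (qc 1 (k + 1)) (qc 12 (k + 1)) (by simp) (by simp)])) ++
  (List.range K).map (fun k => (qc 13 (k + 1),
    [.and (qc 4 k) (qc 9 0) (qc 13 (k + 1)) (by simp) (by simp)]))))))))

/-- The new contents of the slots are added to families 2 and 3. -/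
def updateCopy (w K : ℕ) : List (Assign w QueryCell) :=
  (List.range K).map (fun k => (qc 2 k,
    [.xor (qc 11 (k + 1)) (qc 2 k) (by simp),
      .and (qc 13 (k + 1)) (qc 11 (k + 1)) (qc 2 k) (by simp) (by simp),
      .and (qc 13 (k + 1)) .input (qc 2 k) (by simp) (by simp),
      .and (qc 13 k) .input (qc 2 k) (by simp) (by simp),
      .and (qc 13 k) (qc 11 k) (qc 2 k) (by simp) (by simp)])) ++
  (List.range K).map (fun k => (qc 3 k,
    [.xor (qc 12 (k + 1)) (qc 3 k) (by simp),
      .and (qc 13 (k + 1)) (qc 12 (k + 1)) (qc 3 k) (by simp) (by simp),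
      .and (qc 13 (k + 1)) (qc 7 0) (qc 3 k) (by simp) (by simp),
      .and (qc 13 k) (qc 7 0) (qc 3 k) (by simp) (by simp),
      .and (qc 13 k) (qc 12 k) (qc 3 k) (by simp) (by simp)]))

lemma wellFormed_updatePrep (K nm : ℕ) : WellFormed (updatePrep w K nm) := by
  constructor
  · intro b hb g hg
    simp only [updatePrep, List.mem_append, List.mem_map, List.mem_cons] at hb
    rcases hb with ⟨k, -, rfl⟩ | ⟨k, -, rfl⟩ | ⟨k, -, rfl⟩ | rfl | rfl | rfl | ⟨k, -, rfl⟩ |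
      ⟨k, -, rfl⟩ | ⟨k, -, rfl⟩ | ⟨k, -, rfl⟩ <;>
    · simp only [List.mem_cons, List.not_mem_nil, or_false] at hg
      rcases hg with rfl | rfl | rfl <;> exact ⟨rfl, trivial⟩
  · have hr : ∀ (R : ℕ → ℕ → Prop), (∀ i j, i < j → R i j) → (List.range K).Pairwise R :=
      fun R h => List.pairwise_lt_range.imp fun {i j} => h i j
    simp only [updatePrep, List.pairwise_append, List.pairwise_map, List.pairwise_cons,
      List.forall_mem_append, List.forall_mem_cons, List.forall_mem_map]
    refine ⟨hr _ ?_, ⟨hr _ ?_, ⟨hr _ ?_, ⟨?_, ?_, ?_, hr _ ?_, ⟨hr _ ?_, ⟨hr _ ?_, hr _ ?_, ?_⟩,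
      ?_⟩, ?_⟩, ?_⟩, ?_⟩, ?_⟩ <;>
    simp [Instr.reads] <;> omega

lemma wellFormed_updateCopy (K : ℕ) : WellFormed (updateCopy w K) := by
  constructor
  · intro b hb g hg
    simp only [updateCopy, List.mem_append, List.mem_map] at hb
    rcases hb with ⟨k, -, rfl⟩ | ⟨k, -, rfl⟩ <;>
    · simp only [List.mem_cons, List.not_mem_nil, or_false] at hg
      rcases hg with rfl | rfl | rfl | rfl | rfl <;> exact ⟨rfl, trivial⟩
  · have hr : ∀ (R : ℕ → ℕ → Prop), (∀ i j, i < j → R i j) → (List.range K).Pairwise R :=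
      fun R h => List.pairwise_lt_range.imp fun {i j} => h i j
    simp only [updateCopy, List.pairwise_append, List.pairwise_map, List.forall_mem_map]
    refine ⟨hr _ ?_, hr _ ?_, ?_⟩ <;> simp [Instr.reads] <;> omega

end Update

/-! ### Correctness of the database update -/

section UpdateCorrect

variable {w : ℕ}

lemma Bits.mask_congr {p q : Prop} [Decidable p] [Decidable q] (h : p ↔ q) :
    (Bits.mask p : Bits w) = Bits.mask q := by
  funext i
  simp [Bits.mask, h]

lemma QueryCell.cases_qc (c : QueryCell) : (∃ f k, c = qc f k) ∨ ∀ f k, c ≠ qc f k := by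
  rcases c with _ | _ | (i | i | i | i)
  case own.work =>
    exact Or.inl ⟨i.unpair.1, i.unpair.2, by simp⟩
  all_goals exact Or.inr fun f k => by simp

/-- A memory into which two sequences of words are added: `X` to family `f`, and `Y` to
family `f + 1`. -/
def addWords (f : ℕ) (X Y : ℕ → Bits w) (m : QueryCell → Bits w) : QueryCell → Bits w
  | .own (.work i) =>
    if i.unpair.1 = f then (m (.own (.work i))).xor (X i.unpair.2)
    else if i.unpair.1 = f + 1 then (m (.own (.work i))).xor (Y i.unpair.2)
    else m (.own (.work i))
  | c => m c

lemma addWords_qc (f : ℕ) (X Y : ℕ → Bits w) (m : QueryCell → Bits w) (g k : ℕ) :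
    addWords f X Y m (qc g k) = if g = f then (m (qc g k)).xor (X k)
      else if g = f + 1 then (m (qc g k)).xor (Y k) else m (qc g k) := by
  simp [addWords, qc]

lemma addWords_of_ne (f : ℕ) (X Y : ℕ → Bits w) (m : QueryCell → Bits w) {c : QueryCell}
    (h : ∀ k, c ≠ qc f k ∧ c ≠ qc (f + 1) k) : addWords f X Y m c = m c := by
  rcases c.cases_qc with ⟨g, k, rfl⟩ | hc
  · rw [addWords_qc, if_neg fun hg => (h k).1 (by rw [hg]), if_neg fun hg => (h k).2 (by rw [hg])]
  · rcases c with _ | _ | (i | i | i | i)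
    case own.work => exact absurd (by simp : _ = qc i.unpair.1 i.unpair.2) (hc _ _)
    all_goals rfl

/-- A memory into which a database is added: its arguments to family `f`, and its values to
family `f + 1`. -/
abbrev addDB (f : ℕ) (F : Bits w → Bits w) (m : QueryCell → Bits w) : QueryCell → Bits w :=
  addWords f (slotX F) (slotY F) m

lemma addDB_qc (f : ℕ) (F : Bits w → Bits w) (m : QueryCell → Bits w) (g k : ℕ) :
    addDB f F m (qc g k) = if g = f then (m (qc g k)).xor (slotX F k)
      else if g = f + 1 then (m (qc g k)).xor (slotY F k) else m (qc g k) :=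
  addWords_qc _ _ _ _ _ _

lemma addDB_of_ne (f : ℕ) (F : Bits w → Bits w) (m : QueryCell → Bits w) {c : QueryCell}
    (h : ∀ k, c ≠ qc f k ∧ c ≠ qc (f + 1) k) : addDB f F m c = m c :=
  addWords_of_ne _ _ _ _ h

/-- The auxiliary words that the update computes. -/
lemma exec_updatePrep {K nm : ℕ} (F : Bits w → Bits w) (m : QueryCell → Bits w)
    (h0 : ∀ k, m (qc 0 k) = slotX F k) (h1 : ∀ k, m (qc 1 k) = slotY F k)
    (hz : ∀ f k, 4 ≤ f → f ≤ 14 → m (qc f k) = zeroWord w) (hK : (fsupp F).card ≤ K)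
    (F' : Bits w → Bits w) (hF' : F' = Function.update F (m .input)
      ((F (m .input)).xor ((m .output).and (m (qc 17 nm))))) :
    let e := Circuit.exec (assignCircuit (updatePrep w K nm)) m
    (∀ k < K, (e (qc 11 (k + 1))).xor (((e (qc 13 (k + 1))).and (e (qc 11 (k + 1)))).xor
        (((e (qc 13 (k + 1))).and (e .input)).xor (((e (qc 13 k)).and (e .input)).xor
          (((e (qc 13 k)).and (e (qc 11 k))).xor (zeroWord w))))) = slotX F' k) ∧
    ∀ k < K, (e (qc 12 (k + 1))).xor (((e (qc 13 (k + 1))).and (e (qc 12 (k + 1)))).xor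
        (((e (qc 13 (k + 1))).and (e (qc 7 0))).xor (((e (qc 13 k)).and (e (qc 7 0))).xor
          (((e (qc 13 k)).and (e (qc 12 k))).xor (zeroWord w))))) = slotY F' k := by
  classical
  intro e
  have hwf := wellFormed_updatePrep (w := w) K nm
  have heq := hwf.exec_eq m
  change ∀ b ∈ updatePrep w K nm, e b.1 = (m b.1).xor (xorSum (b.2.map fun g => g.value e)) at heq
  have hkeep : ∀ c, (∀ b ∈ updatePrep w K nm, c ≠ b.1) → e c = m c := fun c =>
    exec_of_notMem _ (fun b hb g hg => (hwf.target b hb g hg).1) m c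
  simp only [updatePrep, List.forall_mem_append, List.forall_mem_cons, List.forall_mem_map,
    List.mem_range, List.map_cons, List.map_nil, Instr.value, xorSum_cons, xorSum_nil]
    at heq hkeep
  obtain ⟨e4, e5, e6, e7, e8, e9, e10, e11, e12, e13⟩ := heq
  have ein : e .input = m .input := hkeep _ (by simp)
  have eout : e .output = m .output := hkeep _ (by simp)
  have e17 : e (qc 17 nm) = m (qc 17 nm) := hkeep _ (by simp)
  have e0 : ∀ k, e (qc 0 k) = slotX F k := fun k => (hkeep _ (by simp)).trans (h0 k)
  have e1 : ∀ k, e (qc 1 k) = slotY F k := fun k => (hkeep _ (by simp)).trans (h1 k)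
  have e14 : e (qc 14 0) = zeroWord w :=
    (hkeep _ (by simp)).trans (hz 14 0 (by omega) le_rfl)
  have e60 : e (qc 6 0) = zeroWord w :=
    (hkeep _ (by simp)).trans (hz 6 0 (by omega) (by omega))
  have e130 : e (qc 13 0) = zeroWord w :=
    (hkeep _ (by simp)).trans (hz 13 0 (by omega) (by omega))
  set x := m .input with hx
  obtain ⟨a, D, hlt, hEq, hcard, hD1, hD2, hU⟩ := exists_slots F x
  set v := (F x).xor ((m .output).and (m (qc 17 nm))) with hv
  -- the entries before the place `a` of `x` are those with a larger point
  have f4 : ∀ k < K, e (qc 4 k) = Bits.mask (¬k < a) := by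
    intro k hk
    rw [e4 k hk, hz 4 k (by omega) (by omega), ein, e0, Bits.zero_xor, Bits.xor_zero,
      Bits.ones_xor_mask]
    exact Bits.mask_congr (not_congr (hlt k))
  -- the partial sums of the values stored at `x`, which end with `F x`
  have f6 : ∀ k ≤ K, e (qc 6 k) = if a < k then F x else zeroWord w := by
    intro k
    induction k with
    | zero => intro _; rw [e60, if_neg (Nat.not_lt_zero a)]
    | succ k ih =>
      intro hk
      rw [e6 k hk, hz 6 _ (by omega) (by omega), ih (by omega), e5 k hk, ein, e0, e1,
        hz 5 _ (by omega) (by omega), Bits.zero_xor, Bits.zero_xor, Bits.xor_zero,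
        Bits.xor_zero, Bits.and_mask]
      rw [show (if x = slotX F k then slotY F k else zeroWord w) =
        if k = a then F x else zeroWord w from by rw [← hEq k]]
      rcases lt_trichotomy a k with h | h | h
      · rw [if_pos h, if_neg (by omega), if_pos (by omega), Bits.xor_zero]
      · rw [if_neg (by omega), if_pos h.symm, if_pos (by omega), Bits.zero_xor]
      · rw [if_neg (by omega), if_neg (by omega), if_neg (by omega), Bits.zero_xor]
  have f6K : e (qc 6 K) = F x := by
    rw [f6 K le_rfl]
    split_ifs with h
    · rfl
    · by_contra h2
      exact h (lt_of_lt_of_le (hcard (Ne.symm h2)) hK)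
  have f7 : e (qc 7 0) = v := by
    rw [e7, hz 7 _ (by omega) (by omega), Bits.zero_xor, Bits.xor_zero, f6K, eout, e17]
  have f8 : e (qc 8 0) = Bits.mask (F x ≠ zeroWord w) := by
    rw [e8, hz 8 _ (by omega) (by omega), Bits.zero_xor, Bits.xor_zero, f6K, e14,
      Bits.ones_xor_mask]
  have f9 : e (qc 9 0) = Bits.mask (v ≠ zeroWord w) := by
    rw [e9, hz 9 _ (by omega) (by omega), Bits.zero_xor, Bits.xor_zero, f7, e14,
      Bits.ones_xor_mask]
  have f10 : ∀ k < K, e (qc 10 k) = Bits.mask (¬k < a ∧ F x ≠ zeroWord w) := by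
    intro k hk
    rw [e10 k hk, hz 10 _ (by omega) (by omega), Bits.zero_xor, Bits.xor_zero, f4 k hk, f8,
      Bits.mask_and_mask]
  -- the database with the entry at `x` removed: a slot from `a` on takes its successor's contents
  have hsel : ∀ (k : ℕ) (s s' : Bits w), s.xor
      (((Bits.mask (¬k < a ∧ F x ≠ zeroWord w)).and s).xor
        (((Bits.mask (¬k < a ∧ F x ≠ zeroWord w)).and s').xor (zeroWord w))) =
      if ¬k < a ∧ F x ≠ zeroWord w then s' else s := by
    intro k s s'
    rw [Bits.mask_and, Bits.mask_and]
    split_ifs with h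
    · rw [← Bits.xor_assoc, Bits.xor_self, Bits.zero_xor, Bits.xor_zero]
    · rw [Bits.xor_zero, Bits.xor_zero, Bits.xor_zero]
  have f11 : ∀ k < K, e (qc 11 (k + 1)) = (D k).1 := by
    intro k hk
    rw [e11 k hk, hz 11 _ (by omega) (by omega), Bits.zero_xor, f10 k hk, e0, e0, hsel, hD1]
  have f12 : ∀ k < K, e (qc 12 (k + 1)) = (D k).2 := by
    intro k hk
    rw [e12 k hk, hz 12 _ (by omega) (by omega), Bits.zero_xor, f10 k hk, e1, e1, hsel, hD2]
  -- the slots after `a` are those shifted by the insertion of the new entry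
  have f13 : ∀ k ≤ K, e (qc 13 k) = Bits.mask (a < k ∧ v ≠ zeroWord w) := by
    intro k hk
    cases k with
    | zero => rw [e130]; funext i; simp [Bits.mask]
    | succ k =>
      rw [e13 k hk, hz 13 _ (by omega) (by omega), Bits.zero_xor, Bits.xor_zero, f4 k hk, f9,
        Bits.mask_and_mask]
      exact Bits.mask_congr (by rw [Nat.lt_succ_iff, not_lt])
  have f13' : ∀ k < K, e (qc 13 (k + 1)) = Bits.mask (¬k < a ∧ v ≠ zeroWord w) := by
    intro k hk
    rw [f13 _ hk]
    exact Bits.mask_congr (by rw [Nat.lt_succ_iff, not_lt])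
  refine ⟨fun k hk => ?_, fun k hk => ?_⟩
  · rw [hF', (hU v k).1, f13' k hk, f11 k hk, ein,
      select_slot a k _ _ _ x _ (f13 k hk.le)]
    rcases k with _ | k
    · split_ifs <;> first | rfl | omega
    · rw [f11 k (by omega)]
      rfl
  · rw [hF', (hU v k).2, f13' k hk, f12 k hk, f7,
      select_slot a k _ _ _ v _ (f13 k hk.le)]
    rcases k with _ | k
    · split_ifs <;> first | rfl | omega
    · rw [f12 k (by omega)]
      rfl

/-- The database with one query added is computed into families 2 and 3; everything else is
uncomputed. -/
def updateCircuit (w K nm : ℕ) : Circuit w QueryCell :=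
  assignCircuit (updatePrep w K nm) ++ assignCircuit (updateCopy w K) ++
    (assignCircuit (updatePrep w K nm)).reverse

lemma avoids_updatePrep (K nm : ℕ) :
    Avoids (assignCircuit (updatePrep w K nm)) fun c => ∃ k, c = qc 2 k ∨ c = qc 3 k := by
  have h : ∀ b ∈ updatePrep w K nm, ∀ g ∈ b.2, (¬∃ k, g.target = qc 2 k ∨ g.target = qc 3 k) ∧
      ∀ a ∈ g.reads, ¬∃ k, a = qc 2 k ∨ a = qc 3 k := by
    simp only [updatePrep, List.forall_mem_append, List.forall_mem_cons, List.forall_mem_map]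
    simp [Instr.reads, Instr.target]
  intro g hg
  obtain ⟨b, hb, hg⟩ := List.mem_flatMap.1 hg
  exact h b hb g hg

/-- The circuit adds the new database to families 2 and 3. -/
lemma exec_updateCircuit {K nm : ℕ} (F : Bits w → Bits w) (m : QueryCell → Bits w)
    (h0 : ∀ k, m (qc 0 k) = slotX F k) (h1 : ∀ k, m (qc 1 k) = slotY F k)
    (hz : ∀ f k, 4 ≤ f → f ≤ 14 → m (qc f k) = zeroWord w) (hK : (fsupp F).card ≤ K)
    (F' : Bits w → Bits w) (hF' : F' = Function.update F (m .input)
      ((F (m .input)).xor ((m .output).and (m (qc 17 nm))))) (hK' : (fsupp F').card ≤ K) :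
    Circuit.exec (updateCircuit w K nm) m = addDB 2 F' m := by
  have hP := avoids_updatePrep (w := w) K nm
  have hwf := wellFormed_updateCopy (w := w) K
  have hwP := wellFormed_updatePrep (w := w) K nm
  obtain ⟨g2, g3⟩ := exec_updatePrep F m h0 h1 hz hK F' hF'
  set e := Circuit.exec (assignCircuit (updatePrep w K nm)) m with he
  have hPkeep : ∀ c, (∀ b ∈ updatePrep w K nm, c ≠ b.1) → e c = m c :=
    exec_of_notMem _ (fun b hb g hg => (hwP.target b hb g hg).1) m
  simp only [updatePrep, List.forall_mem_append, List.forall_mem_cons, List.forall_mem_map]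
    at hPkeep
  have heq := hwf.exec_eq e
  have hkeep : ∀ c, (∀ b ∈ updateCopy w K, c ≠ b.1) →
      Circuit.exec (assignCircuit (updateCopy w K)) e c = e c := fun c =>
    exec_of_notMem _ (fun b hb g hg => (hwf.target b hb g hg).1) e c
  obtain ⟨e', he'⟩ : ∃ e', e' = Circuit.exec (assignCircuit (updateCopy w K)) e := ⟨_, rfl⟩
  simp only [← he'] at heq hkeep
  simp only [updateCopy, List.forall_mem_append, List.forall_mem_map, List.mem_range,
    List.map_cons, List.map_nil, Instr.value, xorSum_cons, xorSum_nil] at heq hkeep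
  have hother : ∀ c, (∀ k, c ≠ qc 2 k ∧ c ≠ qc 3 k) → e' c = e c := fun c hc =>
    hkeep c ⟨fun k _ => (hc k).1, fun k _ => (hc k).2⟩
  have hread : ∀ f k, f ≠ 2 → f ≠ 3 → e' (qc f k) =
      e (qc f k) := fun f k h2 h3 => hother _ fun j => by simp [h2, h3]
  have hin : e' .input = e .input :=
    hother _ fun j => by simp
  funext c
  -- the preparation does not involve families 2 and 3, so that it can be undone after the copy
  rw [updateCircuit, exec_conj hP m fun a ha => ?_]
  swap
  · push Not at ha
    rw [← he, ← he']
    exact hother a ha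
  rw [← he, ← he']
  split_ifs with hc
  · obtain ⟨k, rfl | rfl⟩ := hc
    · rw [addDB_qc, if_pos rfl]
      by_cases hk : k < K
      · rw [heq.1 k hk]
        exact congrArg₂ _ (hPkeep _ (by simp)) (by
          rw [← g2 k hk]
          simp [hread, hin])
      · rw [hkeep _ ⟨fun j hj => by simp; omega, fun j hj => by simp⟩, hPkeep _ (by simp),
          slotX_of_le (by omega), Bits.xor_zero]
    · rw [addDB_qc, if_neg (by omega), if_pos rfl]
      by_cases hk : k < K
      · rw [heq.2 k hk]
        exact congrArg₂ _ (hPkeep _ (by simp)) (by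
          rw [← g3 k hk]
          simp [hread])
      · rw [hkeep _ ⟨fun j hj => by simp, fun j hj => by simp; omega⟩, hPkeep _ (by simp),
          slotY_of_le (by omega), Bits.xor_zero]
  · push Not at hc
    rcases c.cases_qc with ⟨f, k, rfl⟩ | h
    · have h2 : f ≠ 2 := fun h => (hc k).1 (by rw [h])
      have h3 : f ≠ 2 + 1 := fun h => (hc k).2 (by rw [h])
      rw [addDB_qc, if_neg h2, if_neg h3]
    · rw [addDB_of_ne _ _ _ fun k => ⟨h _ _, h _ _⟩]

end UpdateCorrect

/-! ### Updating the database in place -/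

section Toggle

variable {w : ℕ}

/-- Families `g` and `g + 1` are added to families `f` and `f + 1`, up to index `K`. -/
def addLayer (w K f g : ℕ) (h : f + 1 < g ∨ g + 1 < f) : List (Assign w QueryCell) :=
  (List.range K).map (fun k => (qc f k, [.xor (qc g k) (qc f k) (by simp; omega)])) ++
  (List.range K).map (fun k => (qc (f + 1) k,
    [.xor (qc (g + 1) k) (qc (f + 1) k) (by simp; omega)]))

lemma wellFormed_addLayer {K f g : ℕ} (h : f + 1 < g ∨ g + 1 < f) :
    WellFormed (addLayer w K f g h) := by
  constructor
  · intro b hb g' hg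
    simp only [addLayer, List.mem_append, List.mem_map] at hb
    rcases hb with ⟨k, -, rfl⟩ | ⟨k, -, rfl⟩ <;>
    · simp only [List.mem_cons, List.not_mem_nil, or_false] at hg
      subst hg
      exact ⟨rfl, trivial⟩
  · have hr : ∀ (R : ℕ → ℕ → Prop), (∀ i j, i < j → R i j) → (List.range K).Pairwise R :=
      fun R h => List.pairwise_lt_range.imp fun {i j} => h i j
    simp only [addLayer, List.pairwise_append, List.pairwise_map, List.forall_mem_map]
    refine ⟨hr _ ?_, hr _ ?_, ?_⟩ <;> simp [Instr.reads] <;> omega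

/-- The families `g` and `g + 1` need to vanish beyond `K` for the circuit to add all of them. -/
lemma exec_addLayer {K f g : ℕ} (h : f + 1 < g ∨ g + 1 < f) (m : QueryCell → Bits w)
    (X Y : ℕ → Bits w) (hX : ∀ k < K, m (qc g k) = X k) (hY : ∀ k < K, m (qc (g + 1) k) = Y k)
    (hXK : ∀ k, K ≤ k → X k = zeroWord w) (hYK : ∀ k, K ≤ k → Y k = zeroWord w) :
    Circuit.exec (assignCircuit (addLayer w K f g h)) m = addWords f X Y m := by
  have hwf := wellFormed_addLayer (w := w) (K := K) h
  have heq := hwf.exec_eq m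
  have hkeep := exec_of_notMem _ (fun b hb g hg => (hwf.target b hb g hg).1) m
  obtain ⟨e, he⟩ : ∃ e, e = Circuit.exec (assignCircuit (addLayer w K f g h)) m := ⟨_, rfl⟩
  simp only [← he] at heq hkeep
  rw [← he]
  simp only [addLayer, List.forall_mem_append, List.forall_mem_map, List.mem_range,
    List.map_cons, List.map_nil, Instr.value, xorSum_cons, xorSum_nil, Bits.xor_zero] at heq hkeep
  have hg : ∀ k, e (qc g k) = m (qc g k) ∧ e (qc (g + 1) k) = m (qc (g + 1) k) := fun k =>
    ⟨hkeep _ ⟨fun j _ => by simp; omega, fun j _ => by simp; omega⟩,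
      hkeep _ ⟨fun j _ => by simp; omega, fun j _ => by simp; omega⟩⟩
  funext c
  by_cases hc : ∀ k, c ≠ qc f k ∧ c ≠ qc (f + 1) k
  · rw [addWords_of_ne _ _ _ _ hc]
    exact hkeep _ ⟨fun j _ => (hc j).1, fun j _ => (hc j).2⟩
  · obtain ⟨k, hk⟩ := not_forall.1 hc
    rcases not_and_or.1 hk with hk | hk <;> obtain rfl := not_not.1 hk
    · rw [addWords_qc, if_pos rfl]
      by_cases hk : k < K
      · rw [heq.1 k hk, (hg k).1, hX k hk]
      · rw [hkeep _ ⟨fun j hj => by simp; omega, fun j hj => by simp⟩, hXK k (by omega),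
          Bits.xor_zero]
    · rw [addWords_qc, if_neg (by omega), if_pos rfl]
      by_cases hk : k < K
      · rw [heq.2 k hk, (hg k).2, hY k hk]
      · rw [hkeep _ ⟨fun j hj => by simp, fun j hj => by simp; omega⟩, hYK k (by omega),
          Bits.xor_zero]

lemma addWords_addWords (f : ℕ) (X Y X' Y' : ℕ → Bits w) (m : QueryCell → Bits w) :
    addWords f X Y (addWords f X' Y' m) =
      addWords f (fun k => (X' k).xor (X k)) (fun k => (Y' k).xor (Y k)) m := by
  funext c
  by_cases hc : ∀ k, c ≠ qc f k ∧ c ≠ qc (f + 1) k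
  · simp only [addWords_of_ne _ _ _ _ hc]
  · obtain ⟨k, hk⟩ := not_forall.1 hc
    rcases not_and_or.1 hk with hk | hk <;> obtain rfl := not_not.1 hk <;>
      simp [addWords_qc, Bits.xor_assoc]

lemma addWords_comm {f g : ℕ} (h : f + 1 < g) (X Y X' Y' : ℕ → Bits w)
    (m : QueryCell → Bits w) :
    addWords f X Y (addWords g X' Y' m) = addWords g X' Y' (addWords f X Y m) := by
  funext c
  by_cases hc : ∀ k, c ≠ qc f k ∧ c ≠ qc (f + 1) k
  · rw [addWords_of_ne _ _ _ _ hc]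
    rcases c.cases_qc with ⟨g', k, rfl⟩ | hc'
    · have : addWords f X Y m (qc g' k) = m (qc g' k) := addWords_of_ne _ _ _ _ hc
      simp only [addWords_qc g, this]
    · rw [addWords_of_ne _ _ _ _ fun k => ⟨hc' _ _, hc' _ _⟩,
        addWords_of_ne _ _ _ _ fun k => ⟨hc' _ _, hc' _ _⟩, addWords_of_ne _ _ _ _ hc]
  · obtain ⟨k, hk⟩ := not_forall.1 hc
    rcases not_and_or.1 hk with hk | hk <;> obtain rfl := not_not.1 hk <;>
      (have h1 : f ≠ g := by omega) <;> (have h2 : f ≠ g + 1 := by omega) <;>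
      (have h3 : f + 1 ≠ g := by omega) <;> simp [addWords_qc, h1, h2, h3]

lemma addDB_addDB (f : ℕ) (F : Bits w → Bits w) (m : QueryCell → Bits w) :
    addDB f F (addDB f F m) = m := by
  funext c
  by_cases hc : ∀ k, c ≠ qc f k ∧ c ≠ qc (f + 1) k
  · rw [addDB_of_ne _ _ _ hc, addDB_of_ne _ _ _ hc]
  · obtain ⟨k, hk⟩ := not_forall.1 hc
    rcases not_and_or.1 hk with hk | hk <;> obtain rfl := not_not.1 hk <;>
      simp [addDB_qc, Bits.xor_xor_cancel]

/-- The database in families 0 and 1 is replaced by its update: the new database is computed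
into families 2 and 3, the two are exchanged, and the old database is uncomputed, which is
possible since it is an update of the new one. -/
def toggle (w K nm : ℕ) : Circuit w QueryCell :=
  updateCircuit w K nm ++ (assignCircuit (addLayer w K 0 2 (by omega)) ++
    (assignCircuit (addLayer w K 2 0 (by omega)) ++
      (assignCircuit (addLayer w K 0 2 (by omega)) ++ updateCircuit w K nm)))

/-- The update is an involution, so that the second run of `updateCircuit`, on the new database,
erases the old one. -/
lemma exec_toggle {K nm : ℕ} (F : Bits w → Bits w) (m : QueryCell → Bits w)
    (hz : ∀ f k, f ≤ 14 → m (qc f k) = zeroWord w) (hK : (fsupp F).card ≤ K)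
    (F' : Bits w → Bits w) (hF' : F' = Function.update F (m .input)
      ((F (m .input)).xor ((m .output).and (m (qc 17 nm))))) (hK' : (fsupp F').card ≤ K) :
    Circuit.exec (toggle w K nm) (addDB 0 F m) = addDB 0 F' m := by
  have hb : F = Function.update F' (m .input)
      ((F' (m .input)).xor ((m .output).and (m (qc 17 nm)))) := by
    rw [hF', Function.update_self, Function.update_idem, Bits.xor_xor_cancel,
      Function.update_eq_self]
  have hup : ∀ (G G' : Bits w → Bits w), (fsupp G).card ≤ K → (fsupp G').card ≤ K →
      G' = Function.update G (m .input) ((G (m .input)).xor ((m .output).and (m (qc 17 nm)))) →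
      ∀ m', (∀ c, (∀ k, c ≠ qc 2 k ∧ c ≠ qc 3 k) → m' c = addDB 0 G m c) →
      Circuit.exec (updateCircuit w K nm) m' = addDB 2 G' m' := by
    intro G G' hG hG' hGG m' hm'
    have hi : m' .input = m .input := hm' _ fun k => by simp
    have ho : m' .output = m .output := hm' _ fun k => by simp
    have hn : m' (qc 17 nm) = m (qc 17 nm) := (hm' _ fun k => by simp).trans (by simp [addDB_qc])
    refine exec_updateCircuit G m' (fun k => ?_) (fun k => ?_) (fun f k h4 h14 => ?_) hG G'
      (by rw [hi, ho, hn]; exact hGG) hG'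
    · rw [hm' _ fun j => by simp, addDB_qc, if_pos rfl, hz _ _ (by omega), Bits.zero_xor]
    · rw [hm' _ fun j => by simp, addDB_qc, if_neg (by omega), if_pos rfl, hz _ _ (by omega),
        Bits.zero_xor]
    · rw [hm' _ fun j => by simp; omega, addDB_qc, if_neg (by omega), if_neg (by omega),
        hz _ _ h14]
  have hX : ∀ G : Bits w → Bits w, (fsupp G).card ≤ K → ∀ k, K ≤ k → slotX G k = zeroWord w :=
    fun G hG k hk => slotX_of_le (hG.trans hk)
  have hY : ∀ G : Bits w → Bits w, (fsupp G).card ≤ K → ∀ k, K ≤ k → slotY G k = zeroWord w :=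
    fun G hG k hk => slotY_of_le (hG.trans hk)
  have hcancel : ∀ (a b : ℕ → Bits w), (fun k => (a k).xor ((b k).xor (a k))) = b := by
    intro a b
    funext k i
    simp only [Bits.xor]
    cases a k i <;> simp
  have hc := fun (X Y X' Y' : ℕ → Bits w) (m : QueryCell → Bits w) =>
    addWords_comm (f := 0) (g := 2) (by omega) X Y X' Y' m
  have hcell := fun (f : ℕ) (X Y : ℕ → Bits w) (m : QueryCell → Bits w) (g k : ℕ) =>
    addWords_qc f X Y m g k
  -- three additions exchange the two databases
  have e1 := exec_addLayer (K := K) (f := 0) (g := 2) (by omega) (addDB 2 F' (addDB 0 F m))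
    (slotX F') (slotY F') (fun k _ => by simp [hcell, hz, Bits.zero_xor])
    (fun k _ => by simp [hcell, hz, Bits.zero_xor]) (hX F' hK') (hY F' hK')
  have e2 := exec_addLayer (K := K) (f := 2) (g := 0) (by omega)
    (addDB 0 F' (addDB 2 F' (addDB 0 F m))) (fun k => (slotX F k).xor (slotX F' k))
    (fun k => (slotY F k).xor (slotY F' k)) (fun k _ => by simp [hcell, hz, Bits.zero_xor])
    (fun k _ => by simp [hcell, hz, Bits.zero_xor])
    (fun k hk => by simp only [hX F hK k hk, hX F' hK' k hk, Bits.xor_zero])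
    (fun k hk => by simp only [hY F hK k hk, hY F' hK' k hk, Bits.xor_zero])
  have e2' : addWords 2 (fun k => (slotX F k).xor (slotX F' k))
      (fun k => (slotY F k).xor (slotY F' k)) (addDB 0 F' (addDB 2 F' (addDB 0 F m))) =
      addDB 2 F (addDB 0 F' (addDB 0 F m)) := by
    simp only [addDB, ← hc, addWords_addWords 2, hcancel]
  have e3 := exec_addLayer (K := K) (f := 0) (g := 2) (by omega)
    (addDB 2 F (addDB 0 F' (addDB 0 F m))) (slotX F) (slotY F)
    (fun k _ => by simp [hcell, hz, Bits.zero_xor])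
    (fun k _ => by simp [hcell, hz, Bits.zero_xor]) (hX F hK) (hY F hK)
  have e3' : addDB 0 F (addDB 2 F (addDB 0 F' (addDB 0 F m))) = addDB 2 F (addDB 0 F' m) := by
    simp only [addDB, hc]
    simp only [addWords_addWords 0, Bits.xor_assoc, hcancel]
  rw [toggle, Circuit.exec_append, Circuit.exec_append, Circuit.exec_append,
    Circuit.exec_append, hup F F' hK hK' hF' _ fun _ _ => rfl, e1]
  change Circuit.exec _ (Circuit.exec _ (Circuit.exec _ (addDB 0 F' _))) = _
  rw [e2, e2', e3]
  change Circuit.exec _ (addDB 0 F _) = _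
  rw [e3', hup F' F hK' hK hb _ fun c hc => addDB_of_ne _ _ _ hc, addDB_addDB]

lemma isClassical_toggle (K nm : ℕ) : Circuit.IsClassical (toggle w K nm) := by
  have h1 := (wellFormed_updatePrep (w := w) K nm).isClassical
  have h2 := (wellFormed_updateCopy (w := w) K).isClassical
  have h3 : ∀ f g h, Circuit.IsClassical (assignCircuit (addLayer w K f g h)) :=
    fun f g h => (wellFormed_addLayer h).isClassical
  intro g hg
  simp only [toggle, updateCircuit, List.mem_append, List.mem_reverse] at hg
  rcases hg with ((h | h) | h) | h | h | h | (h | h) | h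
  exacts [h1 g h, h2 g h, h1 g h, h3 _ _ _ g h, h3 _ _ _ g h, h3 _ _ _ g h, h1 g h, h2 g h,
    h1 g h]

end Toggle

/-! ### The random oracle interface -/

section Interface

variable {w : ℕ}

/-- The memory at a query. -/
def qmem (x y : Bits w) (s : SimMemory w) : QueryCell → Bits w
  | .input => x
  | .output => y
  | .own c => s c

/-- Whether the query input is one of the points of the commitments (families 15 and 16), which
are in family 18 once the flag in family 19 is set; and whether it is none of them (family 17,
by partial conjunctions). -/
def answerPrep (w n : ℕ) : List (Assign w QueryCell) :=
  (List.range n).map (fun i => (qc 15 i,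
    [.eq .input (qc 18 i) (qc 15 i) (by simp) (by simp)])) ++
  ((List.range n).map (fun i => (qc 16 i,
    [.and (qc 15 i) (qc 19 0) (qc 16 i) (by simp) (by simp)])) ++
  ((qc 17 0, [.const (onesWord w) (qc 17 0)]) ::
  (List.range n).map (fun i => (qc 17 (i + 1),
    [.xor (qc 17 i) (qc 17 (i + 1)) (by simp),
      .and (qc 17 i) (qc 16 i) (qc 17 (i + 1)) (by simp) (by simp)]))))

/-- The commitment of the point that was queried is added to the query output. -/
def answerAdd (w n : ℕ) : List (Assign w QueryCell) :=
  [(.output, (List.range n).map fun i =>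
    .and (.own (.com i)) (qc 16 i) .output (by simp) (by simp))]

/-- The answer to a query after `j` earlier ones. At the points of the commitments, the answer is
the commitment. Elsewhere, it is the answer of a random function whose Fourier transform is
stored as a database with at most `j` entries: the query adds the output word, in the Hadamard
basis, to the entry of the input word. -/
def answer (w n j : ℕ) : Circuit w QueryCell :=
  (assignCircuit (answerPrep w n) ++ assignCircuit (answerAdd w n)) ++
    ([.hadamard .output] ++ (toggle w (j + 1) n ++
      ([.hadamard .output] ++ (assignCircuit (answerPrep w n)).reverse)))

lemma wellFormed_answerPrep (n : ℕ) : WellFormed (answerPrep w n) := by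
  constructor
  · intro b hb g hg
    simp only [answerPrep, List.mem_append, List.mem_map, List.mem_cons] at hb
    rcases hb with ⟨k, -, rfl⟩ | ⟨k, -, rfl⟩ | rfl | ⟨k, -, rfl⟩ <;>
    · simp only [List.mem_cons, List.not_mem_nil, or_false] at hg
      rcases hg with rfl | rfl <;> exact ⟨rfl, trivial⟩
  · have hr : ∀ (R : ℕ → ℕ → Prop), (∀ i j, i < j → R i j) → (List.range n).Pairwise R :=
      fun R h => List.pairwise_lt_range.imp fun {i j} => h i j
    simp only [answerPrep, List.pairwise_append, List.pairwise_map, List.pairwise_cons,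
      List.forall_mem_append, List.forall_mem_cons, List.forall_mem_map]
    refine ⟨hr _ ?_, ⟨hr _ ?_, ⟨?_, hr _ ?_⟩, ?_⟩, ?_⟩ <;> simp [Instr.reads] <;> omega

lemma wellFormed_answerAdd (n : ℕ) : WellFormed (answerAdd w n) := by
  constructor
  · intro b hb g hg
    obtain rfl := List.mem_singleton.1 hb
    obtain ⟨i, -, rfl⟩ := List.mem_map.1 hg
    exact ⟨rfl, trivial⟩
  · exact List.pairwise_singleton _ _

lemma avoids_answerPrep (n : ℕ) : Avoids (assignCircuit (answerPrep w n))
    fun c => c = .output ∨ ∃ k, c = qc 0 k ∨ c = qc 1 k := by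
  have h : ∀ b ∈ answerPrep w n, ∀ g ∈ b.2,
      (¬(g.target = .output ∨ ∃ k, g.target = qc 0 k ∨ g.target = qc 1 k)) ∧
      ∀ a ∈ g.reads, ¬(a = .output ∨ ∃ k, a = qc 0 k ∨ a = qc 1 k) := by
    simp only [answerPrep, List.forall_mem_append, List.forall_mem_cons, List.forall_mem_map]
    simp [Instr.reads, Instr.target]
  intro g hg
  obtain ⟨b, hb, hg⟩ := List.mem_flatMap.1 hg
  exact h b hb g hg

/-- The mask that tells whether `x` is the point number `i` of an opened commitment. -/
def pointMask (s : SimMemory w) (x : Bits w) (i : ℕ) : Bits w :=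
  (Bits.mask (x = s (.work (Nat.pair 18 i)))).and (s (.work (Nat.pair 19 0)))

/-- The word that is added to the answer of the random function. -/
def addWord (n : ℕ) (s : SimMemory w) (x : Bits w) : Bits w :=
  xorSum ((List.range n).map fun i => (s (.com i)).and (pointMask s x i))

/-- The mask by which the answer of the random function is restricted. -/
def keepMask (s : SimMemory w) (x : Bits w) : ℕ → Bits w
  | 0 => onesWord w
  | i + 1 => (keepMask s x i).xor ((keepMask s x i).and (pointMask s x i))

/-- The work cells that are used temporarily are zero. -/
def Clean (s : SimMemory w) : Prop := ∀ f k, f ≤ 17 → s (.work (Nat.pair f k)) = zeroWord w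

/-- The memory after the preparation of an answer. -/
def prepared (n : ℕ) (s : SimMemory w) (x : Bits w) : SimMemory w := fun c =>
  Circuit.exec (assignCircuit (answerPrep w n)) (qmem x (zeroWord w) s) (.own c)

/-- The masks that the preparation computes; it leaves the commitments and the work cells of the
database update alone. -/
lemma prepared_spec (n : ℕ) {s : SimMemory w} (hs : Clean s) (x : Bits w) :
    (∀ f k, f ≤ 14 → prepared n s x (.work (Nat.pair f k)) = zeroWord w) ∧
    (∀ i, prepared n s x (.com i) = s (.com i)) ∧
    (∀ i < n, prepared n s x (.work (Nat.pair 16 i)) = pointMask s x i) ∧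
    prepared n s x (.work (Nat.pair 17 n)) = keepMask s x n ∧
    Circuit.exec (assignCircuit (answerPrep w n)) (qmem x (zeroWord w) s) .input = x := by
  have hwf := wellFormed_answerPrep (w := w) n
  have heq := hwf.exec_eq (qmem x (zeroWord w) s)
  have hkeep := exec_of_notMem _ (fun b hb g hg => (hwf.target b hb g hg).1)
    (qmem x (zeroWord w) s)
  simp only [prepared]
  obtain ⟨e, he⟩ : ∃ e, e = Circuit.exec (assignCircuit (answerPrep w n))
    (qmem x (zeroWord w) s) := ⟨_, rfl⟩
  simp only [← he] at heq hkeep ⊢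
  simp only [answerPrep, List.forall_mem_append, List.forall_mem_map, List.forall_mem_cons,
    List.mem_range, List.map_cons, List.map_nil, Instr.value, xorSum_cons, xorSum_nil,
    Bits.xor_zero] at heq hkeep
  obtain ⟨e15, e16, e170, e17⟩ := heq
  have hz : ∀ f k, f ≤ 17 → qmem x (zeroWord w) s (qc f k) = zeroWord w := hs
  have hin : e .input = x := hkeep _ (by simp)
  have h18 : ∀ i, e (qc 18 i) = s (.work (Nat.pair 18 i)) := fun i => hkeep _ (by simp)
  have h19 : e (qc 19 0) = s (.work (Nat.pair 19 0)) := hkeep _ (by simp)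
  have h16 : ∀ i < n, e (qc 16 i) = pointMask s x i := by
    intro i hi
    rw [e16 i hi, e15 i hi, hz _ _ (by omega), hz _ _ (by omega), Bits.zero_xor, Bits.zero_xor,
      hin, h18, h19]
    rfl
  refine ⟨fun f k hf => (hkeep _ ?_).trans (hs f k (by omega)), fun i => hkeep _ (by simp), h16,
    ?_, hin⟩
  · refine ⟨fun j _ => ?_, fun j _ => ?_, ?_, fun j _ => ?_⟩ <;> simp <;> omega
  · have h17 : ∀ k ≤ n, e (qc 17 k) = keepMask s x k := by
      intro k
      induction k with
      | zero => intro _; rw [e170, hz _ _ (by omega), Bits.zero_xor]; rfl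
      | succ k ih =>
        intro hk
        rw [e17 k hk, hz _ _ (by omega), Bits.zero_xor, ih (by omega), h16 k hk]
        rfl
    exact h17 n le_rfl

lemma addDB_qmem_output (F : Bits w → Bits w) (x y : Bits w) (s : SimMemory w) :
    addDB 0 F (qmem x y s) .output = y := rfl

open Classical in
lemma update_output (F : Bits w → Bits w) (x y u : Bits w) (s : SimMemory w) :
    Function.update (addDB 0 F (qmem x y s)) .output u = addDB 0 F (qmem x u s) := by
  funext c
  rcases c with _ | _ | (i | i | i | i)
  case output => rw [Function.update_self]; rfl
  all_goals rw [Function.update_of_ne (by simp)]; rfl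

/-- The preparation neither reads nor changes the output word and the database. -/
lemma exec_answerPrep (n : ℕ) {s : SimMemory w} (hs : Clean s) (x y : Bits w)
    (F : Bits w → Bits w) :
    Circuit.exec (assignCircuit (answerPrep w n)) (addDB 0 F (qmem x y s)) =
      addDB 0 F (qmem x y (prepared n s x)) := by
  have hT : ∀ a, ¬(a = QueryCell.output ∨ ∃ k, a = qc 0 k ∨ a = qc 1 k) →
      addDB 0 F (qmem x y s) a = qmem x (zeroWord w) s a := by
    intro a ha
    push Not at ha
    rw [addDB_of_ne _ _ _ ha.2]
    rcases a with _ | _ | a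
    · rfl
    · exact absurd rfl ha.1
    · rfl
  funext a
  rw [(avoids_answerPrep n).exec_eq _ _ hT]
  by_cases ha : a = .output ∨ ∃ k, a = qc 0 k ∨ a = qc 1 k
  · rw [if_pos ha]
    have hp := (prepared_spec n hs x).1
    rcases ha with rfl | ⟨k, rfl | rfl⟩
    · rfl
    · rw [addDB_qc, addDB_qc]
      exact congrArg (fun z => Bits.xor z _) ((hs 0 k (by omega)).trans (hp 0 k (by omega)).symm)
    · rw [addDB_qc, addDB_qc]
      exact congrArg (fun z => Bits.xor z _) ((hs 1 k (by omega)).trans (hp 1 k (by omega)).symm)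
  · rw [if_neg ha]
    push Not at ha
    rw [addDB_of_ne _ _ _ ha.2]
    rcases a with _ | _ | a
    · exact (prepared_spec n hs x).2.2.2.2
    · exact absurd rfl ha.1
    · rfl

/-- The commitments to the points equal to the query are added to the output word. -/
lemma exec_answerAdd (n : ℕ) {s : SimMemory w} (hs : Clean s) (x y : Bits w)
    (F : Bits w → Bits w) :
    Circuit.exec (assignCircuit (answerAdd w n)) (addDB 0 F (qmem x y (prepared n s x))) =
      addDB 0 F (qmem x (y.xor (addWord n s x)) (prepared n s x)) := by
  classical
  have hwf := wellFormed_answerAdd (w := w) n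
  have heq := hwf.exec_eq (addDB 0 F (qmem x y (prepared n s x)))
  have hkeep := exec_of_notMem _ (fun b hb g hg => (hwf.target b hb g hg).1)
    (addDB 0 F (qmem x y (prepared n s x)))
  obtain ⟨e, he⟩ : ∃ e, e = Circuit.exec (assignCircuit (answerAdd w n))
    (addDB 0 F (qmem x y (prepared n s x))) := ⟨_, rfl⟩
  simp only [← he] at heq hkeep ⊢
  simp only [answerAdd, List.mem_singleton, forall_eq, List.map_map] at heq hkeep
  rw [← update_output F x y]
  funext a
  by_cases ha : a = .output
  · subst ha
    rw [Function.update_self, heq, addDB_qmem_output]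
    congr 2
    refine List.map_congr_left fun i hi => ?_
    have hi' : i < n := List.mem_range.1 hi
    obtain ⟨-, h1, h2, -⟩ := prepared_spec n hs x
    have e1 : e (.own (.com i)) = s (.com i) := (hkeep _ (by simp)).trans (h1 i)
    have e2 : e (qc 16 i) = pointMask s x i :=
      (hkeep _ (by simp)).trans ((addDB_qc _ _ _ _ _).trans (h2 i hi'))
    rw [← e1, ← e2]
    rfl
  · rw [Function.update_of_ne ha]
    exact hkeep a ha

end Interface

/-! ### The simulated random function -/

section Push

variable {w n : ℕ} {ι : Type} [Fintype ι]

/-- The memory `s` with a database in families 0 and 1. -/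
def dbMem (F : Fn w) (s : SimMemory w) : SimMemory w := fun c =>
  addDB 0 F (qmem (zeroWord w) (zeroWord w) s) (.own c)

lemma qmem_dbMem (x y : Bits w) (F : Fn w) (s : SimMemory w) :
    qmem x y (dbMem F s) = addDB 0 F (qmem x y s) := by
  funext c
  rcases c with _ | _ | (i | i | i | i) <;> rfl

/-- The simulator's representation of a function of the random function: the superposition of
the Fourier coefficients, stored as databases, in each of the memories `s i`. -/
def push (s : ι → SimMemory w) : (Fn w → ℂ) →ₗ[ℂ] (SimMemory w → ℂ) where
  toFun f := ket (fun p : Fn w × ι => hat f p.1) fun p => dbMem p.1 (s p.2)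
  map_add' f g := by
    funext m
    simp only [ket, Pi.add_apply, map_add, ← Finset.sum_add_distrib]
    refine Finset.sum_congr rfl fun p _ => ?_
    split_ifs <;> simp
  map_smul' a f := by
    funext m
    simp only [ket, map_smul, Pi.smul_apply, smul_eq_mul, RingHom.id_apply, Finset.mul_sum]
    refine Finset.sum_congr rfl fun p _ => ?_
    split_ifs <;> simp

lemma push_apply (s : ι → SimMemory w) (f : Fn w → ℂ) :
    push s f = ket (fun p : Fn w × ι => hat f p.1) fun p => dbMem p.1 (s p.2) := rfl

lemma eq_qmem_iff (c : QueryCell → Bits w) (x y : Bits w) (s : SimMemory w) :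
    c = qmem x y s ↔ c .input = x ∧ c .output = y ∧ (fun a => c (.own a)) = s := by
  constructor
  · rintro rfl
    exact ⟨rfl, rfl, rfl⟩
  · rintro ⟨rfl, rfl, rfl⟩
    funext a
    rcases a with _ | _ | a <;> rfl

lemma ket_qmem (f : Bits w → Bits w → ι → ℂ) (v : ι → SimMemory w) (c : QueryCell → Bits w) :
    ket (fun p : Bits w × Bits w × ι => f p.1 p.2.1 p.2.2)
      (fun p => qmem p.1 p.2.1 (v p.2.2)) c =
    ket (f (c .input) (c .output)) v fun a => c (.own a) := by
  simp only [ket, Fintype.sum_prod_type]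
  rw [Finset.sum_eq_single (c .input) (fun x _ hx => Finset.sum_eq_zero fun y _ =>
      Finset.sum_eq_zero fun i _ => if_neg fun h => hx ((eq_qmem_iff _ _ _ _).1 h).1.symm) (by simp),
    Finset.sum_eq_single (c .output) (fun y _ hy => Finset.sum_eq_zero fun i _ =>
      if_neg fun h => hy ((eq_qmem_iff _ _ _ _).1 h).2.1.symm) (by simp)]
  classical
  exact Finset.sum_congr rfl fun i _ => if_congr (by rw [eq_qmem_iff]; simp) rfl rfl

/-- A query moves the old and new contents of the output register, and the Fourier transform of
the query, to new places. -/
def queryEquiv (ι : Type) (N : Bits w → Bits w) :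
    ((Bits w × Bits w × Fn w × ι) × Bits w) × Bits w ≃
      ((Bits w × Bits w × Fn w × ι) × Bits w) × Bits w :=
  Function.Involutive.toPerm
    (fun p => (((p.1.1.1, p.2, Function.update p.1.1.2.2.1 p.1.1.1
      ((p.1.1.2.2.1 p.1.1.1).xor (p.1.2.and (N p.1.1.1))), p.1.1.2.2.2), p.1.2), p.1.1.2.1))
    fun p => by
      obtain ⟨⟨⟨x, y, F, i⟩, u⟩, v⟩ := p
      simp [Bits.xor_xor_cancel]

lemma inv_sqrt_two_pow (w : ℕ) :
    ((Real.sqrt 2 : ℂ) ^ w)⁻¹ * ((Real.sqrt 2 : ℂ) ^ w)⁻¹ = ((2 : ℂ) ^ w)⁻¹ := by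
  rw [← mul_inv, ← mul_pow]
  congr 2
  exact_mod_cast Real.mul_self_sqrt (by norm_num : (0 : ℝ) ≤ 2)

lemma Circuit.apply_singleton {L : Type} (g : Instr w L) (φ : (L → Bits w) → ℂ) :
    Circuit.apply [g] φ = g.apply φ := rfl

/-- The interface answers queries to the random function `x ↦ a x ⊕ (N x ∧ H x)`. -/
lemma push_intertwines {Sim : EquivSimulator w} (hro : ∀ j, Sim.ro j = answer w n j)
    {s : ι → SimMemory w} (hs : ∀ i, Clean (s i)) {a N : Bits w → Bits w}
    (ha : ∀ i x, addWord n (s i) x = a x) (hN : ∀ i x, keepMask (s i) x n = N x) :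
    Intertwines (push s) (sparse w) (ctrl fun H x => (a x).xor ((N x).and (H x))) Sim.world := by
  classical
  intro j d ψ hψ
  refine ⟨?_, ctrl_mem_sparse a N ψ hψ⟩
  funext r m
  obtain ⟨x₀, y₀, z⟩ := r
  set ψ' := ctrl (fun H x => (a x).xor ((N x).and (H x))) j d ψ with hψ'
  -- both sides, as superpositions of the memory at the query
  have hL : Sim.world j d (onMem (push s) ψ) (x₀, y₀, z) m =
      Circuit.apply (answer w n j) (ket (fun p : Bits w × Bits w × Fn w × ι =>
        hat (ψ (p.1, p.2.1, z)) p.2.2.1) fun p => addDB 0 p.2.2.1 (qmem p.1 p.2.1 (s p.2.2.2)))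
        (qmem x₀ y₀ m) := by
    rw [EquivSimulator.world, hro]
    have h1 : (fun | .input => x₀ | .output => y₀ | .own s => m s : QueryCell → Bits w) =
        qmem x₀ y₀ m := by
      funext c
      rcases c with _ | _ | c <;> rfl
    rw [← h1]
    congr 1
    funext c
    have h2 := ket_qmem (fun x y (p : Fn w × ι) => hat (ψ (x, y, z)) p.1)
      (fun p => dbMem p.1 (s p.2)) c
    simp only [qmem_dbMem] at h2
    exact h2.symm
  have hR : onMem (push s) ψ' (x₀, y₀, z) m = ket (fun p : Bits w × Bits w × Fn w × ι =>
      hat (ψ' (p.1, p.2.1, z)) p.2.2.1) (fun p => addDB 0 p.2.2.1 (qmem p.1 p.2.1 (s p.2.2.2)))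
      (qmem x₀ y₀ m) := by
    have h2 := ket_qmem (fun x y (p : Fn w × ι) => hat (ψ' (x, y, z)) p.1)
      (fun p => dbMem p.1 (s p.2)) (qmem x₀ y₀ m)
    simp only [qmem_dbMem] at h2
    exact h2.symm
  rw [hL, hR]
  have hcl : Circuit.IsClassical (assignCircuit (answerPrep w n) ++
      assignCircuit (answerAdd w n)) := fun g hg =>
    (List.mem_append.1 hg).elim ((wellFormed_answerPrep n).isClassical g)
      ((wellFormed_answerAdd n).isClassical g)
  have hrev : Circuit.IsClassical (assignCircuit (answerPrep w n)).reverse := fun g hg =>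
    (wellFormed_answerPrep n).isClassical g (List.mem_reverse.1 hg)
  rw [answer, Circuit.apply_append, Circuit.apply_append, Circuit.apply_append,
    Circuit.apply_append, Circuit.apply_ket _ _ hcl, Circuit.apply_singleton,
    Circuit.apply_singleton, Instr.hadamard_ket]
  simp only [Circuit.exec_append, exec_answerPrep n (hs _), exec_answerAdd n (hs _),
    addDB_qmem_output, update_output, ha]
  rw [Circuit.apply_ket _ _ (isClassical_toggle _ _)]
  rw [ket_congr (v' := fun q : (Bits w × Bits w × Fn w × ι) × Bits w =>
    addDB 0 (Function.update q.1.2.2.1 q.1.1 ((q.1.2.2.1 q.1.1).xor (q.2.and (N q.1.1))))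
      (qmem q.1.1 q.2 (prepared n (s q.1.2.2.2) q.1.1))) ?_]
  swap
  · rintro ⟨⟨x, y, F, i⟩, u⟩ hq
    have hF : (fsupp F).card ≤ j := by
      by_contra hlt
      exact hq (by simp [hψ (x, y, z) F (not_le.1 hlt)])
    obtain ⟨hp1, -, -, hp4, -⟩ := prepared_spec n (hs i) x
    have hN' : qmem x u (prepared n (s i) x) (qc 17 n) = N x := hp4.trans (hN i x)
    have h := fsupp_card_le (Function.update F x ((F x).xor (u.and (N x)))) x (F x)
    rw [Function.update_idem, Function.update_eq_self] at h
    exact exec_toggle F (qmem x u (prepared n (s i) x)) hp1 (by omega) _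
      (by rw [hN']; rfl) (h.trans (by omega))
  rw [Instr.hadamard_ket]
  simp only [addDB_qmem_output, update_output]
  rw [Circuit.apply_ket _ _ hrev]
  simp only [← exec_answerPrep n (hs _), Circuit.exec_reverse_exec, ket]
  rw [← (queryEquiv ι N).sum_comp, Fintype.sum_prod_type, Fintype.sum_prod_type]
  refine Finset.sum_congr rfl fun p _ => ?_
  obtain ⟨x, y, F, i⟩ := p
  have hq := hat_query (fun v => ψ (x, v, z)) (a x) (N x) y x F
  change hat (ψ' (x, y, z)) F = _ at hq
  have hE : ∀ u v, queryEquiv ι N (((x, y, F, i), u), v) =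
      (((x, v, Function.update F x ((F x).xor (u.and (N x))), i), u), y) := fun _ _ => rfl
  simp only [hq, hE, Function.update_self, Function.update_idem, Bits.xor_xor_cancel,
    Function.update_eq_self]
  split_ifs
  · refine Finset.sum_congr rfl fun u _ => Finset.sum_congr rfl fun v _ => ?_
    rw [← inv_sqrt_two_pow, chi_comm y u, chi_xor_right, chi_xor_right, chi_xor_right]
    ring
  · simp

end Push

/-! ### Norms of superpositions, and measurements -/

section Measure

variable {w : ℕ} {L : Type}

lemma tsum_norm_ket_sq {ι : Type} [Fintype ι] (a : ι → ℂ) {v : ι → L → Bits w}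
    (hv : Function.Injective v) : ∑' m, ‖ket a v m‖ ^ 2 = ∑ i, ‖a i‖ ^ 2 := by
  classical
  have h1 : ∀ i, ket a v (v i) = a i := by
    intro i
    rw [ket, Finset.sum_eq_single i (fun j _ hj => if_neg fun h => hj (hv h).symm) (by simp),
      if_pos rfl]
  have h2 : ∀ m, m ∉ Set.range v → ket a v m = 0 := fun m hm =>
    Finset.sum_eq_zero fun i _ => if_neg fun h => hm ⟨i, h.symm⟩
  have h3 : Function.support (fun m => ‖ket a v m‖ ^ 2) ⊆ Set.range v := by
    intro m hm
    by_contra hc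
    exact hm (by simp [h2 m hc])
  rw [← tsum_subtype_eq_of_support_subset h3, ← (Equiv.ofInjective v hv).tsum_eq, tsum_fintype]
  exact Finset.sum_congr rfl fun i _ => by rw [Equiv.ofInjective_apply, h1]

lemma ket_reindex {ι κ : Type} [Fintype ι] [Fintype κ] (e : κ ≃ ι) (a : ι → ℂ)
    (v : ι → L → Bits w) : ket (fun k => a (e k)) (fun k => v (e k)) = ket a v := by
  funext m
  classical exact e.sum_comp fun i => if m = v i then a i else 0

open Classical in
/-- Projecting a superposition. -/
lemma project_ket {ι : Type} [Fintype ι] (a : ι → ℂ) (v : ι → L → Bits w) (q : (L → Bits w) → Prop)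
    (p : ι → Prop) (h : ∀ i, q (v i) ↔ p i) (m : L → Bits w) :
    (if q m then ket a v m else 0) = ket (fun i : {i // p i} => a i) (fun i => v i) m := by
  have h1 : (if q m then ket a v m else 0) = ∑ i, if p i then if m = v i then a i else 0 else 0 := by
    split_ifs with hq
    · refine Finset.sum_congr rfl fun i _ => ?_
      by_cases hm : m = v i
      · rw [if_pos ((h i).1 (hm ▸ hq))]
      · simp [hm]
    · symm
      refine Finset.sum_eq_zero fun i _ => ?_
      by_cases hm : m = v i
      · rw [if_neg fun hp => hq (hm ▸ (h i).2 hp)]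
      · simp [hm]
  rw [h1, ← Finset.sum_filter, ket]
  exact Finset.sum_subtype _ (by simp) _

open Classical in
/-- A memory with the words `c i` in the first `n` cells of a sequence of cells. -/
def fill (cell : ℕ → L) {n : ℕ} (c : Fin n → Bits w) (m : L → Bits w) : L → Bits w := fun x =>
  if h : ∃ i : Fin n, x = cell i then c h.choose else m x

lemma fill_cell {cell : ℕ → L} (hc : Function.Injective cell) {n : ℕ} (c : Fin n → Bits w)
    (m : L → Bits w) (i : Fin n) : fill cell c m (cell i) = c i := by
  have h : ∃ j : Fin n, cell i = cell j := ⟨i, rfl⟩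
  rw [fill, dif_pos h]
  congr 1
  exact Fin.ext (hc h.choose_spec).symm

lemma fill_of_ne {cell : ℕ → L} {n : ℕ} (c : Fin n → Bits w) (m : L → Bits w) {x : L}
    (hx : ∀ i < n, x ≠ cell i) : fill cell c m x = m x :=
  dif_neg fun ⟨i, hi⟩ => hx i i.2 hi

open Classical in
lemma fill_snoc {cell : ℕ → L} (hc : Function.Injective cell) {n : ℕ} (c : Fin n → Bits w)
    (u : Bits w) (m : L → Bits w) :
    fill cell (Fin.snoc c u : Fin (n + 1) → Bits w) m =
      Function.update (fill cell c m) (cell n) u := by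
  funext x
  by_cases hx : ∃ i < n + 1, x = cell i
  · obtain ⟨i, hi, rfl⟩ := hx
    have h := fill_cell hc (Fin.snoc c u : Fin (n + 1) → Bits w) m ⟨i, hi⟩
    rw [h]
    by_cases hin : i = n
    · subst hin
      rw [Function.update_self]
      exact Fin.snoc_last (α := fun _ => Bits w) u c
    · rw [Function.update_of_ne fun h => hin (hc h)]
      have hlt : i < n := by omega
      have h1 := fill_cell hc c m ⟨i, hlt⟩
      rw [h1]
      exact Fin.snoc_castSucc (α := fun _ => Bits w) u c ⟨i, hlt⟩
  · push Not at hx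
    rw [fill_of_ne _ _ hx, Function.update_of_ne (hx n (Nat.lt_succ_self n)),
      fill_of_ne _ _ fun i hi => hx i (hi.trans (Nat.lt_succ_self n))]

/-- Hadamard gates on zero cells produce the uniform superposition. -/
lemma apply_hadamards {ι : Type} [Fintype ι] {cell : ℕ → L} (hc : Function.Injective cell)
    (a : ι → ℂ) (v : ι → L → Bits w) (hv : ∀ p i, v p (cell i) = zeroWord w) (n : ℕ) :
    Circuit.apply ((List.range n).map fun i => .hadamard (cell i)) (ket a v) =
      ket (fun p : ι × (Fin n → Bits w) => (((Real.sqrt 2 : ℂ) ^ w)⁻¹) ^ n * a p.1)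
        fun p => fill cell p.2 (v p.1) := by
  classical
  induction n with
  | zero =>
    rw [← ket_reindex (Equiv.prodUnique ι (Fin 0 → Bits w)).symm]
    simp only [Equiv.prodUnique_symm_apply, pow_zero, one_mul]
    refine ket_congr fun i _ => funext fun x => ?_
    exact (fill_of_ne _ _ (by simp)).symm
  | succ n ih =>
    rw [List.range_succ, List.map_append, Circuit.apply_append, ih, List.map_singleton,
      Circuit.apply_singleton, Instr.hadamard_ket]
    let e : (ι × (Fin n → Bits w)) × Bits w ≃ ι × (Fin (n + 1) → Bits w) :=
      (Equiv.prodAssoc _ _ _).trans (Equiv.prodCongr (Equiv.refl ι)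
        ((Equiv.prodComm _ _).trans (Fin.snocEquiv fun _ => Bits w)))
    have he : ∀ p, e p = (p.1.1, Fin.snoc p.1.2 p.2) := fun _ => rfl
    rw [← ket_reindex e]
    simp only [he, fill_snoc hc]
    congr 1
    funext p
    rw [fill_of_ne _ _ fun i hi h => hi.ne (hc h).symm, hv, chi_comm, chi_zero_left, pow_succ]
    ring

end Measure

section PushMeasure

variable {w : ℕ} {ι : Type} [Fintype ι]

lemma dbMem_injective {F G : Fn w} {s t : SimMemory w} (hs : Clean s) (ht : Clean t)
    (h : dbMem F s = dbMem G t) : F = G ∧ s = t := by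
  have h1 : addDB 0 F (qmem (zeroWord w) (zeroWord w) s) =
      addDB 0 G (qmem (zeroWord w) (zeroWord w) t) := by
    rw [← qmem_dbMem, ← qmem_dbMem, h]
  have hs' : ∀ f k, f ≤ 17 → qmem (zeroWord w) (zeroWord w) s (qc f k) = zeroWord w := hs
  have ht' : ∀ f k, f ≤ 17 → qmem (zeroWord w) (zeroWord w) t (qc f k) = zeroWord w := ht
  have hF : F = G := by
    refine slots_injective (funext fun k => ?_) (funext fun k => ?_)
    · have := congrFun h1 (qc 0 k)
      simpa [addDB_qc, hs', ht', Bits.zero_xor] using this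
    · have := congrFun h1 (qc 1 k)
      simpa [addDB_qc, hs', ht', Bits.zero_xor] using this
  subst hF
  refine ⟨rfl, funext fun c => ?_⟩
  have h2 := congrArg (fun m => addDB 0 F m) h1
  simp only [addDB_addDB] at h2
  exact congrFun h2 (.own c)

/-- The trace of a represented state is its average norm over all values of the random
function, by Parseval's identity. -/
lemma trace_push {R : Type} [Fintype R] {s : ι → SimMemory w} (hs : ∀ i, Clean (s i))
    (hinj : Function.Injective s) (κ : ℂ) (e : MixedState R (Fn w)) :
    MixedState.trace (e.map (onMem (κ • push s))) =
      ‖κ‖ ^ 2 * Fintype.card ι * (wt LinearMap.id e / Fintype.card (Fn w)) := by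
  have hv : Function.Injective fun p : Fn w × ι => dbMem p.1 (s p.2) := by
    rintro ⟨F, i⟩ ⟨G, j⟩ h
    obtain ⟨h1, h2⟩ := dbMem_injective (hs i) (hs j) h
    exact Prod.ext h1 (hinj h2)
  have key : ∀ f : Fn w → ℂ, ∑' m, ‖(κ • push s) f m‖ ^ 2 =
      ‖κ‖ ^ 2 * Fintype.card ι * ((∑ H, ‖f H‖ ^ 2) / Fintype.card (Fn w)) := by
    intro f
    have h1 : ∀ m, ‖(κ • push s) f m‖ ^ 2 = ‖κ‖ ^ 2 * ‖push s f m‖ ^ 2 := fun m => by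
      rw [LinearMap.smul_apply, Pi.smul_apply, norm_smul, mul_pow]
    simp only [h1]
    rw [tsum_mul_left, push_apply, tsum_norm_ket_sq _ hv, Fintype.sum_prod_type, mul_assoc]
    congr 1
    simp only [Finset.sum_const, Finset.card_univ, nsmul_eq_mul]
    rw [← Finset.mul_sum, sum_norm_hat_sq]
  simp only [MixedState.trace, List.map_map, Function.comp_def, onMem, key]
  have h2 : ∀ ψ : StateVec R (Fn w), ∑ r, ‖κ‖ ^ 2 * Fintype.card ι *
      ((∑ H, ‖ψ r H‖ ^ 2) / Fintype.card (Fn w)) =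
      ‖κ‖ ^ 2 * Fintype.card ι / Fintype.card (Fn w) * sqn (onMem LinearMap.id ψ) := by
    intro ψ
    rw [← Finset.mul_sum, ← Finset.sum_div, ← mul_div_assoc, ← mul_div_right_comm]
    rfl
  simp only [h2]
  rw [List.sum_map_mul_left, wt]
  ring

end PushMeasure

/-! ### Commitments and openings of the simulator -/

section CommitOpen

variable {w : ℕ}

/-- The work cell number `k` of the family `f`. -/
abbrev wc (f k : ℕ) : SimCell := .work (Nat.pair f k)

lemma dbMem_of_ne (F : Fn w) (s : SimMemory w) {c : SimCell}
    (h : ∀ k, c ≠ wc 0 k ∧ c ≠ wc 1 k) : dbMem F s c = s c :=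
  addDB_of_ne (m := qmem (zeroWord w) (zeroWord w) s) 0 F (c := .own c) fun k => by
    simpa [qc] using h k

lemma dbMem_congr (F : Fn w) {s t : SimMemory w} {c : SimCell} (h : s c = t c) :
    dbMem F s c = dbMem F t c := by
  rcases c with i | i | i | i
  case work =>
    simp only [dbMem, addDB, addWords, qmem] at h ⊢
    rw [h]
  all_goals exact h

lemma fill_dbMem {cell : ℕ → SimCell} (hcell : ∀ i f k, cell i ≠ wc f k) {n : ℕ}
    (R : Fin n → Bits w) (F : Fn w) (s : SimMemory w) :
    fill cell R (dbMem F s) = dbMem F (fill cell R s) := by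
  funext c
  by_cases h : ∃ i : Fin n, c = cell i
  · obtain ⟨i, rfl⟩ := h
    rw [dbMem_of_ne _ _ fun k => ⟨hcell _ _ _, hcell _ _ _⟩]
    have h1 : ∀ m : SimMemory w, fill cell R m (cell i) = _ := fun m => dif_pos ⟨i, rfl⟩
    rw [h1, h1]
  · have h1 : ∀ m : SimMemory w, fill cell R m c = m c := fun m => dif_neg h
    rw [h1]
    exact dbMem_congr F (h1 s).symm

lemma exec_dbMem {C : Circuit w SimCell} (hC : Avoids C fun c => ∃ k, c = wc 0 k ∨ c = wc 1 k)
    (F : Fn w) (s : SimMemory w) : Circuit.exec C (dbMem F s) = dbMem F (Circuit.exec C s) := by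
  funext c
  have h : ∀ a, (¬∃ k, a = wc 0 k ∨ a = wc 1 k) → dbMem F s a = s a := fun a ha => by
    push Not at ha
    exact dbMem_of_ne F s ha
  have h2 := hC.exec_eq s s (fun _ _ => rfl) c
  rw [hC.exec_eq _ _ h]
  split_ifs with hc
  · rw [if_pos hc] at h2
    exact dbMem_congr F h2.symm
  · push Not at hc
    rw [dbMem_of_ne F _ hc]

/-- The amplitude of each word in the uniform superposition of words. -/
def unifAmp (w : ℕ) : ℂ := ((Real.sqrt 2 : ℂ) ^ w)⁻¹

/-- Cells are filled with uniform superpositions, a classical circuit is applied, and the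
filled cells are measured. -/
lemma project_onMemory_push {R : Type} {ι : Type} [Fintype ι] {cell : ℕ → SimCell}
    (hc : Function.Injective cell) (hcell : ∀ i f k, cell i ≠ wc f k) (n : ℕ)
    {s : ι → SimMemory w} (hs : ∀ p i, s p (cell i) = zeroWord w) {C : Circuit w SimCell}
    (hC : Circuit.IsClassical C) (hC' : Avoids C fun c => ∃ k, c = wc 0 k ∨ c = wc 1 k)
    (P : (Fin n → Bits w) → Prop) [Fintype {X // P X}] (q : SimMemory w → Prop)
    (hq : ∀ F p X, q (dbMem F (Circuit.exec C (fill cell X (s p)))) ↔ P X) (κ : ℂ)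
    (e : MixedState R (Fn w)) :
    project q (onMemory (((List.range n).map fun i => .hadamard (cell i)) ++ C)
      (e.map (onMem (κ • push s)))) =
    e.map (onMem ((unifAmp w ^ n * κ) • push fun p : ι × {X // P X} =>
      Circuit.exec C (fill cell p.2.1 (s p.1)))) := by
  classical
  simp only [project, onMemory, List.map_map]
  refine List.map_congr_left fun ψ _ => ?_
  funext r m
  simp only [Function.comp_apply, onMem]
  set f := ψ r
  have h0 : (κ • push s) f = ket (fun p : Fn w × ι => κ * hat f p.1)
      fun p => dbMem p.1 (s p.2) := by
    have : (κ • push s) f = push s (κ • f) := by rw [map_smul]; rfl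
    rw [this, push_apply, map_smul]
    rfl
  have h1 : Circuit.apply (((List.range n).map fun i => .hadamard (cell i)) ++ C)
      ((κ • push s) f) = ket (fun p : (Fn w × ι) × (Fin n → Bits w) =>
        unifAmp w ^ n * (κ * hat f p.1.1))
        fun p => dbMem p.1.1 (Circuit.exec C (fill cell p.2 (s p.1.2))) := by
    rw [h0, Circuit.apply_append, apply_hadamards hc, Circuit.apply_ket _ _ hC]
    · congr 1
      funext p
      rw [fill_dbMem hcell, exec_dbMem hC']
    · intro p i
      rw [dbMem_of_ne _ _ fun k => ⟨hcell _ _ _, hcell _ _ _⟩, hs]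
  rw [h1]
  refine (project_ket _ _ q (fun p : (Fn w × ι) × (Fin n → Bits w) => P p.2)
    (fun p => hq _ _ _) m).trans ?_
  let eq : (Fn w × ι × {X // P X}) ≃ {p : (Fn w × ι) × (Fin n → Bits w) // P p.2} :=
    { toFun := fun p => ⟨((p.1, p.2.1), p.2.2.1), p.2.2.2⟩
      invFun := fun p => (p.1.1.1, p.1.1.2, ⟨p.1.2, p.2⟩)
      left_inv := fun _ => rfl
      right_inv := fun _ => rfl }
  rw [← ket_reindex eq]
  have h2 : ((unifAmp w ^ n * κ) • push fun p : ι × {X // P X} =>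
      Circuit.exec C (fill cell p.2.1 (s p.1))) f = push (fun p : ι × {X // P X} =>
      Circuit.exec C (fill cell p.2.1 (s p.1))) ((unifAmp w ^ n * κ) • f) := by
    rw [map_smul]; rfl
  rw [h2, push_apply, map_smul]
  refine congrFun (congrArg₂ ket (funext fun p => ?_) rfl) m
  simp [eq, mul_assoc]

/-- The circuit that produces commitments: uniform superpositions of all words. -/
def commitCircuit (w n : ℕ) : Circuit w SimCell := (List.range n).map fun i => .hadamard (.com i)

/-- The points of the commitments (family 18) are computed from the messages and the openings,
and the flag (family 19) is set. Family 20 holds constants, and family 21 the messages as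
masks. -/
def keyPrep (l n : ℕ) : List (Assign (l + 1) SimCell) :=
  (wc 20 0, [.const (Fin.cons false fun _ => true) (wc 20 0)]) ::
  (wc 20 1, [.const (Fin.cons true fun _ => false) (wc 20 1)]) ::
  (wc 20 2, [.const (Bits.toWord (l + 1) (onesWord 1)) (wc 20 2)]) ::
  (wc 19 0, [.const (onesWord (l + 1)) (wc 19 0)]) ::
  ((List.range n).map (fun i => (wc 21 i,
    [.eq (.msg i) (wc 20 2) (wc 21 i) (by simp) (by simp)])) ++
  (List.range n).map (fun i => (wc 18 i,
    [.and (.opn i) (wc 20 0) (wc 18 i) (by simp) (by simp),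
      .and (wc 21 i) (wc 20 1) (wc 18 i) (by simp) (by simp)])))

/-- The circuit that produces openings: uniform superpositions of all words, after which the
random oracle interface is told the points of the commitments. -/
def openCircuit (l n : ℕ) : Circuit (l + 1) SimCell :=
  ((List.range n).map fun i => .hadamard (.opn i)) ++ assignCircuit (keyPrep l n)

lemma wellFormed_keyPrep (l n : ℕ) : WellFormed (keyPrep l n) := by
  constructor
  · intro b hb g hg
    simp only [keyPrep, List.mem_append, List.mem_map, List.mem_cons] at hb
    rcases hb with rfl | rfl | rfl | rfl | ⟨k, -, rfl⟩ | ⟨k, -, rfl⟩ <;>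
    · simp only [List.mem_cons, List.not_mem_nil, or_false] at hg
      rcases hg with rfl | rfl <;> exact ⟨rfl, trivial⟩
  · have hr : ∀ (R : ℕ → ℕ → Prop), (∀ i j, i < j → R i j) → (List.range n).Pairwise R :=
      fun R h => List.pairwise_lt_range.imp fun {i j} => h i j
    simp only [keyPrep, List.pairwise_append, List.pairwise_map, List.pairwise_cons,
      List.forall_mem_append, List.forall_mem_cons, List.forall_mem_map]
    refine ⟨?_, ?_, ?_, ?_, hr _ ?_, hr _ ?_, ?_⟩ <;> simp [Instr.reads] <;> omega

lemma avoids_keyPrep (l n : ℕ) : Avoids (assignCircuit (keyPrep l n))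
    fun c => ∃ k, c = wc 0 k ∨ c = wc 1 k := by
  have h : ∀ b ∈ keyPrep l n, ∀ g ∈ b.2, (¬∃ k, g.target = wc 0 k ∨ g.target = wc 1 k) ∧
      ∀ a ∈ g.reads, ¬∃ k, a = wc 0 k ∨ a = wc 1 k := by
    simp only [keyPrep, List.forall_mem_append, List.forall_mem_cons, List.forall_mem_map]
    simp [Instr.reads, Instr.target]
  intro g hg
  obtain ⟨b, hb, hg⟩ := List.mem_flatMap.1 hg
  exact h b hb g hg

lemma Bits.ofWord_toWord {l w : ℕ} (h : l ≤ w) (s : Bits l) : (s.toWord w).ofWord h = s := by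
  funext j
  have hj := j.2
  simp only [Bits.ofWord, Bits.toWord]
  rw [dif_pos (by omega)]
  congr 1
  exact Fin.ext (by simp; omega)

lemma Bits.toWord_injective {l w : ℕ} (h : l ≤ w) :
    Function.Injective (Bits.toWord w : Bits l → Bits w) := fun s t hst => by
  rw [← Bits.ofWord_toWord h s, hst, Bits.ofWord_toWord]

/-- The effect of `keyPrep`. -/
lemma exec_keyPrep {l n : ℕ} (t : SimMemory (l + 1))
    (hz : ∀ f k, 18 ≤ f → f ≤ 21 → t (wc f k) = zeroWord (l + 1))
    (b : Fin n → Bits 1) (hb : ∀ i : Fin n, t (.msg i) = (b i).toWord (l + 1)) :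
    let e := Circuit.exec (assignCircuit (keyPrep l n)) t
    (∀ i, e (.com i) = t (.com i) ∧ e (.opn i) = t (.opn i)) ∧
    (∀ f k, f ≤ 17 → e (wc f k) = t (wc f k)) ∧ e (wc 19 0) = onesWord (l + 1) ∧
    ∀ i : Fin n, e (wc 18 i) =
      hashInput (b i) ((t (.opn i)).ofWord (Nat.le_succ l)) := by
  intro e
  have hwf := wellFormed_keyPrep l n
  have heq := hwf.exec_eq t
  have hkeep := exec_of_notMem _ (fun b hb g hg => (hwf.target b hb g hg).1) t
  change ∀ b ∈ keyPrep l n, e b.1 = (t b.1).xor (xorSum (b.2.map fun g => g.value e)) at heq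
  change ∀ c, (∀ b ∈ keyPrep l n, c ≠ b.1) → e c = t c at hkeep
  simp only [keyPrep, List.forall_mem_append, List.forall_mem_map, List.forall_mem_cons,
    List.mem_range, List.map_cons, List.map_nil, Instr.value, xorSum_cons, xorSum_nil,
    Bits.xor_zero] at heq hkeep
  obtain ⟨h0, h1, h2, h19, h21, h18⟩ := heq
  rw [hz _ _ (by omega) (by omega), Bits.zero_xor] at h0 h1 h2 h19
  have hopn : ∀ i, e (.opn i) = t (.opn i) := fun i => hkeep _ (by simp)
  refine ⟨fun i => ⟨hkeep _ (by simp), hopn i⟩, fun f k hf => hkeep _ ?_, h19, fun i => ?_⟩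
  · refine ⟨?_, ?_, ?_, ?_, fun j _ => ?_, fun j _ => ?_⟩ <;> simp <;> omega
  · have hmsg : e (.msg i) = (b i).toWord (l + 1) := (hkeep _ (by simp)).trans (hb i)
    have h21' : e (wc 21 i) = Bits.mask (b i 0 = true) := by
      rw [h21 i i.2, hz _ _ (by omega) le_rfl, Bits.zero_xor, hmsg, h2]
      refine Bits.mask_congr ⟨fun h => ?_, fun h => ?_⟩
      · rw [Bits.toWord_injective (by omega) h]
      · congr 1
        funext j
        rw [Subsingleton.elim j 0, h]
    rw [h18 i i.2, hz _ _ le_rfl (by omega), Bits.zero_xor, hopn, h0, h1, h21']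
    funext j
    refine Fin.cases ?_ (fun j => ?_) j
    · simp [Bits.xor, Bits.and, Bits.mask, hashInput]
    · simp only [Bits.xor, Bits.and, hashInput, Fin.cons_succ, Bits.ofWord, Bool.and_true,
        Bool.and_false, Bool.xor_false]
      congr 1
      exact Fin.ext (by simp; omega)

end CommitOpen

/-! ### The simulator -/

/-- The simulator of equivocality. Commitments and openings are measurements of uniform
superpositions; the random oracle interface makes the random function consistent with them once
the commitments are opened. -/
def simulator (l n : ℕ) : EquivSimulator (l + 1) where
  init := []
  ro := answer (l + 1) n
  com := commitCircuit (l + 1) n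
  opn := openCircuit l n

/-- The `j`-th query is answered by a circuit of size linear in `j` and in the number of
commitments; the constant `200` absorbs the mixed terms. -/
lemma simulator_runtime_le (l n q : ℕ) :
    (simulator l n).runtime q ≤ 200 * (q ^ 2 + (n ^ 2 + n + 1)) := by
  have h1 : ∀ j, ((simulator l n).ro j).length = 9 * n + 78 * j + 106 := by
    intro j
    simp [simulator, answer, toggle, updateCircuit, assignCircuit, answerPrep, answerAdd,
      updatePrep, updateCopy, addLayer, Function.comp_def, List.length_flatMap]
    ring
  have h2 : (∑ j ∈ Finset.range q, ((simulator l n).ro j).length) ≤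
      q * (9 * n + 78 * q + 106) := by
    refine (Finset.sum_le_card_nsmul _ _ (9 * n + 78 * q + 106) fun j hj => ?_).trans (by simp)
    have := Finset.mem_range.1 hj
    rw [h1]
    omega
  have h3 : (simulator l n).com.length = n := by simp [simulator, commitCircuit]
  have h4 : (simulator l n).opn.length = 4 * n + 4 := by
    simp [simulator, openCircuit, keyPrep, assignCircuit, Function.comp_def,
      List.length_flatMap]
    ring
  have h5 : (simulator l n).init.length = 0 := rfl
  rw [EquivSimulator.runtime, h3, h4, h5]
  have h6 : q ≤ q ^ 2 := Nat.le_self_pow two_ne_zero q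
  nlinarith [sq_nonneg ((q : ℤ) - n), Nat.zero_le n, two_mul_le_add_sq q n]

/-! ### The answers of the simulator after the opening -/

section Answers

variable {w n : ℕ}

lemma xorSum_eq_zero {l : List (Bits w)} (h : ∀ a ∈ l, a = zeroWord w) :
    xorSum l = zeroWord w := by
  induction l with
  | nil => rfl
  | cons a l ih =>
    rw [xorSum_cons, h a List.mem_cons_self, ih fun b hb => h b (List.mem_cons_of_mem _ hb),
      Bits.xor_self]

lemma xorSum_ofFn_eq (f : Fin n → Bits w) (i : Fin n) (h : ∀ j, j ≠ i → f j = zeroWord w) :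
    xorSum (List.ofFn f) = f i := by
  induction n with
  | zero => exact i.elim0
  | succ n ih =>
    rw [List.ofFn_succ, xorSum_cons]
    refine Fin.cases (fun h => ?_) (fun i h => ?_) i h
    · rw [xorSum_eq_zero, Bits.xor_zero]
      intro a ha
      obtain ⟨j, rfl⟩ := (List.mem_ofFn' _ _).1 ha
      exact h _ (Fin.succ_ne_zero j)
    · rw [h 0 (Fin.succ_ne_zero i).symm, Bits.zero_xor,
        ih (fun j => f j.succ) i fun j hj => h _ fun h2 => hj (Fin.succ_injective _ h2)]

/-- The answers to queries after commitments `c` were opened at the points `x`. -/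
def openedAnswer (x c : Fin n → Bits w) (H : Fn w) : Fn w := fun p =>
  (xorSum (List.ofFn fun i => (c i).and (Bits.mask (p = x i)))).xor
    ((Bits.mask (∀ i, p ≠ x i)).and (H p))

lemma openedAnswer_eq_reprogram {x : Fin n → Bits w} (hx : Function.Injective x)
    (c : Fin n → Bits w) (H : Fn w) : openedAnswer x c H = reprogram x c H := by
  funext p
  rw [openedAnswer, Bits.mask_and]
  by_cases hp : ∃ i, x i = p
  · obtain ⟨i, rfl⟩ := hp
    rw [reprogram_apply hx, if_neg fun h => h i rfl, Bits.xor_zero, xorSum_ofFn_eq _ i,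
      Bits.and_mask, if_pos rfl]
    intro j hj
    rw [Bits.and_mask, if_neg fun h => hj (hx h).symm]
  · rw [reprogram_of_ne _ _ hp, if_pos fun i h => hp ⟨i, h.symm⟩, xorSum_eq_zero, Bits.zero_xor]
    intro a ha
    obtain ⟨j, rfl⟩ := (List.mem_ofFn' _ _).1 ha
    exact (Bits.and_mask _ _).trans (if_neg fun h => hp ⟨j, h.symm⟩)

lemma addWord_eq (s : SimMemory w) (p : Bits w) (x c : Fin n → Bits w)
    (hc : ∀ i : Fin n, s (.com i) = c i) (hx : ∀ i : Fin n, pointMask s p i = Bits.mask (p = x i)) :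
    addWord n s p = xorSum (List.ofFn fun i => (c i).and (Bits.mask (p = x i))) := by
  rw [addWord, List.ofFn_eq_map, ← List.map_coe_finRange_eq_range, List.map_map]
  congr 1
  refine List.map_congr_left fun i _ => ?_
  simp only [Function.comp_apply, hc, hx]

lemma Bits.mask_xor_mask_and (p q : Prop) [Decidable p] [Decidable q] :
    (Bits.mask p : Bits w).xor (Bits.mask (p ∧ q)) = Bits.mask (p ∧ ¬q) := by
  funext i
  by_cases hp : p <;> simp [Bits.mask, Bits.xor, hp]

lemma keepMask_eq (s : SimMemory w) (p : Bits w) (x : Fin n → Bits w)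
    (hx : ∀ i : Fin n, pointMask s p i = Bits.mask (p = x i)) :
    keepMask s p n = Bits.mask (∀ i, p ≠ x i) := by
  induction n with
  | zero => funext j; simp [keepMask, Bits.mask]
  | succ n ih =>
    rw [keepMask, ih (fun i => x i.castSucc) (fun i => hx i.castSucc)]
    have h := hx (Fin.last n)
    rw [Fin.val_last] at h
    rw [h, Bits.mask_and_mask, Bits.mask_xor_mask_and]
    exact Bits.mask_congr (Fin.forall_fin_succ' (P := fun i => p ≠ x i)).symm

end Answers

/-! ### The memory of the simulator in the course of the experiment -/

section Stages

variable {l n : ℕ}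

lemma push_smul_intertwines {w : ℕ} {ι : Type} [Fintype ι] {s : ι → SimMemory w} (κ : ℂ)
    {W : ℕ → Submodule ℂ (Fn w → ℂ)} {g : Fn w → Fn w} {Q : OracleWorld w (SimMemory w)}
    (h : Intertwines (push s) W (ctrl g) Q) : Intertwines (κ • push s) W (ctrl g) Q := by
  intro j d ψ hψ
  refine ⟨?_, (h j d ψ hψ).2⟩
  have h1 := (h j d (fun r => κ • ψ r) fun r => (W j).smul_mem κ (hψ r)).1
  have h2 : ∀ φ : StateVec (QReg w d) (Fn w),
      onMem (κ • push s) φ = onMem (push s) fun r => κ • φ r := by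
    intro φ
    funext r
    simp only [onMem, map_smul]
    rfl
  rw [h2, h1, h2]
  rfl

/-- The memory in which all cells are zero. -/
def zeroMem (w : ℕ) : SimMemory w := fun _ => zeroWord w

lemma clean_zeroMem (w : ℕ) : Clean (zeroMem w) := fun _ _ _ => rfl

lemma hat_one {w : ℕ} (F : Fn w) :
    hat (fun _ => 1) F = if F = fun _ => zeroWord w then 1 else 0 := by
  split_ifs with h
  · subst h
    have hT : (Fintype.card (Bits w → Bits w) : ℂ) ≠ 0 := by
      exact_mod_cast Fintype.card_ne_zero
    simp only [hat_apply, fchi, chi_zero_left, Finset.prod_const_one, mul_one, Finset.sum_const,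
      Finset.card_univ, nsmul_eq_mul]
    exact div_self hT
  · refine const_mem_sparse w 0 1 F (Finset.card_pos.2 ?_)
    obtain ⟨x, hx⟩ := Function.ne_iff.1 h
    exact ⟨x, mem_fsupp.2 hx⟩

/-- The memory of zeros is the empty database, that is, the Fourier transform of the constant
function. -/
lemma blankState_eq (w : ℕ) : blankState w =
    [fun _ _ => 1].map (onMem ((1 : ℂ) • push fun _ : Unit => zeroMem w)) := by
  have h0 : dbMem (fun _ => zeroWord w) (zeroMem w) = zeroMem w := by
    funext c
    rcases c with i | i | i | i
    case work =>
      have h1 : ∀ k, slotX (fun _ : Bits w => zeroWord w) k = zeroWord w := fun k =>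
        slotX_of_le (by simp [fsupp])
      have h2 : ∀ k, slotY (fun _ : Bits w => zeroWord w) k = zeroWord w := fun k =>
        slotY_of_le (by simp [fsupp])
      simp [dbMem, addDB, addWords, qmem, h1, h2, Bits.xor_zero, zeroMem]
    all_goals rfl
  rw [one_smul]
  refine congrArg (fun φ => [φ]) (funext fun r => funext fun m => ?_)
  change _ = ∑ _, _
  rw [Finset.sum_eq_single (fun _ => zeroWord w, ())]
  · dsimp only
    rw [hat_one, if_pos rfl]
    classical exact if_congr (by rw [h0]; rfl) rfl rfl
  · rintro ⟨F, _⟩ - hF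
    dsimp only
    have hF' : ¬F = fun _ => zeroWord w := fun h => hF (by rw [h])
    rw [hat_one, if_neg hF', ite_self]
  · simp

/-- Loading messages, as a map of memories. -/
def loadMem {w k : ℕ} (b : Fin n → Bits k) (s : SimMemory w) : SimMemory w
  | .msg i => if h : i < n then (s (.msg i)).xor ((b ⟨i, h⟩).toWord w) else s (.msg i)
  | c => s c

lemma loadMem_loadMem {w k : ℕ} (b : Fin n → Bits k) (s : SimMemory w) :
    loadMem b (loadMem b s) = s := by
  funext c
  rcases c with i | i | i | i
  case msg =>
    simp only [loadMem]
    split_ifs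
    exacts [Bits.xor_xor_cancel _ _, rfl]
  all_goals rfl

lemma loadMem_dbMem {w k : ℕ} (b : Fin n → Bits k) (F : Fn w) (s : SimMemory w) :
    loadMem b (dbMem F s) = dbMem F (loadMem b s) := by
  funext c
  rcases c with i | i | i | i <;> rfl

lemma loadMessages_push {R : Type} {w k : ℕ} {ι : Type} [Fintype ι] (b : Fin n → Bits k)
    (s : ι → SimMemory w) (κ : ℂ) (e : MixedState R (Fn w)) :
    loadMessages b (e.map (onMem (κ • push s))) =
      e.map (onMem (κ • push fun p => loadMem b (s p))) := by
  classical
  simp only [loadMessages, List.map_map]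
  refine List.map_congr_left fun ψ _ => ?_
  funext r m
  have h : ∀ f : Fn w → ℂ, push (fun p => loadMem b (s p)) f m = push s f (loadMem b m) := by
    intro f
    simp only [push_apply, ket]
    refine Finset.sum_congr rfl fun p _ => if_congr ?_ rfl rfl
    rw [← loadMem_dbMem]
    exact ⟨fun h => by rw [h, loadMem_loadMem], fun h => by rw [← h, loadMem_loadMem]⟩
  simp only [Function.comp_apply, onMem, LinearMap.smul_apply, Pi.smul_apply, h]
  congr 2

/-- The superposition index after a measurement with outcome `u`: all words in which `u` is
stored. -/
abbrev Outcome {k w : ℕ} (h : k ≤ w) (u : Fin n → Bits k) : Type :=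
  {X : Fin n → Bits w // ∀ i, (X i).ofWord h = u i}

/-- All outputs of a measurement are equally likely: each is stored in the same number of tuples
of words. -/
lemma card_outcome {k w : ℕ} (h : k ≤ w) (u : Fin n → Bits k) :
    Fintype.card (Outcome h u) * Fintype.card (Fin n → Bits k) =
      Fintype.card (Fin n → Bits w) := by
  have hx : ∀ (a : Bits w) (v : Bits k),
      (a.xor (v.toWord w)).ofWord h = (a.ofWord h).xor v := fun a v => by
    conv_rhs => rw [← Bits.ofWord_toWord h v]
    rfl
  have hc : ∀ a b : Bits k, a.xor (a.xor b) = b := fun a b => by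
    rw [← Bits.xor_assoc, Bits.xor_self, Bits.zero_xor]
  have hcomm : ∀ a b : Bits k, a.xor b = b.xor a := fun a b => funext fun i => Bool.xor_comm _ _
  have hc' : ∀ a b : Bits k, (a.xor b).xor a = b := fun a b => by rw [hcomm, hc]
  rw [← Fintype.card_prod]
  refine Fintype.card_congr
    { toFun := fun p i => (p.1.1 i).xor ((p.2 i).toWord w)
      invFun := fun Y => (⟨fun i => (Y i).xor ((((Y i).ofWord h).xor (u i)).toWord w), fun i => by
        rw [hx, hc]⟩, fun i => (u i).xor ((Y i).ofWord h))
      left_inv := ?_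
      right_inv := ?_ }
  · rintro ⟨⟨X, hX⟩, v⟩
    have h1 : ∀ i, (u i).xor (((X i).xor ((v i).toWord w)).ofWord h) = v i := fun i => by
      rw [hx, hX, hc]
    have h2 : ∀ i, ((X i).xor ((v i).toWord w)).xor
        (((((X i).xor ((v i).toWord w)).ofWord h).xor (u i)).toWord w) = X i := fun i => by
      rw [hx, hX, hc', Bits.xor_xor_cancel]
    exact Prod.ext (Subtype.ext (funext h2)) (funext h1)
  · intro Y
    funext i
    change ((Y i).xor ((((Y i).ofWord h).xor (u i)).toWord w)).xor
      (((u i).xor ((Y i).ofWord h)).toWord w) = Y i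
    rw [hcomm, Bits.xor_xor_cancel]

/-- The memory after the commitments `c` were made. -/
def committedMem (c : Fin n → Bits (l + 1)) (p : Unit × Outcome (le_refl (l + 1)) c) :
    SimMemory (l + 1) :=
  Circuit.exec [] (fill .com p.2.1 (zeroMem (l + 1)))

/-- The memory after commitments `c` to `b` were opened with `u`. -/
def openedMem (b : Fin n → Bits 1) (c : Fin n → Bits (l + 1)) (u : Fin n → Bits l)
    (p : (Unit × Outcome (le_refl (l + 1)) c) × Outcome (Nat.le_succ l) u) : SimMemory (l + 1) :=
  Circuit.exec (assignCircuit (keyPrep l n)) (fill .opn p.2.1 (loadMem b (committedMem c p.1)))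

lemma com_injective : Function.Injective SimCell.com := fun _ _ h => by injection h

lemma opn_injective : Function.Injective SimCell.opn := fun _ _ h => by injection h

lemma committedMem_com (c : Fin n → Bits (l + 1)) (p : Unit × Outcome (le_refl (l + 1)) c)
    (i : Fin n) : committedMem c p (.com i) = p.2.1 i := fill_cell com_injective _ _ i

lemma committedMem_of_ne (c : Fin n → Bits (l + 1)) (p : Unit × Outcome (le_refl (l + 1)) c)
    {a : SimCell} (h : ∀ i, a ≠ .com i) : committedMem c p a = zeroWord (l + 1) :=
  fill_of_ne _ _ fun i _ => h i

lemma ofWord_self {w : ℕ} (a : Bits w) : a.ofWord (le_refl w) = a := by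
  funext i
  simp only [Bits.ofWord]
  congr 1
  exact Fin.ext (by simp)

/-- After the opening, the masks select exactly the points of the commitments. -/
lemma openedMem_spec (b : Fin n → Bits 1) (c : Fin n → Bits (l + 1)) (u : Fin n → Bits l)
    (p : (Unit × Outcome (le_refl (l + 1)) c) × Outcome (Nat.le_succ l) u) :
    Clean (openedMem b c u p) ∧
    (∀ i : Fin n, openedMem b c u p (.com i) = p.1.2.1 i) ∧
    (∀ i : Fin n, openedMem b c u p (.opn i) = p.2.1 i) ∧
    ∀ (x : Bits (l + 1)) (i : Fin n),
      pointMask (openedMem b c u p) x i = Bits.mask (x = points b u i) := by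
  set t := fill .opn p.2.1 (loadMem b (committedMem c p.1)) with ht
  have h1 : ∀ f k, t (wc f k) = zeroWord (l + 1) := fun f k =>
    (fill_of_ne _ _ fun i _ => by simp).trans (committedMem_of_ne c p.1 fun i => by simp)
  have h2 : ∀ i : Fin n, t (.msg i) = (b i).toWord (l + 1) := by
    intro i
    refine (fill_of_ne _ _ fun i _ => by simp).trans ?_
    simp only [loadMem, i.2, dif_pos]
    rw [committedMem_of_ne c p.1 fun i => by simp, Bits.zero_xor]
  have h3 : ∀ i : Fin n, t (.opn i) = p.2.1 i := fill_cell opn_injective _ _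
  have h4 : ∀ i : Fin n, t (.com i) = p.1.2.1 i := fun i =>
    (fill_of_ne _ _ fun i _ => by simp).trans (committedMem_com c p.1 i)
  obtain ⟨e1, e2, e3, e4⟩ := exec_keyPrep t (fun f k _ _ => h1 f k) b h2
  refine ⟨fun f k hf => (e2 f k hf).trans (h1 f k), fun i => (e1 i).1.trans (h4 i),
    fun i => (e1 i).2.trans (h3 i), fun x i => ?_⟩
  rw [pointMask]
  have h5 : openedMem b c u p (wc 18 i) = points b u i := by
    refine (e4 i).trans ?_
    rw [h3, p.2.2 i]
  have h6 : openedMem b c u p (wc 19 0) = onesWord (l + 1) := e3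
  rw [h5, h6, Bits.mask_and]
  funext j
  by_cases hx : x = points b u i <;> simp [Bits.mask, hx]

end Stages

/-! ### The simulated experiment -/

section Simulation

variable {l n : ℕ}

lemma openedMem_injective (b : Fin n → Bits 1) (c : Fin n → Bits (l + 1)) (u : Fin n → Bits l) :
    Function.Injective (openedMem b c u) := by
  rintro ⟨⟨_, X⟩, Y⟩ ⟨⟨_, X'⟩, Y'⟩ h
  have h1 : X = X' := Subtype.ext <| funext fun i => by
    rw [← (openedMem_spec b c u ⟨⟨(), X⟩, Y⟩).2.1 i, h, (openedMem_spec b c u _).2.1 i]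
  have h2 : Y = Y' := Subtype.ext <| funext fun i => by
    rw [← (openedMem_spec b c u ⟨⟨(), X⟩, Y⟩).2.2.1 i, h, (openedMem_spec b c u _).2.2.1 i]
  rw [h1, h2]

/-- Before an opening, the interface answers with the random function. -/
lemma intertwines_of_unopened {ι : Type} [Fintype ι] {s : ι → SimMemory (l + 1)}
    (hs : ∀ i, Clean (s i)) (h19 : ∀ i, s i (wc 19 0) = zeroWord (l + 1)) (κ : ℂ) :
    Intertwines (κ • push s) (sparse (l + 1)) (ctrl fun H => H) (simulator l n).world := by
  have hp : ∀ i x k, pointMask (s i) x k = zeroWord (l + 1) := fun i x k => by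
    rw [pointMask, h19, Bits.mask_and, ite_self]
  have ha : ∀ i x, addWord n (s i) x = zeroWord (l + 1) := fun i x => by
    refine xorSum_eq_zero fun a ha => ?_
    obtain ⟨k, -, rfl⟩ := List.mem_map.1 ha
    rw [hp]
    funext j
    simp [Bits.and]
  have hN : ∀ i x, keepMask (s i) x n = onesWord (l + 1) := fun i x => by
    have h : ∀ k, keepMask (s i) x k = onesWord (l + 1) := fun k => by
      induction k with
      | zero => rfl
      | succ k ih => rw [keepMask, ih, hp]; funext j; simp [Bits.xor, Bits.and]
    exact h n
  have h := push_intertwines (n := n) (Sim := simulator l n) (fun _ => rfl) hs ha hN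
  have hg : (fun (H : Fn (l + 1)) x => (zeroWord (l + 1)).xor ((onesWord (l + 1)).and (H x))) =
      fun H => H := by
    funext H x j
    simp [Bits.xor, Bits.and]
  rw [hg] at h
  exact push_smul_intertwines κ h

/-- After an opening, the interface answers with the reprogrammed random function. -/
lemma intertwines_of_opened (b : Fin n → Bits 1) (c : Fin n → Bits (l + 1)) (u : Fin n → Bits l)
    (κ : ℂ) : Intertwines (κ • push (openedMem b c u)) (sparse (l + 1))
      (ctrl (openedAnswer (points b u) c)) (simulator l n).world := by
  have h := fun p => openedMem_spec b c u p
  have hcom : ∀ p (i : Fin n), openedMem b c u p (.com i) = c i := fun p i => by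
    rw [(h p).2.1, ← p.1.2.2 i, ofWord_self]
  exact push_smul_intertwines κ (push_intertwines (n := n) (Sim := simulator l n) (fun _ => rfl)
    (fun p => (h p).1) (fun p x => addWord_eq _ x _ _ (hcom p) ((h p).2.2.2 x))
    fun p x => keepMask_eq _ x _ ((h p).2.2.2 x))

lemma run_ctrl_index {w : ℕ} {R R' B M : Type} [Fintype R] [DecidableEq R] [Fintype R']
    [Fintype B] (A : OracleAlg w R R' B) (g : M → Bits w → Bits w) (j j' : ℕ) (b : B)
    (e : MixedState R M) : A.run (ctrl g) j b e = A.run (ctrl g) j' b e := by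
  have h := A.run_map_pull g id j j' b e
  have h1 : ∀ {X : Type} (e : MixedState X M), e.map (onMem (pull id)) = e :=
    fun e => List.map_id _
  rw [h1, h1] at h
  exact h

variable (Adv : EquivAdversary (hashCommitment l n))

/-- The algorithm that chooses the messages. -/
def committer : OracleAlg (l + 1) (Fin 1) (Fin Adv.dim₁) (Fin n → Bits 1) :=
  Adv.rcommit

/-- The algorithm that receives the commitments. -/
def opener (c : Fin n → Bits (l + 1)) : OracleAlg (l + 1) (Fin Adv.dim₁) (Fin Adv.dim₂) Unit :=
  Adv.ropen c

/-- The distinguisher, with curried arguments. -/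
def distinguisher (c : Fin n → Bits (l + 1)) (b : Fin n → Bits 1) (u : Fin n → Bits l) :
    OracleAlg (l + 1) (Fin Adv.dim₂) (Fin 1) Bool :=
  Adv.dist fun i => (c i, b i, u i)

/-- The experiment with the simulator, up to normalisation. -/
def simSum (r : Fin n → Bits l) : ℝ :=
  ∑ b, ∑ p : Fn (l + 1) × (Fin n → Bits (l + 1)),
    endProb (opener Adv) (distinguisher Adv) p.1 (openedAnswer (points b r) p.2 p.1) p.2 b r
      (atLabel p.1 (firstState (committer Adv) b))

lemma norm_unifAmp_sq (w n : ℕ) :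
    ‖unifAmp w ^ n‖ ^ 2 * Fintype.card (Fin n → Bits w) = 1 := by
  have h : ‖unifAmp w‖ ^ 2 = ((2 : ℝ) ^ w)⁻¹ := by
    have h2 : ‖(Real.sqrt 2 : ℂ)‖ = Real.sqrt 2 := by
      rw [Complex.norm_real, Real.norm_of_nonneg (Real.sqrt_nonneg 2)]
    rw [unifAmp, norm_inv, norm_pow, h2, inv_pow, ← pow_mul, mul_comm, pow_mul,
      Real.sq_sqrt (by norm_num)]
  rw [norm_pow, ← pow_mul, mul_comm n, pow_mul, h]
  simp only [Fintype.card_pi, Fintype.card_bool, Finset.prod_const, Finset.card_univ,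
    Fintype.card_fin]
  push_cast
  rw [← mul_pow, inv_mul_cancel₀ (by positivity), one_pow]

/-- One term of the simulated experiment. -/
lemma trace_simulated (b : Fin n → Bits 1) (c : Fin n → Bits (l + 1)) (u : Fin n → Bits l) :
    let Q := (simulator l n).world
    let j₁ := (committer Adv).queries
    let j₂ := j₁ + (opener Adv c).queries
    let ρ₁ := (committer Adv).run Q 0 b (onMemory (simulator l n).init (blankState (l + 1)))
    let σ₁ := project (fun μ => ∀ i : Fin n, (μ (.com i)).ofWord (le_refl (l + 1)) = c i)
      (onMemory (simulator l n).com ρ₁)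
    let ρ₂ := (opener Adv c).run Q j₁ () σ₁
    let σ₂ := project (fun μ => ∀ i : Fin n, (μ (.opn i)).ofWord (Nat.le_succ l) = u i)
      (onMemory (simulator l n).opn (loadMessages b ρ₂))
    MixedState.trace ((distinguisher Adv c b u).run Q j₂ true σ₂) *
      (Fintype.card (Fn (l + 1)) * Fintype.card (Fin n → Bits (l + 1)) *
        Fintype.card (Fin n → Bits l)) =
    ∑ H, endProb (opener Adv) (distinguisher Adv) H (openedAnswer (points b u) c H) c b u
      (atLabel H (firstState (committer Adv) b)) := by
  intro Q j₁ j₂ ρ₁ σ₁ ρ₂ σ₂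
  have h0 : onMemory (simulator l n).init (blankState (l + 1)) =
      [fun _ _ => 1].map (onMem ((1 : ℂ) • push fun _ : Unit => zeroMem (l + 1))) := by
    rw [← blankState_eq]
    exact List.map_id _
  obtain ⟨h1, m1⟩ := (intertwines_of_unopened (l := l) (n := n) (fun _ : Unit => clean_zeroMem _)
    (fun _ => rfl) 1).run (committer Adv) 0 b (e := [fun _ _ => 1]) fun ψ hψ r => by
      obtain rfl := List.mem_singleton.1 hψ
      exact const_mem_sparse _ _ _
  set e₁ := firstState (committer Adv) b with he₁
  have hρ₁ : ρ₁ = e₁.map (onMem ((1 : ℂ) • push fun _ : Unit => zeroMem (l + 1))) :=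
    (congrArg ((committer Adv).run Q 0 b) h0).trans h1
  rw [Nat.zero_add] at m1
  change MemIn (sparse (l + 1) j₁) e₁ at m1
  -- the commitments
  have hσ₁ : σ₁ = e₁.map (onMem ((unifAmp (l + 1) ^ n * 1) • push (committedMem c))) := by
    have h := project_onMemory_push com_injective (fun i f k => by simp) n
      (s := fun _ : Unit => zeroMem (l + 1)) (fun _ _ => rfl) (C := [])
      (fun g hg => absurd hg List.not_mem_nil) (fun g hg => absurd hg List.not_mem_nil)
      (fun X => ∀ i, (X i).ofWord (le_refl (l + 1)) = c i)
      (fun μ => ∀ i : Fin n, (μ (.com i)).ofWord (le_refl (l + 1)) = c i) (fun F p X => by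
        refine forall_congr' fun i => ?_
        rw [dbMem_of_ne _ _ fun k => by simp, Circuit.exec_nil, fill_cell com_injective]) 1 e₁
    rw [List.append_nil] at h
    rw [← hρ₁] at h
    exact h
  have hclean : ∀ p, Clean (committedMem c p) := fun p f k _ =>
    committedMem_of_ne c p fun i => by simp
  obtain ⟨h2, m2⟩ := (intertwines_of_unopened (l := l) (n := n) hclean
    (fun p => committedMem_of_ne c p fun i => by simp)
    (unifAmp (l + 1) ^ n * 1)).run (opener Adv c) j₁ () m1
  set e₂ := (opener Adv c).run (ctrl fun H : Fn (l + 1) => H) j₁ () e₁ with he₂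
  have hρ₂ : ρ₂ = e₂.map (onMem ((unifAmp (l + 1) ^ n * 1) • push (committedMem c))) := by
    rw [← h2, ← hσ₁]
  -- the openings
  have hσ₂ : σ₂ = e₂.map (onMem ((unifAmp (l + 1) ^ n * (unifAmp (l + 1) ^ n * 1)) •
      push (openedMem b c u))) := by
    have h := project_onMemory_push opn_injective (fun i f k => by simp) n
      (s := fun p => loadMem b (committedMem c p)) (fun p i =>
        committedMem_of_ne c p fun i => by simp)
      (wellFormed_keyPrep l n).isClassical (avoids_keyPrep l n)
      (fun X => ∀ i, (X i).ofWord (Nat.le_succ l) = u i)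
      (fun μ => ∀ i : Fin n, (μ (.opn i)).ofWord (Nat.le_succ l) = u i) (fun F p X => by
        refine forall_congr' fun i => ?_
        rw [dbMem_of_ne _ _ fun k => by simp, exec_of_notMem _
          (fun b hb g hg => ((wellFormed_keyPrep l n).target b hb g hg).1) _ _ (by
            simp only [keyPrep, List.forall_mem_append, List.forall_mem_cons,
              List.forall_mem_map]
            simp), fill_cell opn_injective]) (unifAmp (l + 1) ^ n * 1) e₂
    rw [← loadMessages_push, ← hρ₂] at h
    exact h
  obtain ⟨h3, -⟩ := (intertwines_of_opened b c u
    (unifAmp (l + 1) ^ n * (unifAmp (l + 1) ^ n * 1))).run (distinguisher Adv c b u) j₂ true m2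
  rw [← hσ₂] at h3
  rw [h3, trace_push (fun p => (openedMem_spec b c u p).1) (openedMem_injective b c u),
    wt_id]
  have hK := norm_unifAmp_sq (l + 1) n
  have hc1 := card_outcome (le_refl (l + 1)) c
  have hc2 := card_outcome (Nat.le_succ l) u
  have hT : (Fintype.card (Fn (l + 1)) : ℝ) ≠ 0 := by positivity
  have hcoef : ‖unifAmp (l + 1) ^ n * (unifAmp (l + 1) ^ n * 1)‖ ^ 2 *
      Fintype.card ((Unit × Outcome (le_refl (l + 1)) c) × Outcome (Nat.le_succ l) u) *
      (Fintype.card (Fin n → Bits (l + 1)) * Fintype.card (Fin n → Bits l)) = 1 := by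
    have hc1' : ((Fintype.card (Outcome (le_refl (l + 1)) c) : ℕ) : ℝ) *
      Fintype.card (Fin n → Bits (l + 1)) = Fintype.card (Fin n → Bits (l + 1)) := by
      exact_mod_cast hc1
    have hc2' : ((Fintype.card (Outcome (Nat.le_succ l) u) : ℕ) : ℝ) *
      Fintype.card (Fin n → Bits l) = Fintype.card (Fin n → Bits (l + 1)) := by
      exact_mod_cast hc2
    rw [mul_one, norm_mul, mul_pow, Fintype.card_prod, Fintype.card_prod, Fintype.card_unit,
      one_mul]
    push_cast
    calc _ = (‖unifAmp (l + 1) ^ n‖ ^ 2 * ((Fintype.card (Outcome (le_refl (l + 1)) c) : ℕ) *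
        Fintype.card (Fin n → Bits (l + 1)))) * (‖unifAmp (l + 1) ^ n‖ ^ 2 *
        ((Fintype.card (Outcome (Nat.le_succ l) u) : ℕ) * Fintype.card (Fin n → Bits l))) := by
          ring
      _ = 1 := by rw [hc1', hc2', hK, one_mul]
  have hsum : ∀ H, wt (pt H) ((distinguisher Adv c b u).run (ctrl (openedAnswer (points b u) c))
      j₂ true e₂) = endProb (opener Adv) (distinguisher Adv) H (openedAnswer (points b u) c H) c b u
      (atLabel H e₁) := by
    intro H
    rw [endProb, atLabel_run _ (fun H => H) H, atLabel_run, trace_atLabel,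
      run_ctrl_index _ _ j₂ 0, he₂, run_ctrl_index (opener Adv c) _ j₁ 0]
  simp only [hsum]
  calc _ = (‖unifAmp (l + 1) ^ n * (unifAmp (l + 1) ^ n * 1)‖ ^ 2 *
      Fintype.card ((Unit × Outcome (le_refl (l + 1)) c) × Outcome (Nat.le_succ l) u) *
      (Fintype.card (Fin n → Bits (l + 1)) * Fintype.card (Fin n → Bits l))) *
      (∑ H, endProb (opener Adv) (distinguisher Adv) H (openedAnswer (points b u) c H) c b u
      (atLabel H e₁)) * ((Fintype.card (Fn (l + 1)) : ℝ)⁻¹ * Fintype.card (Fn (l + 1))) := by ring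
    _ = _ := by rw [hcoef, inv_mul_cancel₀ hT, one_mul, mul_one]

lemma simProb_eq : simProb (hashCommitment l n) (simulator l n) Adv *
    (Fintype.card (Fn (l + 1)) * Fintype.card (Fin n → Bits (l + 1)) *
      Fintype.card (Fin n → Bits l)) = ∑ r, simSum Adv r := by
  have h : simProb (hashCommitment l n) (simulator l n) Adv *
      (Fintype.card (Fn (l + 1)) * Fintype.card (Fin n → Bits (l + 1)) *
        Fintype.card (Fin n → Bits l)) = ∑ b, ∑ c, ∑ u,
      ∑ H, endProb (opener Adv) (distinguisher Adv) H (openedAnswer (points b u) c H) c b u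
        (atLabel H (firstState (committer Adv) b)) := by
    rw [simProb]
    simp only [Finset.sum_mul]
    exact Finset.sum_congr rfl fun b _ => Finset.sum_congr rfl fun c _ =>
      Finset.sum_congr rfl fun u _ => trace_simulated Adv b c u
  rw [h]
  simp only [simSum, Fintype.sum_prod_type]
  rw [Finset.sum_comm (s := (Finset.univ : Finset (Fin n → Bits l)))]
  refine Finset.sum_congr rfl fun b _ => ?_
  rw [Finset.sum_comm]
  refine Finset.sum_congr rfl fun u _ => ?_
  rw [Finset.sum_comm]

/-- The real experiment in the normalisation of `simProb_eq`. -/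
lemma realProb_eq : realProb (hashCommitment l n) Adv *
    (Fintype.card (Fn (l + 1)) * Fintype.card (Fin n → Bits (l + 1)) *
      Fintype.card (Fin n → Bits l)) =
    ∑ r, realSum (committer Adv) (opener Adv) (distinguisher Adv) r := by
  have h : realProb (hashCommitment l n) Adv =
      (∑ H : Fn (l + 1), (∑ r : Fin n → Bits l, ∑ b, endProb (opener Adv) (distinguisher Adv) H H
        (fun i => H (points b r i)) b r (atLabel H (firstState (committer Adv) b))) /
        Fintype.card (Fin n → Bits l)) / Fintype.card (Fn (l + 1)) := by
    simp only [firstState_atLabel]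
    rfl
  have hT : (Fintype.card (Fn (l + 1)) : ℝ) ≠ 0 := by positivity
  have hN : (Fintype.card (Fin n → Bits l) : ℝ) ≠ 0 := by positivity
  -- the real experiment does not use the second component of the sample space of `realSum`
  have hr : ∀ r, realSum (committer Adv) (opener Adv) (distinguisher Adv) r =
      (∑ H : Fn (l + 1), ∑ b, endProb (opener Adv) (distinguisher Adv) H H
        (fun i => H (points b r i)) b r (atLabel H (firstState (committer Adv) b))) *
        Fintype.card (Fin n → Bits (l + 1)) := fun r => by
    simp only [realSum, Fintype.sum_prod_type, Finset.sum_const, nsmul_eq_mul, Finset.card_univ]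
    rw [Finset.sum_comm, Finset.sum_mul]
    refine Finset.sum_congr rfl fun H _ => ?_
    rw [← Finset.mul_sum, mul_comm]
  simp only [hr]
  rw [h, ← Finset.sum_div, ← Finset.sum_mul, Finset.sum_comm]
  field_simp

/-- The real and the simulated experiment are close. -/
theorem abs_realProb_sub_simProb_le (hn : n ^ 3 ≤ 2 ^ l) {q : ℕ} (hq : 1 ≤ q)
    (hA : Adv.QueriesLE q) :
    |realProb (hashCommitment l n) Adv - simProb (hashCommitment l n) (simulator l n) Adv| ≤
      2 * q * √n / (2 : ℝ) ^ ((l : ℝ) / 2) := by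
  have h := abs_sum_realSum_sub_le (committer Adv) (opener Adv) (distinguisher Adv) hn hq
    (fun c => (Nat.le_add_right _ _).trans (hA c fun i => (c i, fun _ => false, fun _ => false)))
    (simSum Adv) (fun r => sum_endProb_nonneg_le (committer Adv) (opener Adv) (distinguisher Adv)
      (fun _ p => p.1) (fun b p => openedAnswer (points b r) p.2 p.1) (fun _ p => p.2) r)
    (fun r hr => by
      simp only [simSum, openSum, openedAnswer_eq_reprogram (points_injective _ hr)])
  have hX : (0 : ℝ) < Fintype.card (Fn (l + 1)) * Fintype.card (Fin n → Bits (l + 1)) *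
      Fintype.card (Fin n → Bits l) := by positivity
  rw [← realProb_eq, ← simProb_eq, ← sub_mul, abs_mul, abs_of_pos hX] at h
  rw [two_rpow_half, mul_div_assoc]
  exact le_of_mul_le_mul_right h hX

end Simulation

end

theorem mainTheorem8 (n : ℕ → ℕ) (hn : ∃ p : Polynomial ℕ, ∀ l, n l ≤ p.eval l) :
    (∃ (C : ℕ) (p : Polynomial ℕ),
      IsEquivocal (fun l => hashCommitment l (n l)) {l | n l ^ 3 ≤ 2 ^ l}
        (fun l q => 2 * q * Real.sqrt (n l) / (2 : ℝ) ^ ((l : ℝ) / 2))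
        (fun l q => C * (q ^ 2 + p.eval l))) ∧
    IsHiding (fun l => hashCommitment l (n l)) {l | n l ^ 3 ≤ 2 ^ l}
      (fun l q => 2 * (2 * q * Real.sqrt (n l) / (2 : ℝ) ^ ((l : ℝ) / 2))) := by
  obtain ⟨P, hP⟩ := hn
  refine ⟨⟨200, P ^ 2 + P + 1, fun l => simulator l (n l), fun l q => ?_,
    fun q Adv hq hA l hl => abs_realProb_sub_simProb_le (Adv l) hl (hq l) (hA l)⟩,
    fun q Adv m₀ m₁ hq hA l hl =>
      abs_hidingProb_sub_le hl (hq l) (Adv l) (hA l) (m₀ l) (m₁ l)⟩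
  refine (simulator_runtime_le l (n l) q).trans ?_
  have h := hP l
  simp only [Polynomial.eval_add, Polynomial.eval_pow, Polynomial.eval_one]
  gcongr
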